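/- Let $p:\mathcal X\to\mathcal B$ be a proper holomorphic submersion between complex manifolds, with $\dim\mathcal B=m$ and fibres $X_t=p^{-1}(t)$ of dimension $n$. Let $\omega$ be a real, smooth, $d$-closed $(1,1)$-form on $\mathcal X$ that is positive on every fibre, and suppose that $\omega^{n+1}\equiv 0$ (i.e. $p:(\mathcal X,\omega)\to\mathcal B$ is a Poisson--Kähler fibration). Write $\omega_t=\omega|_{X_t}$ and $|X_t|=\int_{X_t}\omega_t^n/n!$. For local holomorphic coordinates $(t^j)$ on $\mathcal B$ let $V_j$ be the horizontal lift of $\partial/\partial t^j$, that is, the $(1,0)$-vector field with $p_*V_j=\partial/\partial t^j$ and $\omega(V_j,W)=0$ for all vertical $W$, let $\kappa_j=(\bar\partial V_j)|_{X_t}$, a $\bar\partial$-closed $(0,1)$-form on $X_t$ with values in $T_{X_t}$, and suppose that for every $t\in\mathcal B$ the Kodaira--Spencer map $T_t\mathcal B\to H^{0,1}(X_t,T_{X_t})$, $\partial/\partial t^j\mapsto[\kappa_j]$, is injective. Define the non-harmonic Weil--Petersson (Donaldson--Fujiki) metric on $\mathcal B$ by $$\Big\langle \frac{\partial}{\partial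 t^j},\frac{\partial}{\partial t^k}\Big\rangle_{\rm DF}(t)=\int_{X_t}\langle\kappa_j,\kappa_k\rangle_{\omega_t}\,\frac{\omega_t^n}{n!},$$ and let $\omega_{\rm DF}=i\sum_{j,k}\langle\partial/\partial t^j,\partial/\partial t^k\rangle_{\rm DF}\,dt^j\wedge d\bar t^k$ be its fundamental form. Then $|X_t|$ is finite and locally constant in $t$ (hence constant if $\mathcal B$ is connected), the integrals defining $\langle\cdot,\cdot\rangle_{\rm DF}$ converge, and: i) $\omega_{\rm DF}$ is a Kähler form (smooth, $d$-closed and positive definite) on $\mathcal B$; ii) the holomorphic sectional curvature of $\omega_{\rm DF}$ satisfies $\dfrac{R(\xi,\bar\xi,\xi,\bar\xi)}{\|\xi\|_{\rm DF}^4}\le-\dfrac{2}{n}\,|X_t|^{-1}$ for all $t\in\mathcal B$ and $0\ne\xi\in T_t\mathcal B$; iii) the holomorphic bisectional curvature of $\omega_{\rm DF}$ is non-positive: $\dfrac{R(\xi,\bar\xi,\eta,\bar\eta)}{\|\xi\|_{\rm DF}^2\,\|\eta\|_{\rm DF}^2}\le0$ for all $t\in\mathcal B$ and $0\ne\xi,\eta\in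 T_t\mathcal B$. Here $G_{j\bar k}=\langle\partial/\partial t^j,\partial/\partial t^k\rangle_{\rm DF}$, the curvature tensor is $R_{j\bar k l\bar q}=-\dfrac{\partial^2G_{j\bar k}}{\partial t^l\,\partial\bar t^q}+\sum_{r,s}G^{r\bar s}\dfrac{\partial G_{j\bar s}}{\partial t^l}\dfrac{\partial G_{r\bar k}}{\partial\bar t^q}$, and $R(\xi,\bar\xi,\eta,\bar\eta)=\sum R_{j\bar kl\bar q}\,\xi^j\bar\xi^k\eta^l\bar\eta^q$. -/

import Mathlib

open scoped Manifold ContDiff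
open MeasureTheory

noncomputable section

namespace PoissonKahler

/-! ### Real two-forms and Kähler forms on complex manifolds

A complex manifold `M` is modelled on a complex normed space `E` through charts with complex
analytic transition maps.  The complex vector space `TangentSpace 𝓘(ℂ, E) x` is the real tangent
space with complex structure `J u = I • u`; it is identified with the holomorphic tangent space
`T^{1,0}` by `u ↦ (u - i J u) / 2`, so that the coordinate vector `∂/∂z^a` corresponds to the
`a`-th basis vector. -/

section Forms

variable {E : Type*} [NormedAddCommGroup E] [NormedSpace ℂ E]
variable {M : Type*} [TopologicalSpace M] [ChartedSpace E M]

instance instFiniteDimensionalTangentSpace [FiniteDimensional ℂ E] (x : M) :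
    FiniteDimensional ℂ (TangentSpace 𝓘(ℂ, E) x) :=
  inferInstanceAs (FiniteDimensional ℂ E)

variable (E M) in
/-- Real-valued differential two-forms (with no regularity imposed). -/
abbrev TwoForm := ∀ x : M, TangentSpace 𝓘(ℂ, E) x [⋀^Fin 2]→L[ℝ] ℝ

/-- The two-form `Ω` written in the chart around `x₀`, i.e. its pull-back by the inverse chart. -/
def TwoForm.inChart (Ω : TwoForm E M) (x₀ : M) (y : E) : E [⋀^Fin 2]→L[ℝ] ℝ :=
  (Ω ((chartAt E x₀).symm y)).compContinuousLinearMap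
    ((mfderiv 𝓘(ℂ, E) 𝓘(ℂ, E) (chartAt E x₀).symm y).restrictScalars ℝ)

/-- `Ω` is a real, smooth, `d`-closed `(1,1)`-form. -/
structure IsClosedOneOne (Ω : TwoForm E M) : Prop where
  smooth : ∀ x₀ : M, ContDiffOn ℝ ∞ (Ω.inChart x₀) (chartAt E x₀).target
  closed : ∀ x₀ : M, ∀ y ∈ (chartAt E x₀).target, extDeriv (Ω.inChart x₀) y = 0
  oneOne : ∀ (x : M) (u v : TangentSpace 𝓘(ℂ, E) x),
    Ω x ![Complex.I • u, Complex.I • v] = Ω x ![u, v]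

/-- `Ω` is a Kähler form: a smooth `d`-closed positive `(1,1)`-form. -/
structure IsKahlerForm (Ω : TwoForm E M) : Prop extends IsClosedOneOne Ω where
  pos : ∀ (x : M) (u : TangentSpace 𝓘(ℂ, E) x), u ≠ 0 → 0 < Ω x ![u, Complex.I • u]

/-- The Hermitian form `⟨u, v⟩ = -i Ω(u^{1,0}, conj v^{1,0})` of a `(1,1)`-form, where
`u^{1,0} = (u - i J u) / 2`.  If `Ω = i ∑ g_{a b̄} dz^a ∧ dz̄^b`, then `⟨∂_a, ∂_b⟩ = g_{a b̄}`. -/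
def TwoForm.herm (Ω : TwoForm E M) (x : M) (u v : TangentSpace 𝓘(ℂ, E) x) : ℂ :=
  ((Ω x ![u, Complex.I • v] : ℂ) - Complex.I * (Ω x ![u, v] : ℂ)) / 2

end Forms

/-- The `k`-fold wedge power `α ∧ ⋯ ∧ α` of an alternating two-form, evaluated on `2k` vectors that
are listed in `k` consecutive pairs (determinant convention: `(dx ∧ dy)(∂_x, ∂_y) = 1`). -/
def wedgePow {V : Type*} [AddCommGroup V] [Module ℝ V] [TopologicalSpace V]
    (α : V [⋀^Fin 2]→L[ℝ] ℝ) (k : ℕ) (v : Fin k × Fin 2 → V) : ℝ :=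
  (2 ^ k : ℝ)⁻¹ * ∑ σ : Equiv.Perm (Fin k × Fin 2),
    ((Equiv.Perm.sign σ : ℤ) : ℝ) * ∏ i : Fin k, α ![v (σ (i, 0)), v (σ (i, 1))]

/-! ### Vector fields of type `(1,0)` and their `∂̄`-derivative -/

section Fields

variable {E : Type*} [NormedAddCommGroup E] [NormedSpace ℂ E]
variable {M : Type*} [TopologicalSpace M] [ChartedSpace E M]

/-- A `(1,0)`-vector field written in the chart around `x₀`. -/
def fieldInChart (V : ∀ x : M, TangentSpace 𝓘(ℂ, E) x) (x₀ : M) (y : E) : E :=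
  mfderiv 𝓘(ℂ, E) 𝓘(ℂ, E) (chartAt E x₀) ((chartAt E x₀).symm y) (V ((chartAt E x₀).symm y))

/-- Smoothness (in the real sense) of a `(1,0)`-vector field. -/
def IsSmoothField (V : ∀ x : M, TangentSpace 𝓘(ℂ, E) x) : Prop :=
  ∀ x₀ : M, ContDiffOn ℝ ∞ (fieldInChart V x₀) (chartAt E x₀).target

/-- The vector `(∂̄V)(w̄) = ∑ (∂V^a/∂z̄^b) w̄^b ∂_a` at `x`, where `V = ∑ V^a ∂_a` in a holomorphic
chart around `x`; it is conjugate-linear in `w`. -/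
def dbar (V : ∀ x : M, TangentSpace 𝓘(ℂ, E) x) (x : M) (w : TangentSpace 𝓘(ℂ, E) x) :
    TangentSpace 𝓘(ℂ, E) x :=
  let φ := chartAt E x
  let a : E := mfderiv 𝓘(ℂ, E) 𝓘(ℂ, E) φ x w
  let D := fderiv ℝ (fieldInChart V x) (φ x)
  mfderiv 𝓘(ℂ, E) 𝓘(ℂ, E) φ.symm (φ x) ((1 / 2 : ℂ) • (D a + Complex.I • D (Complex.I • a)))

/-- The coordinate vector field, in the chart around `t`, with value `v` at `t`. -/
def coordField (t : M) (v : TangentSpace 𝓘(ℂ, E) t) (s : M) : TangentSpace 𝓘(ℂ, E) s :=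
  mfderiv 𝓘(ℂ, E) 𝓘(ℂ, E) (chartAt E t).symm (chartAt E t s)
    (mfderiv 𝓘(ℂ, E) 𝓘(ℂ, E) (chartAt E t) t v)

end Fields

/-! ### Relative Kähler fibrations, horizontal lifts and Kodaira–Spencer tensors -/

section Fibration

variable {E : Type*} [NormedAddCommGroup E] [NormedSpace ℂ E]
variable {F : Type*} [NormedAddCommGroup F] [NormedSpace ℂ F]
variable {X : Type*} [TopologicalSpace X] [ChartedSpace E X]
variable {B : Type*} [TopologicalSpace B] [ChartedSpace F B]

/-- The vertical tangent space at `x`: the tangent space of the fibre of `p` through `x`. -/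
def vert (p : X → B) (x : X) : Submodule ℂ (TangentSpace 𝓘(ℂ, E) x) :=
  LinearMap.ker (mfderiv 𝓘(ℂ, E) 𝓘(ℂ, F) p x).toLinearMap

/-- `Ω` is a relative Kähler form for `p`: a real smooth closed `(1,1)`-form on the total space
which is positive on each fibre. -/
structure IsRelativeKahlerForm (p : X → B) (Ω : TwoForm E X) : Prop
    extends IsClosedOneOne Ω where
  pos_fibre : ∀ (x : X), ∀ u ∈ vert (E := E) (F := F) p x, u ≠ 0 → 0 < Ω x ![u, Complex.I • u]

/-- The horizontal lift to `x` of a tangent vector `v` of the base at `p x`: the (unique) vector `u`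
over `v` with `Ω(u, w) = 0` for all vertical `w`. -/
def hlift (p : X → B) (Ω : TwoForm E X) (x : X) (v : TangentSpace 𝓘(ℂ, F) (p x)) :
    TangentSpace 𝓘(ℂ, E) x :=
  Classical.epsilon fun u : TangentSpace 𝓘(ℂ, E) x =>
    mfderiv 𝓘(ℂ, E) 𝓘(ℂ, F) p x u = v ∧
      ∀ w ∈ vert (E := E) (F := F) p x, Ω x ![u, w] = 0

/-- The `Ω`-Kodaira–Spencer tensor `κ_v = (∂̄V)|_{X_t}` of `v ∈ T_t B`, where `V` is the horizontal
lift of the coordinate field with value `v` at `t`.  It is evaluated at points `x` of the fibre over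
`t` and on (conjugates of) vertical vectors `w`. -/
def kappa (p : X → B) (Ω : TwoForm E X) (t : B) (v : TangentSpace 𝓘(ℂ, F) t) (x : X)
    (w : TangentSpace 𝓘(ℂ, E) x) : TangentSpace 𝓘(ℂ, E) x :=
  dbar (fun x' => hlift p Ω x' (coordField t v (p x'))) x w

/-- Tensors along the fibre over `t` that take a vertical vector to a tangent vector; they contain
the `T_{X_t}`-valued `(0,1)`-forms on the fibre `X_t`. -/
abbrev FibreTensor (p : X → B) (t : B) :=
  ∀ x : {x : X // p x = t}, vert (E := E) (F := F) p x.1 → TangentSpace 𝓘(ℂ, E) x.1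

/-- The space of `∂̄`-exact `T_{X_t}`-valued `(0,1)`-forms on the fibre: the forms `(∂̄W)|_{X_t}` with
`W` a smooth vertical `(1,0)`-vector field.  (Every smooth vector field on the closed submanifold
`X_t` is the restriction of such a `W`, and `(∂̄W)|_{X_t}` depends only on `W|_{X_t}`.) -/
def exactTensors (p : X → B) (t : B) : Submodule ℂ (FibreTensor (E := E) (F := F) p t) :=
  Submodule.span ℂ {K | ∃ W : ∀ x : X, TangentSpace 𝓘(ℂ, E) x, IsSmoothField W ∧
    (∀ x, W x ∈ vert (E := E) (F := F) p x) ∧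
    K = fun (x : {x : X // p x = t}) (w : vert (E := E) (F := F) p x.1) =>
      dbar W x.1 (w : TangentSpace 𝓘(ℂ, E) x.1)}

/-- The Kodaira–Spencer map at `t`: it takes `v ∈ T_t B` to the class of `κ_v` modulo `∂̄`-exact
tensors.  Since `κ_v` is `∂̄`-closed, the class lies in
`H^{0,1}(X_t, T_{X_t}) = {closed} / {exact}`, a subspace of this quotient; as the difference of two
smooth lifts of `v` is a vertical field, the class does not depend on `Ω`. -/
def kodairaSpencer (p : X → B) (Ω : TwoForm E X) (t : B) (v : TangentSpace 𝓘(ℂ, F) t) :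
    FibreTensor (E := E) (F := F) p t ⧸ exactTensors (E := E) (F := F) p t :=
  Submodule.Quotient.mk
    (fun (x : {x : X // p x = t}) (w : vert (E := E) (F := F) p x.1) =>
      kappa p Ω t v x.1 (w : TangentSpace 𝓘(ℂ, E) x.1))

/-- The pointwise Hermitian inner product `⟨κ, κ'⟩` at `x`, with respect to the metric that `Ω`
induces on the fibre through `x`, of two `T_{X_t}`-valued `(0,1)`-forms.  With a basis `b` of the
vertical space and `g_{αβ} = ⟨b_α, b_β⟩` it is `∑ (g⁻¹)_{αβ} ⟨κ(b̄_α), κ'(b̄_β)⟩`, which for an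
orthonormal basis reads `∑ ⟨κ(b̄_α), κ'(b̄_α)⟩`. -/
def tensorInner [FiniteDimensional ℂ E] (p : X → B) (Ω : TwoForm E X) (x : X)
    (κ κ' : TangentSpace 𝓘(ℂ, E) x → TangentSpace 𝓘(ℂ, E) x) : ℂ :=
  let b := Module.finBasis ℂ (vert (E := E) (F := F) p x)
  let g : Matrix _ _ ℂ := Matrix.of fun α β => Ω.herm x (b α) (b β)
  ∑ α, ∑ β, g⁻¹ α β * Ω.herm x (κ (b α)) (κ' (b β))

end Fibration

/-! ### Integration over the fibres -/

section Integration

variable {m n : ℕ}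
variable {X : Type*} [TopologicalSpace X] [ChartedSpace ((Fin m → ℂ) × (Fin n → ℂ)) X]
variable {B : Type*} [TopologicalSpace B] [ChartedSpace (Fin m → ℂ) B]

/-- Holomorphic coordinates `(t, ζ)` on an open set of the total space and `t` on an open set of the
base in which `p` is the projection `(t, ζ) ↦ t`. -/
structure FibredChart (p : X → B) where
  total : OpenPartialHomeomorph X ((Fin m → ℂ) × (Fin n → ℂ))
  base : OpenPartialHomeomorph B (Fin m → ℂ)
  total_mem : total ∈ IsManifold.maximalAtlas 𝓘(ℂ, (Fin m → ℂ) × (Fin n → ℂ)) ω X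
  base_mem : base ∈ IsManifold.maximalAtlas 𝓘(ℂ, Fin m → ℂ) ω B
  map_source : ∀ x ∈ total.source, p x ∈ base.source
  fst_eq : ∀ x ∈ total.source, (total x).1 = base (p x)

/-- The parametrization `ζ ↦ (t, ζ)` of an open part of the fibre over `t`. -/
def FibredChart.param {p : X → B} (c : FibredChart (m := m) (n := n) p) (t : B) (ζ : Fin n → ℂ) : X :=
  c.total.symm (c.base t, ζ)

/-- The domain of the parametrization of the part of the fibre over `t` in the chart. -/
def FibredChart.domain {p : X → B} (c : FibredChart (m := m) (n := n) p) (t : B) : Set (Fin n → ℂ) :=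
  {ζ | t ∈ c.base.source ∧ (c.base t, ζ) ∈ c.total.target}

/-- The coefficient of the volume form `Ω_t^n / n!` of the fibre over `t` with respect to
`dx_1 ∧ dy_1 ∧ ⋯ ∧ dx_n ∧ dy_n`, where `ζ_k = x_k + i y_k` are the fibre coordinates. -/
def FibredChart.density {p : X → B} (c : FibredChart (m := m) (n := n) p)
    (Ω : TwoForm ((Fin m → ℂ) × (Fin n → ℂ)) X) (t : B) (ζ : Fin n → ℂ) : ℝ :=
  (n.factorial : ℝ)⁻¹ * wedgePow (Ω (c.param t ζ)) n fun k : Fin n × Fin 2 =>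
    mfderiv 𝓘(ℂ, Fin n → ℂ) 𝓘(ℂ, (Fin m → ℂ) × (Fin n → ℂ)) (c.param t) ζ
      (Pi.single k.1 (if k.2 = 0 then 1 else Complex.I) : Fin n → ℂ)

/-- The measure `Ω_t^n / n!` on the fibre over `t`, as a measure on `X` carried by that fibre.  Its
restriction to each fibred chart is the density of the form times Lebesgue measure, and as these
restrictions agree on overlaps the measure is their least upper bound. -/
def fibreMeasure [MeasurableSpace X] (p : X → B)
    (Ω : TwoForm ((Fin m → ℂ) × (Fin n → ℂ)) X) (t : B) : Measure X :=
  ⨆ c : FibredChart (m := m) (n := n) p, Measure.map (c.param t)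
    (((volume : Measure (Fin n → ℂ)).restrict (c.domain t)).withDensity
      fun ζ => ENNReal.ofReal (c.density Ω t ζ))

/-- The volume `|X_t| = ∫_{X_t} Ω_t^n / n!` of the fibre over `t`. -/
def fibreVolume [MeasurableSpace X] (p : X → B)
    (Ω : TwoForm ((Fin m → ℂ) × (Fin n → ℂ)) X) (t : B) : ℝ :=
  (fibreMeasure p Ω t).real Set.univ

/-- The pointwise inner product `⟨κ_ξ, κ_η⟩` of Kodaira–Spencer tensors, for `ξ, η ∈ T_t B`. -/
def kappaInner (p : X → B) (Ω : TwoForm ((Fin m → ℂ) × (Fin n → ℂ)) X) (t : B)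
    (ξ η : TangentSpace 𝓘(ℂ, Fin m → ℂ) t) (x : X) : ℂ :=
  tensorInner (F := Fin m → ℂ) p Ω x (kappa p Ω t ξ x) (kappa p Ω t η x)

/-- The non-harmonic Weil–Petersson (Donaldson–Fujiki) metric on the base:
`⟨ξ, η⟩_DF = ∫_{X_t} ⟨κ_ξ, κ_η⟩ Ω_t^n / n!`. -/
def donaldsonFujiki [MeasurableSpace X] (p : X → B)
    (Ω : TwoForm ((Fin m → ℂ) × (Fin n → ℂ)) X) (t : B)
    (ξ η : TangentSpace 𝓘(ℂ, Fin m → ℂ) t) : ℂ :=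
  ∫ x, kappaInner p Ω t ξ η x ∂(fibreMeasure p Ω t)

end Integration

/-! ### Curvature of a Kähler metric -/

section Curvature

variable {m : ℕ} {B : Type*} [TopologicalSpace B] [ChartedSpace (Fin m → ℂ) B]

/-- `∂f/∂z^l`. -/
def wirtinger (l : Fin m) (f : (Fin m → ℂ) → ℂ) (y : Fin m → ℂ) : ℂ :=
  (1 / 2 : ℂ) * (fderiv ℝ f y (Pi.single l 1) - Complex.I * fderiv ℝ f y (Pi.single l Complex.I))

/-- `∂f/∂z̄^l`. -/
def wirtingerBar (l : Fin m) (f : (Fin m → ℂ) → ℂ) (y : Fin m → ℂ) : ℂ :=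
  (1 / 2 : ℂ) * (fderiv ℝ f y (Pi.single l 1) + Complex.I * fderiv ℝ f y (Pi.single l Complex.I))

/-- The matrix `G_{j k̄} = ⟨∂_j, ∂_k⟩` of the metric in the chart around `t₀`. -/
def metricMatrix (Θ : TwoForm (Fin m → ℂ) B) (t₀ : B) (y : Fin m → ℂ) :
    Matrix (Fin m) (Fin m) ℂ :=
  Matrix.of fun j k =>
    Θ.herm ((chartAt (Fin m → ℂ) t₀).symm y)
      (mfderiv 𝓘(ℂ, Fin m → ℂ) 𝓘(ℂ, Fin m → ℂ) (chartAt (Fin m → ℂ) t₀).symm y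
        (Pi.single j 1 : Fin m → ℂ))
      (mfderiv 𝓘(ℂ, Fin m → ℂ) 𝓘(ℂ, Fin m → ℂ) (chartAt (Fin m → ℂ) t₀).symm y
        (Pi.single k 1 : Fin m → ℂ))

/-- The components at `t` of the curvature tensor,
`R_{j k̄ l q̄} = -∂_l ∂_q̄ G_{j k̄} + ∑ G^{r s̄} ∂_l G_{j s̄} ∂_q̄ G_{r k̄}`,
in the chart around `t`. -/
def curvatureCoeff (Θ : TwoForm (Fin m → ℂ) B) (t : B) (j k l q : Fin m) : ℂ :=
  let y := chartAt (Fin m → ℂ) t t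
  (∑ r, ∑ s, (metricMatrix Θ t y)⁻¹ s r
      * wirtinger l (fun z => metricMatrix Θ t z j s) y
      * wirtingerBar q (fun z => metricMatrix Θ t z r k) y)
    - wirtinger l (wirtingerBar q (fun z => metricMatrix Θ t z j k)) y

/-- `R(ξ, ξ̄, η, η̄)` for `ξ, η ∈ T_t B`. -/
def curvature (Θ : TwoForm (Fin m → ℂ) B) (t : B) (ξ η : TangentSpace 𝓘(ℂ, Fin m → ℂ) t) : ℂ :=
  let a : Fin m → ℂ :=
    mfderiv 𝓘(ℂ, Fin m → ℂ) 𝓘(ℂ, Fin m → ℂ) (chartAt (Fin m → ℂ) t) t ξ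
  let b : Fin m → ℂ :=
    mfderiv 𝓘(ℂ, Fin m → ℂ) 𝓘(ℂ, Fin m → ℂ) (chartAt (Fin m → ℂ) t) t η
  ∑ j, ∑ k, ∑ l, ∑ q,
    curvatureCoeff Θ t j k l q * a j * starRingEnd ℂ (a k) * b l * starRingEnd ℂ (b q)

/-- Holomorphic bisectional curvature `R(ξ, ξ̄, η, η̄) / (|ξ|² |η|²)` (a real number). -/
def bisectionalCurvature (Θ : TwoForm (Fin m → ℂ) B) (t : B)
    (ξ η : TangentSpace 𝓘(ℂ, Fin m → ℂ) t) : ℝ :=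
  (curvature Θ t ξ η).re / ((Θ.herm t ξ ξ).re * (Θ.herm t η η).re)

/-- Holomorphic sectional curvature `R(ξ, ξ̄, ξ, ξ̄) / |ξ|⁴`. -/
def sectionalCurvature (Θ : TwoForm (Fin m → ℂ) B) (t : B)
    (ξ : TangentSpace 𝓘(ℂ, Fin m → ℂ) t) : ℝ :=
  bisectionalCurvature Θ t ξ ξ

end Curvature

end PoissonKahler

end

/-!
The curvature of the non-harmonic Weil–Petersson metric is computed by differentiating under the
fibre integral along horizontal lifts, and this works because the horizontal distribution of a
Poisson–Kähler form is as good as it can be.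

In fibred coordinates `(t, ζ)` write `Ω = i ∑ H_{A B̄} dz^A ∧ dz̄^B`, let `g` be the block of fibre
coefficients and `V_j = ∂_j + ∑ a_j^α ∂_α` the horizontal lifts.  The Gram determinant of `V_j` and
`∂_1, …, ∂_n` is a coefficient of `Ω^{n+1} = 0` (`wedgePow_eq_det`) and equals `Ω(V_j, V̄_j) det g`;
hence the horizontal vectors are the kernel of `Ω`
(`IsLocalPoissonKahler.herm2_lift_self`).  With `dΩ = 0` this gives the identities of
`HorizontalCalculus`, proved there in an abstract differential ring:

* the fields `V_j` commute with one another (`V_a_symm`) and with all the `V̄_k` (`Vbar_V`);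
* the Kodaira–Spencer matrices `A_j = (∂a_j^α/∂ζ̄^β)` are symmetric for `g` (`A_symm`), so that
  `⟨κ_j, κ_k⟩ = tr (A_j Ā_k)` (`kappaInner_eq`);
* `V_l (det g) = -(∑ ∂_α a_l^α) det g`, that is, the flow of `V_l` preserves the fibre volume form;
* the covariant derivative `A_{jl}` of `A_j` along `V_l` is symmetric in `j` and `l`,
  `V_l ⟨κ_j, κ_k⟩ = tr (A_{jl} Ā_k)`, and
  `V_l V̄_q ⟨κ_j, κ_k⟩ = tr (A_{jl} Ā_{kq}) + tr (A_j Ā_q A_l Ā_k) + tr (A_l Ā_q A_j Ā_k)`.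

The third identity and Stokes' theorem (in the form: integrals of vertical derivatives of compactly
supported functions vanish) give `∂_l ∫ f = ∫ V_l f` for fibre integrals of compactly supported
functions in one fibred chart (`wirt_localIntegral`).  A partition of the fibre by bump functions,
whose domains contain the neighbouring fibres because `p` is proper, extends this to all smooth
functions (`transportAt`).  It follows that fibre integrals are smooth, that the fibre volume is
locally constant (take `f = 1`), and that `∂_l G_{j k̄} = ∫ tr (A_{jl} Ā_k)` is symmetric in `j` and
`l`, which is the Kähler condition for `G_{j k̄} = ∫ ⟨κ_j, κ_k⟩`.  If the norm of `ξ` vanishes, then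
the tensor `κ_ξ` vanishes identically on the fibre, so injectivity of the Kodaira–Spencer map gives
`ξ = 0` (`donaldsonFujiki_pos`).

For the curvature, let `A_ξ = ∑ ξ^j A_j`, `S = ∑ ξ^j η^l A_{jl}`, and let `P = ∑ x^r A_r` where `x` is
chosen such that `P` is the `L²`-projection of `S` to the span of the `A_r`; by
`exists_dual_vector` this projection accounts exactly for the term of the curvature that is quadratic
in the first derivatives of `G`.  Then
`-R(ξ, ξ̄, η, η̄) = ∫ |S - P|² + tr (A_ξ Ā_η A_η Ā_ξ) + tr (A_η Ā_η A_ξ Ā_ξ)`,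
in which every term is non-negative: in a unitary frame the `A_j` are symmetric matrices
(`exists_unitary_frame`), and the last two traces are norms or traces of products of positive
matrices.  For `ξ = η` the last two terms are equal, and the Cauchy–Schwarz inequality, applied to the
eigenvalues of `A_ξ Ā_ξ` (`sq_trace_le`) and then to the integral over the fibre (`sq_integral_le`),
bounds their integral from below by `(2 / n) ‖ξ‖⁴ / |X_t|`.
-/

noncomputable section

namespace PoissonKahler

/-! ### Differential algebra of the horizontal lift -/

/-- The conjugate `f ↦ star (D (star f))` of a derivation of a commutative star ring. -/
def starDerivation {R : Type*} [CommRing R] [StarRing R] (D : Derivation ℤ R R) :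
    Derivation ℤ R R :=
  Derivation.mk'
    (AddMonoidHom.toIntLinearMap
      { toFun := fun f => star (D (star f))
        map_zero' := by simp
        map_add' := by simp })
    (by intro a b; simp)

@[simp] lemma starDerivation_apply {R : Type*} [CommRing R] [StarRing R] (D : Derivation ℤ R R)
    (f : R) : starDerivation D f = star (D (star f)) := rfl

lemma map_derivation_mul {R κ : Type*} [CommRing R] [Fintype κ] (D : Derivation ℤ R R)
    (M N : Matrix κ κ R) : (M * N).map D = M.map D * N + M * N.map D := by
  ext i j
  simp only [Matrix.map_apply, Matrix.mul_apply, Matrix.add_apply, map_sum, Derivation.leibniz,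
    smul_eq_mul, Finset.sum_add_distrib]
  rw [add_comm]
  congr 1
  exact Finset.sum_congr rfl fun _ _ => mul_comm _ _

lemma derivation_trace {R κ : Type*} [CommRing R] [Fintype κ] (D : Derivation ℤ R R)
    (M : Matrix κ κ R) : D M.trace = (M.map D).trace := by
  simp [Matrix.trace, map_sum]

/-- Jacobi's formula for a derivation. -/
lemma derivation_det {R κ : Type*} [CommRing R] [Fintype κ] [DecidableEq κ] (D : Derivation ℤ R R)
    (M N : Matrix κ κ R) (h : M.map D = N * M) : D M.det = N.trace * M.det := by
  -- The dual number `f + ε D f` is a ring homomorphism in `f`, so it commutes with `det`.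
  let φ : R →+* TrivSqZeroExt R R :=
    { toFun := fun f => TrivSqZeroExt.inl f + TrivSqZeroExt.inr (D f)
      map_one' := by ext <;> simp
      map_zero' := by ext <;> simp
      map_mul' := by
        intro x y
        ext
        · simp
        · simp [Derivation.leibniz, mul_comm (D x)]
      map_add' := by
        intro x y
        ext <;> simp }
  have hsnd : D M.det = (φ M.det).snd := by simp [φ]
  have hε : (TrivSqZeroExt.inr 1 : TrivSqZeroExt R R) ^ 2 = 0 := by
    rw [pow_two, TrivSqZeroExt.inr_mul_inr]
  have hM : M.map φ = (1 + (TrivSqZeroExt.inr 1 : TrivSqZeroExt R R) •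
      N.map (TrivSqZeroExt.inlHom R R)) * M.map (TrivSqZeroExt.inlHom R R) := by
    rw [add_mul, one_mul, smul_mul_assoc, ← Matrix.map_mul, ← h]
    ext i j
    · simp [φ]
    · simp [φ]
  have hdet : φ M.det = (M.map φ).det := RingHom.map_det φ M
  have h1 : (M.map (TrivSqZeroExt.inlHom R R)).det = TrivSqZeroExt.inl M.det :=
    (RingHom.map_det (TrivSqZeroExt.inlHom R R) M).symm
  have h2 : (N.map (TrivSqZeroExt.inlHom R R)).trace = TrivSqZeroExt.inl N.trace :=
    (AddMonoidHom.map_trace (TrivSqZeroExt.inlHom R R).toAddMonoidHom N).symm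
  rw [hsnd, hdet, hM, Matrix.det_mul, Matrix.det_one_add_smul, hε, h1, h2]
  simp [mul_comm]

/-- Entrywise conjugation of a matrix. -/
def cc {R κ : Type*} [Star R] (M : Matrix κ κ R) : Matrix κ κ R := M.map star

section EntrywiseConjugation

variable {R κ : Type*} [CommRing R] [StarRing R]

lemma cc_apply (M : Matrix κ κ R) (i j : κ) : cc M i j = star (M i j) := rfl

lemma cc_mul [Fintype κ] (M N : Matrix κ κ R) : cc (M * N) = cc M * cc N := by
  ext i j; simp [cc, Matrix.mul_apply, star_sum]

lemma cc_cc (M : Matrix κ κ R) : cc (cc M) = M := by ext i j; simp [cc]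

lemma cc_neg (M : Matrix κ κ R) : cc (-M) = -cc M := by ext i j; simp [cc]

lemma cc_add (M N : Matrix κ κ R) : cc (M + N) = cc M + cc N := by ext i j; simp [cc]

end EntrywiseConjugation

/-- The differential algebra of a Poisson–Kähler fibration in fibred coordinates: `ι` indexes the
base coordinates and `κ` the fibre coordinates, `d A` is the Wirtinger derivation `∂_A`, `H A B` are
the coefficients of the form, and `∂_j + ∑ α, a j α ∂_α` spans the horizontal space, which is the
kernel of the form. -/
structure HorizontalCalculus (R ι κ : Type*) [CommRing R] [StarRing R] [Fintype κ]
    [DecidableEq κ] where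
  d : ι ⊕ κ → Derivation ℤ R R
  H : ι ⊕ κ → ι ⊕ κ → R
  a : ι → κ → R
  d_comm : ∀ A B f, d A (d B f) = d B (d A f)
  d_dbar : ∀ A B f, d A (star (d B (star f))) = star (d B (star (d A f)))
  star_H : ∀ A B, star (H A B) = H B A
  closed : ∀ A B C, d A (H B C) = d B (H A C)
  lift_vert : ∀ j β, H (.inl j) (.inr β) + ∑ α, a j α * H (.inr α) (.inr β) = 0
  lift_base : ∀ j k, H (.inl j) (.inl k) + ∑ α, a j α * H (.inr α) (.inl k) = 0
  nondeg : IsUnit (Matrix.det (Matrix.of fun α β => H (.inr α) (.inr β)))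

namespace HorizontalCalculus

variable {R ι κ : Type*} [CommRing R] [StarRing R] [Fintype κ] [DecidableEq κ]
variable (c : HorizontalCalculus R ι κ)

/-- The matrix `g_{α β̄}` of the fibre metric. -/
def g : Matrix κ κ R := Matrix.of fun α β => c.H (.inr α) (.inr β)

/-- The conjugate derivation `∂_Ā`. -/
def dbar (A : ι ⊕ κ) : Derivation ℤ R R := starDerivation (c.d A)

/-- The horizontal derivation `∂_j + ∑ α, a_j^α ∂_α`. -/
def V (j : ι) : Derivation ℤ R R := c.d (.inl j) + ∑ α, c.a j α • c.d (.inr α)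

/-- The conjugate of the horizontal derivation. -/
def Vbar (j : ι) : Derivation ℤ R R := starDerivation (c.V j)

/-- The Kodaira–Spencer matrix `∂a_j^α/∂ζ̄^β`. -/
def A (j : ι) : Matrix κ κ R := Matrix.of fun α β => c.dbar (.inr β) (c.a j α)

/-- The matrix `∂a_j^α/∂ζ^β`. -/
def D (j : ι) : Matrix κ κ R := Matrix.of fun α β => c.d (.inr β) (c.a j α)

/-- The covariant derivative of the Kodaira–Spencer matrix `A j` along the `l`-th horizontal
field. -/
def A₂ (j l : ι) : Matrix κ κ R := (c.A j).map (c.V l) - c.D l * c.A j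

lemma V_apply (j : ι) (f : R) : c.V j f = c.d (.inl j) f + ∑ α, c.a j α * c.d (.inr α) f := by
  have : ∀ s : Finset κ, (∑ α ∈ s, c.a j α • c.d (.inr α)) f = ∑ α ∈ s, c.a j α * c.d (.inr α) f := by
    intro s
    induction s using Finset.cons_induction with
    | empty => simp
    | cons a s ha ih => rw [Finset.sum_cons, Finset.sum_cons, Derivation.add_apply, ih]; rfl
  rw [V, Derivation.add_apply, this]

lemma Vbar_def (j : ι) (f : R) : c.Vbar j f = star (c.V j (star f)) := rfl

lemma Vbar_apply (j : ι) (f : R) :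
    c.Vbar j f = c.dbar (.inl j) f + ∑ α, star (c.a j α) * c.dbar (.inr α) f := by
  simp [Vbar_def, V_apply, dbar]

lemma star_V (j : ι) (f : R) : star (c.V j f) = c.Vbar j (star f) := by simp [Vbar_def]

lemma star_Vbar (j : ι) (f : R) : star (c.Vbar j f) = c.V j (star f) := by simp [Vbar_def]

lemma star_d (A : ι ⊕ κ) (f : R) : star (c.d A f) = c.dbar A (star f) := by simp [dbar]

lemma star_dbar (A : ι ⊕ κ) (f : R) : star (c.dbar A f) = c.d A (star f) := by simp [dbar]

lemma dbar_d (A B : ι ⊕ κ) (f : R) : c.dbar A (c.d B f) = c.d B (c.dbar A f) := by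
  simpa [dbar] using (c.d_dbar B A f).symm

lemma closed_bar (A B C : ι ⊕ κ) : c.dbar A (c.H B C) = c.dbar C (c.H B A) := by
  simp [dbar, c.star_H, c.closed A C]

lemma A_apply (j : ι) (α β : κ) : c.A j α β = c.dbar (.inr β) (c.a j α) := rfl
lemma D_apply (j : ι) (α β : κ) : c.D j α β = c.d (.inr β) (c.a j α) := rfl
lemma g_apply (α β : κ) : c.g α β = c.H (.inr α) (.inr β) := rfl

/-- `g` is a nondegenerate matrix, so a vector annihilated by it vanishes. -/
lemma eq_zero_of_sum_mul_g {v : κ → R} (h : ∀ β, ∑ α, v α * c.g α β = 0) : v = 0 := by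
  have h1 : Matrix.vecMul v c.g = 0 := by
    ext β; simpa [Matrix.vecMul, dotProduct] using h β
  have h2 := congrArg (fun w => Matrix.vecMul w c.g⁻¹) h1
  simpa [Matrix.vecMul_vecMul, Matrix.mul_nonsing_inv c.g c.nondeg] using h2

/-- The Kodaira–Spencer tensors are symmetric with respect to the fibre metric. -/
lemma A_symm (j : ι) : (c.A j).transpose * c.g = c.g.transpose * c.A j := by
  ext β γ
  have h1 := congrArg (c.dbar (.inr β)) (c.lift_vert j γ)
  have h2 := congrArg (c.dbar (.inr γ)) (c.lift_vert j β)
  simp only [map_add, map_sum, Derivation.leibniz, smul_eq_mul, map_zero,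
    Finset.sum_add_distrib] at h1 h2
  rw [c.closed_bar (.inr β) (.inl j) (.inr γ)] at h1
  have h3 : ∑ α, c.a j α * c.dbar (.inr β) (c.H (.inr α) (.inr γ))
      = ∑ α, c.a j α * c.dbar (.inr γ) (c.H (.inr α) (.inr β)) :=
    Finset.sum_congr rfl fun α _ => by rw [c.closed_bar]
  rw [h3] at h1
  simp only [Matrix.mul_apply, Matrix.transpose_apply, A_apply, g_apply]
  have h4 : ∑ α, c.dbar (.inr β) (c.a j α) * c.H (.inr α) (.inr γ) =
    ∑ α, c.H (.inr α) (.inr γ) * c.dbar (.inr β) (c.a j α) :=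
    Finset.sum_congr rfl fun α _ => mul_comm _ _
  rw [h4]
  linear_combination h1 - h2

/-- The horizontal coefficients are constant along the conjugate horizontal fields. -/
lemma Vbar_a (k j : ι) (α : κ) : c.Vbar k (c.a j α) = 0 := by
  have key : (fun α => c.Vbar k (c.a j α)) = 0 := by
    refine c.eq_zero_of_sum_mul_g fun β => ?_
    have h1 := congrArg (c.dbar (.inl k)) (c.lift_vert j β)
    have h2 := congrArg (c.dbar (.inr β)) (c.lift_base j k)
    simp only [map_add, map_sum, Derivation.leibniz, smul_eq_mul, map_zero,
      Finset.sum_add_distrib] at h1 h2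
    rw [c.closed_bar (.inl k) (.inl j) (.inr β)] at h1
    have h3 : ∑ α, c.a j α * c.dbar (.inl k) (c.H (.inr α) (.inr β))
        = ∑ α, c.a j α * c.dbar (.inr β) (c.H (.inr α) (.inl k)) :=
      Finset.sum_congr rfl fun α _ => by rw [c.closed_bar]
    rw [h3] at h1
    -- `H (inr α) (inl k)` is minus the conjugate horizontal coefficient paired with `g`.
    have h4 : ∀ α, c.H (.inr α) (.inl k) = -∑ δ, star (c.a k δ) * c.g α δ := by
      intro α
      have := congrArg star (c.lift_vert k α)
      simp only [star_add, star_sum, star_mul', c.star_H, star_zero] at this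
      exact eq_neg_of_add_eq_zero_left this
    have h5 : ∑ α, c.H (.inr α) (.inl k) * c.dbar (.inr β) (c.a j α)
        = -∑ α, (∑ δ, star (c.a k δ) * c.dbar (.inr δ) (c.a j α)) * c.g α β := by
      have h6 : ∀ δ, ∑ α, c.g α δ * c.dbar (.inr β) (c.a j α)
          = ∑ α, c.dbar (.inr δ) (c.a j α) * c.g α β := by
        intro δ
        have := congrFun (congrFun (c.A_symm j) δ) β
        simpa [Matrix.mul_apply, A_apply] using this.symm
      calc ∑ α, c.H (.inr α) (.inl k) * c.dbar (.inr β) (c.a j α)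
          = -∑ δ, star (c.a k δ) * ∑ α, c.g α δ * c.dbar (.inr β) (c.a j α) := by
            simp only [h4, neg_mul, Finset.sum_neg_distrib, Finset.sum_mul, Finset.mul_sum]
            rw [Finset.sum_comm]
            simp only [mul_assoc]
        _ = _ := by
            simp only [h6, Finset.sum_mul, Finset.mul_sum]
            rw [Finset.sum_comm]
            simp only [mul_assoc]
    simp only [Vbar_apply, add_mul, Finset.sum_add_distrib]
    have h7 : ∑ α, c.dbar (.inl k) (c.a j α) * c.g α β
        = ∑ α, c.H (.inr α) (.inr β) * c.dbar (.inl k) (c.a j α) :=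
      Finset.sum_congr rfl fun α _ => mul_comm _ _
    rw [h7]
    linear_combination h1 - h2 + h5
  exact congrFun key α

lemma V_star_a (k j : ι) (α : κ) : c.V k (star (c.a j α)) = 0 := by
  rw [← star_Vbar, Vbar_a, star_zero]

/-- Derivative of the fibre metric along a horizontal field. -/
lemma V_g (l : ι) : c.g.map (c.V l) = -((c.D l).transpose * c.g) := by
  ext α β
  have h1 := congrArg (c.d (.inr α)) (c.lift_vert l β)
  simp only [map_add, map_sum, Derivation.leibniz, smul_eq_mul, map_zero,
    Finset.sum_add_distrib] at h1
  rw [c.closed (.inr α) (.inl l)] at h1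
  have h3 : ∑ γ, c.a l γ * c.d (.inr α) (c.H (.inr γ) (.inr β))
      = ∑ γ, c.a l γ * c.d (.inr γ) (c.H (.inr α) (.inr β)) :=
    Finset.sum_congr rfl fun γ _ => by rw [c.closed]
  rw [h3] at h1
  simp only [Matrix.map_apply, Matrix.neg_apply, Matrix.mul_apply, Matrix.transpose_apply, D_apply,
    g_apply, V_apply]
  have h4 : ∑ γ, c.d (.inr α) (c.a l γ) * c.H (.inr γ) (.inr β)
      = ∑ γ, c.H (.inr γ) (.inr β) * c.d (.inr α) (c.a l γ) :=
    Finset.sum_congr rfl fun α _ => mul_comm _ _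
  rw [h4]
  linear_combination h1

/-- The horizontal fields commute. -/
lemma V_a_symm (l j : ι) (α : κ) : c.V l (c.a j α) = c.V j (c.a l α) := by
  have key : (fun α => c.V l (c.a j α) - c.V j (c.a l α)) = 0 := by
    refine c.eq_zero_of_sum_mul_g fun β => ?_
    have hV : ∀ l j, ∑ α, c.V l (c.a j α) * c.g α β
        = -c.V l (c.H (.inl j) (.inr β)) + ∑ α, c.a j α * ∑ γ, c.D l γ α * c.g γ β := by
      intro l j
      have h1 := congrArg (c.V l) (c.lift_vert j β)
      simp only [map_add, map_sum, Derivation.leibniz, smul_eq_mul, map_zero,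
        Finset.sum_add_distrib] at h1
      have h2 : ∀ α, c.V l (c.H (.inr α) (.inr β)) = -∑ γ, c.D l γ α * c.g γ β := fun α => by
        simpa [Matrix.mul_apply, g_apply] using congrFun (congrFun (c.V_g l) α) β
      simp only [h2, mul_neg, Finset.sum_neg_distrib] at h1
      have h3 : ∑ α, c.V l (c.a j α) * c.g α β
        = ∑ α, c.H (.inr α) (.inr β) * c.V l (c.a j α) :=
        Finset.sum_congr rfl fun α _ => mul_comm _ _
      rw [h3]
      linear_combination h1
    -- Both second-order terms are symmetric because the form is closed.
    have hH : ∀ l j, c.V l (c.H (.inl j) (.inr β)) = c.d (.inl l) (c.H (.inl j) (.inr β))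
        - ∑ γ, c.a l γ * ((∑ α, c.D j α γ * c.g α β)
          + ∑ α, c.a j α * c.d (.inr γ) (c.H (.inr α) (.inr β))) := by
      intro l j
      rw [V_apply, sub_eq_add_neg, ← Finset.sum_neg_distrib]
      congr 1
      refine Finset.sum_congr rfl fun γ _ => ?_
      have h1 := congrArg (c.d (.inr γ)) (c.lift_vert j β)
      simp only [map_add, map_sum, Derivation.leibniz, smul_eq_mul, map_zero,
        Finset.sum_add_distrib] at h1
      have h3 : ∑ α, c.D j α γ * c.g α β
        = ∑ α, c.H (.inr α) (.inr β) * c.d (.inr γ) (c.a j α) :=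
        Finset.sum_congr rfl fun α _ => mul_comm _ _
      rw [h3]
      linear_combination c.a l γ * h1
    have hs : ∑ γ, c.a l γ * ∑ α, c.a j α * c.d (.inr γ) (c.H (.inr α) (.inr β))
        = ∑ γ, c.a j γ * ∑ α, c.a l α * c.d (.inr γ) (c.H (.inr α) (.inr β)) := by
      simp only [Finset.mul_sum]
      rw [Finset.sum_comm]
      refine Finset.sum_congr rfl fun γ _ => Finset.sum_congr rfl fun α _ => ?_
      rw [c.closed (.inr α)]; ring
    simp only [sub_mul, Finset.sum_sub_distrib]
    rw [hV, hV, hH, hH, c.closed (.inl l)]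
    simp only [mul_add, Finset.sum_add_distrib]
    linear_combination hs
  exact sub_eq_zero.mp (congrFun key α)

/-- The horizontal fields commute with their conjugates. -/
lemma Vbar_V (q l : ι) (f : R) : c.Vbar q (c.V l f) = c.V l (c.Vbar q f) := by
  have h1 : c.Vbar q (c.V l f) = c.Vbar q (c.d (.inl l) f)
      + ∑ α, c.a l α * c.Vbar q (c.d (.inr α) f) := by
    rw [V_apply]
    simp [map_sum, Derivation.leibniz, Vbar_a]
  have h2 : c.V l (c.Vbar q f) = c.V l (c.dbar (.inl q) f)
      + ∑ α, star (c.a q α) * c.V l (c.dbar (.inr α) f) := by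
    rw [Vbar_apply]
    simp [map_sum, Derivation.leibniz, V_star_a]
  rw [h1, h2]
  simp only [Vbar_apply, V_apply, mul_add, Finset.sum_add_distrib, Finset.mul_sum, dbar_d]
  have h3 : ∑ α, ∑ β, c.a l α * (star (c.a q β) * c.d (.inr α) (c.dbar (.inr β) f))
    = ∑ β, ∑ α, star (c.a q β) * (c.a l α * c.d (.inr α) (c.dbar (.inr β) f)) := by
    rw [Finset.sum_comm]
    exact Finset.sum_congr rfl fun _ _ => Finset.sum_congr rfl fun _ _ => mul_left_comm _ _ _
  rw [h3]
  ring

/-- Vertical derivatives of a horizontal derivative. -/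
lemma d_V (l : ι) (β : κ) (f : R) : c.d (.inr β) (c.V l f)
    = c.V l (c.d (.inr β) f) + ∑ γ, c.D l γ β * c.d (.inr γ) f := by
  simp only [V_apply, map_add, map_sum, Derivation.leibniz, smul_eq_mul, D_apply,
    Finset.sum_add_distrib, c.d_comm (.inr β)]
  have : ∑ γ, c.d (.inr γ) f * c.d (.inr β) (c.a l γ) = ∑ γ, c.d (.inr β) (c.a l γ) * c.d (.inr γ) f :=
    Finset.sum_congr rfl fun _ _ => mul_comm _ _
  rw [this]; ring

lemma dbar_V (l : ι) (β : κ) (f : R) : c.dbar (.inr β) (c.V l f)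
    = c.V l (c.dbar (.inr β) f) + ∑ γ, c.A l γ β * c.d (.inr γ) f := by
  simp only [V_apply, map_add, map_sum, Derivation.leibniz, smul_eq_mul, A_apply,
    Finset.sum_add_distrib, dbar_d]
  have : ∑ γ, c.d (.inr γ) f * c.dbar (.inr β) (c.a l γ)
      = ∑ γ, c.dbar (.inr β) (c.a l γ) * c.d (.inr γ) f :=
    Finset.sum_congr rfl fun _ _ => mul_comm _ _
  rw [this]; ring

lemma V_A (l j : ι) (α β : κ) : c.V l (c.A j α β)
    = c.dbar (.inr β) (c.V l (c.a j α)) - ∑ γ, c.A l γ β * c.D j α γ := by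
  rw [dbar_V]; simp [A_apply, D_apply]

/-- The covariant derivative of the Kodaira–Spencer tensors is symmetric in the base directions;
this is the closedness of the Donaldson–Fujiki form. -/
lemma A₂_symm (j l : ι) : c.A₂ j l = c.A₂ l j := by
  ext α β
  simp only [A₂, Matrix.sub_apply, Matrix.map_apply, V_A, Matrix.mul_apply, c.V_a_symm l j]
  have : ∀ l j, ∑ γ, c.A l γ β * c.D j α γ = ∑ γ, c.D j α γ * c.A l γ β := fun l j =>
    Finset.sum_congr rfl fun _ _ => mul_comm _ _
  rw [this, this]; ring

/-- The covariant derivatives of the Kodaira–Spencer tensors are symmetric with respect to the fibre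
metric. -/
lemma A₂_transpose (j l : ι) : (c.A₂ j l).transpose * c.g = c.g.transpose * c.A₂ j l := by
  have h := congrArg (fun M => M.map (c.V l)) (c.A_symm j)
  simp only [map_derivation_mul] at h
  rw [Matrix.transpose_map, Matrix.transpose_map, V_g] at h
  simp only [Matrix.transpose_neg, Matrix.transpose_mul, Matrix.transpose_transpose, mul_neg,
    neg_mul] at h
  simp only [A₂, Matrix.transpose_sub, Matrix.transpose_mul, sub_mul, mul_sub]
  simp only [← mul_assoc] at h ⊢
  rw [sub_eq_add_neg, h]; abel

lemma Vbar_A (k j : ι) : (c.A j).map (c.Vbar k) = -(c.A j * cc (c.D k)) := by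
  ext α β
  have h := congrArg star (c.d_V k β (star (c.a j α)))
  rw [V_star_a] at h
  simp only [map_zero, star_zero, star_add, star_sum, star_mul', star_V, star_d, star_star] at h
  simp only [Matrix.map_apply, Matrix.neg_apply, Matrix.mul_apply, A_apply, cc]
  have h2 : ∑ γ, c.dbar (.inr γ) (c.a j α) * star (c.D k γ β)
    = ∑ γ, star (c.D k γ β) * c.dbar (.inr γ) (c.a j α) :=
    Finset.sum_congr rfl fun _ _ => mul_comm _ _
  rw [h2]
  linear_combination -h

lemma Vbar_D (q l : ι) : (c.D l).map (c.Vbar q) = -(c.A l * cc (c.A q)) := by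
  ext α β
  have h := congrArg star (c.dbar_V q β (star (c.a l α)))
  rw [V_star_a] at h
  simp only [map_zero, star_zero, star_add, star_sum, star_mul', star_V, star_d, star_dbar,
    star_star] at h
  simp only [Matrix.map_apply, Matrix.neg_apply, Matrix.mul_apply, D_apply, cc, A_apply]
  have h2 : ∑ γ, c.dbar (.inr γ) (c.a l α) * star (c.dbar (.inr β) (c.a q γ))
    = ∑ γ, star (c.A q γ β) * c.dbar (.inr γ) (c.a l α) :=
    Finset.sum_congr rfl fun _ _ => mul_comm _ _
  rw [h2]
  linear_combination -h

lemma map_V_cc (l : ι) (M : Matrix κ κ R) : (cc M).map (c.V l) = cc (M.map (c.Vbar l)) := by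
  ext i j; simp [cc, star_Vbar]

lemma map_Vbar_cc (l : ι) (M : Matrix κ κ R) : (cc M).map (c.Vbar l) = cc (M.map (c.V l)) := by
  ext i j; simp [cc, star_V]

lemma map_V_A (j l : ι) : (c.A j).map (c.V l) = c.A₂ j l + c.D l * c.A j := by simp [A₂]

/-- The pointwise inner product `⟨κ_j, κ_k⟩` of the Kodaira–Spencer tensors. -/
def f (j k : ι) : R := (c.A j * cc (c.A k)).trace

lemma V_f (l j k : ι) : c.V l (c.f j k) = (c.A₂ j l * cc (c.A k)).trace := by
  rw [f, derivation_trace, map_derivation_mul, map_V_cc, Vbar_A, map_V_A, cc_neg, cc_mul, cc_cc,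
    add_mul, Matrix.trace_add, Matrix.trace_add, mul_neg, Matrix.trace_neg,
    mul_assoc, Matrix.trace_mul_comm (c.D l), ← mul_assoc]
  ring

lemma Vbar_A₂ (q j l : ι) : (c.A₂ j l).map (c.Vbar q) = -(c.A₂ j l * cc (c.D q))
    + c.A j * cc (c.A q) * c.A l + c.A l * cc (c.A q) * c.A j := by
  have h0 : ((c.A j).map (c.V l)).map (c.Vbar q) = ((c.A j).map (c.Vbar q)).map (c.V l) := by
    ext i k; simp [Vbar_V]
  have h1 : (c.A₂ j l).map (c.Vbar q)
      = ((c.A j).map (c.V l)).map (c.Vbar q) - (c.D l * c.A j).map (c.Vbar q) := by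
    ext i k; simp [A₂]
  have h2 : ∀ M : Matrix κ κ R, (-M).map (c.V l) = -(M.map (c.V l)) := by
    intro M; ext i k; simp
  rw [h1, h0, map_derivation_mul, Vbar_D, Vbar_A, h2, map_derivation_mul, map_V_cc, Vbar_D, cc_neg,
    cc_mul, cc_cc, map_V_A]
  noncomm_ring

/-- The second horizontal derivatives of `⟨κ_j, κ_k⟩`: the terms other than the first one give the
negative curvature. -/
lemma Vbar_V_f (q l j k : ι) : c.Vbar q (c.V l (c.f j k)) = (c.A₂ j l * cc (c.A₂ k q)).trace
    + (c.A j * cc (c.A q) * c.A l * cc (c.A k)).trace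
    + (c.A l * cc (c.A q) * c.A j * cc (c.A k)).trace := by
  rw [V_f, derivation_trace, map_derivation_mul, Vbar_A₂, map_Vbar_cc, map_V_A, cc_add, cc_mul]
  simp only [add_mul, mul_add, Matrix.trace_add, neg_mul, Matrix.trace_neg, mul_assoc]
  ring

/-- The volume density of the fibres is transported by the horizontal fields: its divergence along
them vanishes. -/
lemma divergence_det (l : ι) :
    c.d (.inl l) c.g.det + ∑ α, c.d (.inr α) (c.a l α * c.g.det) = 0 := by
  have h := derivation_det (c.V l) c.g (-(c.D l).transpose) (by rw [V_g, neg_mul])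
  rw [V_apply, Matrix.trace_neg, Matrix.trace_transpose] at h
  simp only [Derivation.leibniz, smul_eq_mul, Finset.sum_add_distrib, ← Finset.mul_sum]
  have h2 : (c.D l).trace = ∑ α, c.d (.inr α) (c.a l α) := rfl
  rw [h2] at h
  linear_combination h

/-- The product of a horizontal derivative with the volume density is a total divergence. -/
lemma V_mul_det (l : ι) (f : R) : c.V l f * c.g.det
    = c.d (.inl l) (f * c.g.det) + ∑ α, c.d (.inr α) (c.a l α * (f * c.g.det)) := by
  have h := c.divergence_det l
  have h4 : ∀ α, c.d (.inr α) (c.a l α * (f * c.g.det))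
      = f * c.d (.inr α) (c.a l α * c.g.det) + c.a l α * c.d (.inr α) f * c.g.det := by
    intro α
    rw [mul_left_comm, Derivation.leibniz, smul_eq_mul, smul_eq_mul]
    ring
  rw [Finset.sum_congr rfl fun α _ => h4 α, Finset.sum_add_distrib, ← Finset.mul_sum,
    ← Finset.sum_mul, Derivation.leibniz, V_apply, smul_eq_mul, smul_eq_mul]
  linear_combination -f * h

end HorizontalCalculus

/-! ### Hermitian forms of real (1,1)-forms and their wedge powers -/

section Herm

variable {V : Type*} [AddCommGroup V] [Module ℂ V] [TopologicalSpace V]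

/-- The Hermitian form `(α(u, iv) - i α(u, v)) / 2` of a real `(1,1)`-form `α`. -/
def herm2 (α : V [⋀^Fin 2]→L[ℝ] ℝ) (u v : V) : ℂ :=
  ((α ![u, Complex.I • v] : ℂ) - Complex.I * (α ![u, v] : ℂ)) / 2

variable {α : V [⋀^Fin 2]→L[ℝ] ℝ}

omit [TopologicalSpace V] [Module ℂ V] [AddCommGroup V] in
lemma update_pair_zero (u v x : V) : Function.update ![u, v] 0 x = ![x, v] := by
  ext i; fin_cases i <;> simp

omit [TopologicalSpace V] [Module ℂ V] [AddCommGroup V] in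
lemma update_pair_one (u v x : V) : Function.update ![u, v] 1 x = ![u, x] := by
  ext i; fin_cases i <;> simp

lemma form_add_left (u u' v : V) : α ![u + u', v] = α ![u, v] + α ![u', v] := by
  have h := α.toAlternatingMap.map_update_add ![u, v] 0 u u'
  simp only [update_pair_zero] at h
  exact h

lemma form_add_right (u v v' : V) : α ![u, v + v'] = α ![u, v] + α ![u, v'] := by
  have h := α.toAlternatingMap.map_update_add ![u, v] 1 v v'
  simp only [update_pair_one] at h
  exact h

lemma form_smul_left (r : ℝ) (u v : V) : α ![r • u, v] = r * α ![u, v] := by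
  have h := α.toAlternatingMap.map_update_smul ![u, v] 0 r u
  simp only [update_pair_zero] at h
  exact h

lemma form_smul_right (r : ℝ) (u v : V) : α ![u, r • v] = r * α ![u, v] := by
  have h := α.toAlternatingMap.map_update_smul ![u, v] 1 r v
  simp only [update_pair_one] at h
  exact h

lemma form_swap (u v : V) : α ![v, u] = -α ![u, v] := by
  have := α.toAlternatingMap.map_swap ![u, v] (show (0 : Fin 2) ≠ 1 by decide)
  have h2 : (![u, v] ∘ (Equiv.swap (0 : Fin 2) 1)) = ![v, u] := by
    ext i; fin_cases i <;> simp
  rw [h2] at this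
  exact this

lemma form_neg_right (u v : V) : α ![u, -v] = -α ![u, v] := by
  simpa using form_smul_right (α := α) (-1) u v

lemma form_neg_left (u v : V) : α ![-u, v] = -α ![u, v] := by
  simpa using form_smul_left (α := α) (-1) u v

lemma form_I_left (hα : ∀ u v, α ![Complex.I • u, Complex.I • v] = α ![u, v]) (u v : V) :
    α ![Complex.I • u, v] = -α ![u, Complex.I • v] := by
  rw [← hα u, smul_smul, Complex.I_mul_I, neg_smul, one_smul, form_neg_right, neg_neg]

lemma herm2_add_left (u u' v : V) : herm2 α (u + u') v = herm2 α u v + herm2 α u' v := by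
  simp only [herm2, form_add_left]; push_cast; ring

lemma herm2_conj (hα : ∀ u v, α ![Complex.I • u, Complex.I • v] = α ![u, v]) (u v : V) :
    star (herm2 α u v) = herm2 α v u := by
  have h1 : α ![v, Complex.I • u] = α ![u, Complex.I • v] := by
    rw [form_swap, form_I_left hα, neg_neg]
  simp only [herm2, h1, form_swap u v, Complex.star_def, map_div₀, map_sub, map_mul,
    Complex.conj_ofReal, Complex.conj_I, map_ofNat]
  push_cast; ring

lemma herm2_add_right (u v v' : V) : herm2 α u (v + v') = herm2 α u v + herm2 α u v' := by
  simp only [herm2, smul_add, form_add_right]; push_cast; ring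

lemma herm2_smul_left (hα : ∀ u v, α ![Complex.I • u, Complex.I • v] = α ![u, v]) (z : ℂ) (u v : V) :
    herm2 α (z • u) v = z * herm2 α u v := by
  have hz : z • u = z.re • u + z.im • (Complex.I • u) := by
    conv_lhs => rw [← Complex.re_add_im z]
    rw [add_smul, mul_smul]
    rfl
  have h2 : herm2 α (Complex.I • u) v = Complex.I * herm2 α u v := by
    simp only [herm2, form_I_left hα, smul_smul, Complex.I_mul_I, neg_smul, one_smul,
      form_neg_right]
    push_cast
    linear_combination (α ![u, v] / 2 : ℂ) * Complex.I_mul_I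
  have h3 : ∀ (r : ℝ) (w : V), herm2 α (r • w) v = r * herm2 α w v := by
    intro r w; simp only [herm2, form_smul_left]; push_cast; ring
  rw [hz, herm2_add_left, h3, h3, h2]
  conv_rhs => rw [← Complex.re_add_im z]
  ring

lemma herm2_smul_right (hα : ∀ u v, α ![Complex.I • u, Complex.I • v] = α ![u, v]) (z : ℂ)
    (u v : V) : herm2 α u (z • v) = star z * herm2 α u v := by
  rw [← herm2_conj hα, herm2_smul_left hα, star_mul', herm2_conj hα]

lemma herm2_zero_left (hα : ∀ u v, α ![Complex.I • u, Complex.I • v] = α ![u, v]) (v : V) :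
    herm2 α 0 v = 0 := by simpa using herm2_smul_left hα 0 0 v

lemma herm2_sum_left (hα : ∀ u v, α ![Complex.I • u, Complex.I • v] = α ![u, v]) {ι : Type*}
    (s : Finset ι) (z : ι → ℂ) (u : ι → V) (v : V) :
    herm2 α (∑ i ∈ s, z i • u i) v = ∑ i ∈ s, z i * herm2 α (u i) v := by
  induction s using Finset.cons_induction with
  | empty => simp [herm2_zero_left hα]
  | cons a s ha ih => rw [Finset.sum_cons, Finset.sum_cons, herm2_add_left, herm2_smul_left hα, ih]

lemma herm2_sum_right (hα : ∀ u v, α ![Complex.I • u, Complex.I • v] = α ![u, v]) {ι : Type*}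
    (s : Finset ι) (z : ι → ℂ) (u : V) (v : ι → V) :
    herm2 α u (∑ i ∈ s, z i • v i) = ∑ i ∈ s, star (z i) * herm2 α u (v i) := by
  rw [← herm2_conj hα, herm2_sum_left hα, star_sum]
  exact Finset.sum_congr rfl fun i _ => by rw [star_mul', herm2_conj hα]

lemma form_eq_herm2 (hα : ∀ u v, α ![Complex.I • u, Complex.I • v] = α ![u, v]) (u v : V) :
    (α ![u, v] : ℂ) = Complex.I * (herm2 α u v - herm2 α v u) := by
  have h1 : α ![v, Complex.I • u] = α ![u, Complex.I • v] := by
    rw [form_swap, form_I_left hα, neg_neg]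
  simp only [herm2, h1, form_swap u v]
  push_cast
  linear_combination (α ![u, v] : ℂ) * Complex.I_mul_I

lemma herm2_self (u : V) : herm2 α u u = ((α ![u, Complex.I • u] / 2 : ℝ) : ℂ) := by
  have h : α ![u, u] = 0 := by linarith [form_swap (α := α) u u]
  simp [herm2, h]

lemma form_eq_zero_of_herm2 (hα : ∀ u v, α ![Complex.I • u, Complex.I • v] = α ![u, v]) (u v : V)
    (h : herm2 α u v = 0) : α ![u, v] = 0 := by
  have h1 : herm2 α v u = 0 := by rw [← herm2_conj hα, h, star_zero]
  have := form_eq_herm2 hα u v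
  rw [h, h1] at this
  simpa using this

end Herm

section Pfaffian

variable {k : ℕ}

/-- Antisymmetrising a product over pairs of a bilinear expression. -/
lemma sum_perm_prod_sub_swap (B : Fin k × Fin 2 → Fin k × Fin 2 → ℂ) :
    ∑ σ : Equiv.Perm (Fin k × Fin 2), ((Equiv.Perm.sign σ : ℤ) : ℂ) *
      ∏ i : Fin k, (B (σ (i, 0)) (σ (i, 1)) - B (σ (i, 1)) (σ (i, 0)))
    = 2 ^ k * ∑ σ : Equiv.Perm (Fin k × Fin 2), ((Equiv.Perm.sign σ : ℤ) : ℂ) *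
      ∏ i : Fin k, B (σ (i, 0)) (σ (i, 1)) := by
  have h1 : ∀ x y, B x y - B y x = ∑ s : Bool, (if s then -1 else 1) *
      (if s then B y x else B x y) := by
    intro x y; simp [sub_eq_neg_add]
  let τ : (Fin k → Bool) → Equiv.Perm (Fin k × Fin 2) := fun f =>
    Equiv.prodCongrRight fun i => if f i then Equiv.swap 0 1 else 1
  have hτ : ∀ f, ((Equiv.Perm.sign (τ f) : ℤ) : ℂ) = ∏ i, (if f i then -1 else 1) := by
    intro f
    simp only [τ, Equiv.Perm.sign_prodCongrRight]
    push_cast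
    refine Finset.prod_congr rfl fun i _ => ?_
    cases f i <;> simp
  simp only [h1, Finset.prod_univ_sum, Fintype.piFinset_univ, Finset.mul_sum]
  rw [Finset.sum_comm]
  have h2 : ∀ f : Fin k → Bool, ∑ σ : Equiv.Perm (Fin k × Fin 2), ((Equiv.Perm.sign σ : ℤ) : ℂ) *
      ∏ i, ((if f i then -1 else 1) *
        (if f i then B (σ (i, 1)) (σ (i, 0)) else B (σ (i, 0)) (σ (i, 1))))
      = ∑ σ : Equiv.Perm (Fin k × Fin 2), ((Equiv.Perm.sign σ : ℤ) : ℂ) *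
      ∏ i : Fin k, B (σ (i, 0)) (σ (i, 1)) := by
    intro f
    refine Fintype.sum_equiv (Equiv.mulRight (τ f)) _ _ fun σ => ?_
    rw [Finset.prod_mul_distrib, ← hτ, Equiv.coe_mulRight, Equiv.Perm.sign_mul]
    push_cast
    rw [← mul_assoc]
    congr 1
    refine Finset.prod_congr rfl fun i _ => ?_
    cases h : f i <;> simp [τ, h]
  rw [Finset.sum_congr rfl fun f _ => h2 f]
  simp [Finset.mul_sum]

/-- Sums over all pairs of permutations of products of matrix entries give the determinant. -/
lemma sum_perm_perm_prod (G : Matrix (Fin k) (Fin k) ℂ) :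
    ∑ a : Equiv.Perm (Fin k), ∑ b : Equiv.Perm (Fin k),
      ((Equiv.Perm.sign a : ℤ) : ℂ) * ((Equiv.Perm.sign b : ℤ) : ℂ) * ∏ i, G (a i) (b i)
    = k.factorial * G.det := by
  rw [Finset.sum_comm]
  have h : ∀ b : Equiv.Perm (Fin k), ∑ a : Equiv.Perm (Fin k),
      ((Equiv.Perm.sign a : ℤ) : ℂ) * ((Equiv.Perm.sign b : ℤ) : ℂ) * ∏ i, G (a i) (b i) = G.det := by
    intro b
    rw [Matrix.det_apply']
    refine Fintype.sum_equiv (Equiv.mulRight b⁻¹) _ _ fun a => ?_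
    rw [Equiv.coe_mulRight, Equiv.Perm.sign_mul, Equiv.Perm.sign_inv]
    push_cast
    congr 1
    exact Fintype.prod_equiv b _ _ fun i => by simp
  rw [Finset.sum_congr rfl fun b _ => h b]
  simp [Fintype.card_perm]

/-- The vectors `u_i` and `i u_i` have the coefficients `1, i` along the `(1,0)`-part of `u_i` and
`1, -i` along its conjugate.  The determinant is that of the matrix of their coefficients along the
`(1,0)`-parts of the `u_{a r}` and the conjugates of those of the `u_{b r}`; it is zero unless `a` and
`b` are permutations. -/
lemma det_pairs (a b : Fin k → Fin k) :
    (Matrix.of fun (q r : Fin k × Fin 2) => if q.1 = (if r.2 = 0 then a r.1 else b r.1) then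
      (if q.2 = 0 then 1 else if r.2 = 0 then Complex.I else -Complex.I) else 0).det
    = (Matrix.of fun q r : Fin k => if q = a r then (1 : ℂ) else 0).det *
      (Matrix.of fun q r : Fin k => if q = b r then (1 : ℂ) else 0).det * (-2 * Complex.I) ^ k := by
  by_cases ha : Function.Injective a
  swap
  · obtain ⟨i, j, hij, hne⟩ : ∃ i j, a i = a j ∧ i ≠ j := by
      simpa [Function.Injective] using ha
    rw [Matrix.det_zero_of_column_eq (i := (i, 0)) (j := (j, 0)) (by simpa using hne)
      (by intro q; simp [hij])]
    rw [Matrix.det_zero_of_column_eq (i := i) (j := j) hne (by intro q; simp [hij])]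
    simp
  by_cases hb : Function.Injective b
  swap
  · obtain ⟨i, j, hij, hne⟩ : ∃ i j, b i = b j ∧ i ≠ j := by
      simpa [Function.Injective] using hb
    rw [Matrix.det_zero_of_column_eq (i := (i, 1)) (j := (j, 1)) (by simpa using hne)
      (by intro q; simp [hij])]
    rw [Matrix.det_zero_of_column_eq (M := Matrix.of fun q r : Fin k => if q = b r then (1 : ℂ) else 0)
      (i := i) (j := j) hne (by intro q; simp [hij])]
    simp
  let a' : Equiv.Perm (Fin k) := Equiv.ofBijective a (Finite.injective_iff_bijective.mp ha)
  let b' : Equiv.Perm (Fin k) := Equiv.ofBijective b (Finite.injective_iff_bijective.mp hb)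
  have hperm : ∀ c : Equiv.Perm (Fin k),
      (Matrix.of fun q r : Fin k => if q = c r then (1 : ℂ) else 0).det
        = ((Equiv.Perm.sign c : ℤ) : ℂ) := by
    intro c
    have : (Matrix.of fun q r : Fin k => if q = c r then (1 : ℂ) else 0)
        = (1 : Matrix (Fin k) (Fin k) ℂ).submatrix id c := by
      ext q r; simp [Matrix.one_apply]
    rw [this, Matrix.det_permute', Matrix.det_one, mul_one]
  have h1 := hperm a'
  have h2 := hperm b'
  simp only [a', b', Equiv.ofBijective_apply] at h1 h2
  rw [h1, h2]
  let M : Matrix (Fin k × Fin 2) (Fin k × Fin 2) ℂ := Matrix.of fun q r => if q.1 = r.1 then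
      (if q.2 = 0 then 1 else if r.2 = 0 then Complex.I else -Complex.I) else 0
  let τ : Equiv.Perm (Fin k × Fin 2) := Equiv.prodCongrLeft fun s => if s = 0 then a' else b'
  have hM : (Matrix.of fun (q r : Fin k × Fin 2) => if q.1 = (if r.2 = 0 then a r.1 else b r.1) then
      (if q.2 = 0 then 1 else if r.2 = 0 then Complex.I else -Complex.I) else 0)
      = M.submatrix id τ := by
    ext q ⟨i, s⟩
    fin_cases s <;> simp [M, τ, a', b']
  have hMdet : M.det = (-2 * Complex.I) ^ k := by
    have : M = (Matrix.blockDiagonal fun _ : Fin k => !![1, 1; Complex.I, -Complex.I]).submatrix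
        (Equiv.prodComm _ _) (Equiv.prodComm _ _) := by
      ext ⟨i, s⟩ ⟨j, t⟩
      fin_cases s <;> fin_cases t <;> simp [M, Matrix.blockDiagonal_apply]
    rw [this, Matrix.det_submatrix_equiv_self, Matrix.det_blockDiagonal]
    simp [Matrix.det_fin_two]
    ring
  rw [hM, Matrix.det_permute', hMdet]
  simp [τ, Equiv.Perm.sign_prodCongrLeft, Fin.prod_univ_two, a', b']

/-- The wedge power of a `(1,1)`-form on vectors `u_i, i u_i` is the Gram determinant of its
Hermitian form. -/
theorem wedgePow_eq_det {V : Type*} [AddCommGroup V] [Module ℂ V] [TopologicalSpace V]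
    {α : V [⋀^Fin 2]→L[ℝ] ℝ} (hα : ∀ u v, α ![Complex.I • u, Complex.I • v] = α ![u, v])
    (u : Fin k → V) :
    (wedgePow α k fun p => (if p.2 = 0 then (1 : ℂ) else Complex.I) • u p.1 : ℂ)
      = 2 ^ k * k.factorial * (Matrix.of fun i j => herm2 α (u i) (u j)).det := by
  let e : Fin 2 → ℂ := fun s => if s = 0 then 1 else Complex.I
  let G : Matrix (Fin k) (Fin k) ℂ := Matrix.of fun i j => herm2 α (u i) (u j)
  let B : Fin k × Fin 2 → Fin k × Fin 2 → ℂ := fun p q =>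
    Complex.I * (e p.2 * star (e q.2) * G p.1 q.1)
  have hB : ∀ p q : Fin k × Fin 2, (α ![e p.2 • u p.1, e q.2 • u q.1] : ℂ) = B p q - B q p := by
    intro p q
    rw [form_eq_herm2 hα, herm2_smul_left hα, herm2_smul_right hα, herm2_smul_left hα,
      herm2_smul_right hα]
    simp only [B, G, Matrix.of_apply]; ring
  have h1 : (wedgePow α k fun p => (if p.2 = 0 then (1 : ℂ) else Complex.I) • u p.1 : ℂ)
      = (2 ^ k)⁻¹ * ∑ σ : Equiv.Perm (Fin k × Fin 2), ((Equiv.Perm.sign σ : ℤ) : ℂ) *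
      ∏ i : Fin k, (B (σ (i, 0)) (σ (i, 1)) - B (σ (i, 1)) (σ (i, 0))) := by
    simp only [wedgePow, ← hB, e]
    push_cast
    rfl
  rw [h1, sum_perm_prod_sub_swap, inv_mul_cancel_left₀ (pow_ne_zero k two_ne_zero)]
  -- Expand each factor over the entries of the Gram matrix.
  have h2 : ∀ p q : Fin k × Fin 2, B p q = ∑ ab : Fin k × Fin k, Complex.I * G ab.1 ab.2 *
      ((if p.1 = ab.1 then e p.2 else 0) * (if q.1 = ab.2 then star (e q.2) else 0)) := by
    intro p q
    rw [Fintype.sum_prod_type, Finset.sum_eq_single p.1, Finset.sum_eq_single q.1]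
    · simp [B]; ring
    · intro b _ hb; simp [hb.symm]
    · simp
    · intro b _ hb; simp [hb.symm]
    · simp
  simp only [h2, Finset.prod_univ_sum, Fintype.piFinset_univ, Finset.mul_sum]
  rw [Finset.sum_comm]
  have h3 : ∀ ab : Fin k → Fin k × Fin k,
      ∑ σ : Equiv.Perm (Fin k × Fin 2), ((Equiv.Perm.sign σ : ℤ) : ℂ) *
        ∏ i, (Complex.I * G (ab i).1 (ab i).2 * ((if (σ (i, 0)).1 = (ab i).1 then e (σ (i, 0)).2 else 0)
          * (if (σ (i, 1)).1 = (ab i).2 then star (e (σ (i, 1)).2) else 0)))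
      = 2 ^ k * (∏ i, G (ab i).1 (ab i).2) *
        ((Matrix.of fun q r : Fin k => if q = (ab r).1 then (1 : ℂ) else 0).det *
        (Matrix.of fun q r : Fin k => if q = (ab r).2 then (1 : ℂ) else 0).det) := by
    intro ab
    have h4 := det_pairs (fun i => (ab i).1) (fun i => (ab i).2)
    rw [Matrix.det_apply'] at h4
    simp only [Finset.prod_mul_distrib, Finset.prod_const, Finset.card_univ, Fintype.card_fin]
    have h5 : (Complex.I) ^ k * (-2 * Complex.I) ^ k = 2 ^ k := by
      rw [← mul_pow]; congr 1; linear_combination -2 * Complex.I_mul_I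
    have h6 : ∀ σ : Equiv.Perm (Fin k × Fin 2), ∏ r, (Matrix.of fun (q r : Fin k × Fin 2) =>
        if q.1 = (if r.2 = 0 then (ab r.1).1 else (ab r.1).2) then
        (if q.2 = 0 then 1 else if r.2 = 0 then Complex.I else -Complex.I) else 0) (σ r) r
        = (∏ i, if (σ (i, 0)).1 = (ab i).1 then e (σ (i, 0)).2 else 0)
          * ∏ i, if (σ (i, 1)).1 = (ab i).2 then star (e (σ (i, 1)).2) else 0 := by
      intro σ
      rw [Fintype.prod_prod_type, ← Finset.prod_mul_distrib]
      refine Finset.prod_congr rfl fun i _ => ?_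
      rw [Fin.prod_univ_two]
      simp only [Matrix.of_apply, e]
      by_cases h : (σ (i, 1)).2 = 0 <;> simp [h]
    simp only [h6] at h4
    rw [← h5]
    set P := ∏ i, G (ab i).1 (ab i).2
    trans Complex.I ^ k * P * ∑ σ : Equiv.Perm (Fin k × Fin 2), ((Equiv.Perm.sign σ : ℤ) : ℂ) *
      ((∏ i, if (σ (i, 0)).1 = (ab i).1 then e (σ (i, 0)).2 else 0)
          * ∏ i, if (σ (i, 1)).1 = (ab i).2 then star (e (σ (i, 1)).2) else 0)
    · rw [Finset.mul_sum]
      exact Finset.sum_congr rfl fun σ _ => by ring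
    · rw [h4]; ring
  rw [Finset.sum_congr rfl fun ab _ => h3 ab]
  -- Only permutations contribute.
  have h7 : ∑ ab : Fin k → Fin k × Fin k, 2 ^ k * (∏ i, G (ab i).1 (ab i).2) *
        ((Matrix.of fun q r : Fin k => if q = (ab r).1 then (1 : ℂ) else 0).det *
        (Matrix.of fun q r : Fin k => if q = (ab r).2 then (1 : ℂ) else 0).det)
      = ∑ cd : Equiv.Perm (Fin k) × Equiv.Perm (Fin k), 2 ^ k *
        (((Equiv.Perm.sign cd.1 : ℤ) : ℂ) * ((Equiv.Perm.sign cd.2 : ℤ) : ℂ) *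
          ∏ i, G (cd.1 i) (cd.2 i)) := by
    have hperm : ∀ c : Equiv.Perm (Fin k),
        (Matrix.of fun q r : Fin k => if q = c r then (1 : ℂ) else 0).det
          = ((Equiv.Perm.sign c : ℤ) : ℂ) := by
      intro c
      have : (Matrix.of fun q r : Fin k => if q = c r then (1 : ℂ) else 0)
          = (1 : Matrix (Fin k) (Fin k) ℂ).submatrix id c := by
        ext q r; simp [Matrix.one_apply]
      rw [this, Matrix.det_permute', Matrix.det_one, mul_one]
    have hninj : ∀ c : Fin k → Fin k, ¬ Function.Injective c →
        (Matrix.of fun q r : Fin k => if q = c r then (1 : ℂ) else 0).det = 0 := by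
      intro c hc
      obtain ⟨i, j, hij, hne⟩ : ∃ i j, c i = c j ∧ i ≠ j := by
        simpa [Function.Injective] using hc
      exact Matrix.det_zero_of_column_eq hne (by intro q; simp [hij])
    symm
    refine Finset.sum_of_injOn (fun cd i => (cd.1 i, cd.2 i)) ?_ (by simp) ?_ ?_
    · rintro ⟨c, d⟩ _ ⟨c', d'⟩ _ h
      have h' := fun i => congrFun h i
      simp only [Prod.mk.injEq] at h'
      ext i
      · simp [(h' i).1]
      · simp [(h' i).2]
    · intro ab _ hab
      by_cases h1 : Function.Injective fun i => (ab i).1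
      · by_cases h2 : Function.Injective fun i => (ab i).2
        · exfalso
          apply hab
          refine ⟨(Equiv.ofBijective _ (Finite.injective_iff_bijective.mp h1),
            Equiv.ofBijective _ (Finite.injective_iff_bijective.mp h2)), by simp, ?_⟩
          ext i <;> simp
        · rw [hninj _ h2]; simp
      · rw [hninj _ h1]; simp
    · rintro ⟨c, d⟩ _
      rw [hperm, hperm]; ring
  rw [h7, ← Finset.mul_sum, Fintype.sum_prod_type, sum_perm_perm_prod, mul_assoc]

end Pfaffian

/-! ### Conjugate-linear endomorphisms that are symmetric for a Hermitian metric -/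

section SymmetricTensors

open scoped ComplexOrder Matrix

variable {κ : Type*} [Fintype κ] [DecidableEq κ] {g A B : Matrix κ κ ℂ}

/-- In a unitary frame the matrix of a `g`-symmetric conjugate-linear map is symmetric; in symbols
`A = L⁻¹ S (conj L)` with `S` symmetric. -/
lemma exists_unitary_frame (hg : g.PosDef) : ∃ L M : Matrix κ κ ℂ, M * L = 1 ∧ L * M = 1 ∧
    ∀ A : Matrix κ κ ℂ, Aᵀ * g = gᵀ * A → ∃ S : Matrix κ κ ℂ, Sᵀ = S ∧ A = M * S * cc L := by
  obtain ⟨N, hN⟩ : ∃ N : Matrix κ κ ℂ, g = Nᴴ * N := by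
    open scoped MatrixOrder in
    obtain ⟨N, hN⟩ := CStarAlgebra.nonneg_iff_eq_star_mul_self.mp hg.posSemidef.nonneg
    exact ⟨N, hN⟩
  have hdet : IsUnit N.det := by
    have h1 : IsUnit g.det := hg.isUnit.map Matrix.detMonoidHom
    rw [hN, Matrix.det_mul] at h1
    exact isUnit_of_mul_isUnit_right h1
  have h1 : N * N⁻¹ = 1 := Matrix.mul_nonsing_inv N hdet
  have h2 : N⁻¹ * N = 1 := Matrix.nonsing_inv_mul N hdet
  have hcc1 : cc (1 : Matrix κ κ ℂ) = 1 := by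
    ext i j; by_cases h : i = j <;> simp [cc, Matrix.one_apply, h]
  have ht : ∀ M : Matrix κ κ ℂ, Mᴴ = (cc M)ᵀ := fun M => rfl
  refine ⟨cc N, cc N⁻¹, ?_, ?_, ?_⟩
  · rw [← cc_mul, h2, hcc1]
  · rw [← cc_mul, h1, hcc1]
  · intro A hA
    refine ⟨cc N * A * N⁻¹, ?_, ?_⟩
    · have h3 : N⁻¹ᵀ * Nᵀ = 1 := by rw [← Matrix.transpose_mul, h1, Matrix.transpose_one]
      rw [hN, ht, Matrix.transpose_mul, Matrix.transpose_transpose] at hA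
      have h4 : N⁻¹ᵀ * (Aᵀ * ((cc N)ᵀ * N)) * N⁻¹ = N⁻¹ᵀ * (Nᵀ * cc N * A) * N⁻¹ := by rw [hA]
      have h5 : N⁻¹ᵀ * (Aᵀ * ((cc N)ᵀ * N)) * N⁻¹ = N⁻¹ᵀ * (Aᵀ * (cc N)ᵀ) * (N * N⁻¹) := by
        simp only [mul_assoc]
      have h6 : N⁻¹ᵀ * (Nᵀ * cc N * A) * N⁻¹ = (N⁻¹ᵀ * Nᵀ) * (cc N * A * N⁻¹) := by
        simp only [mul_assoc]
      rw [h5, h6, h1, h3, mul_one, one_mul] at h4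
      conv_rhs => rw [← h4]
      rw [Matrix.transpose_mul, Matrix.transpose_mul]
    · rw [cc_cc]
      have : cc N⁻¹ * cc N = 1 := by rw [← cc_mul, h2, hcc1]
      calc A = (cc N⁻¹ * cc N) * A * (N⁻¹ * N) := by rw [this, h2, one_mul, mul_one]
        _ = _ := by simp only [mul_assoc]

/-- Traces of products of `g`-symmetric conjugate-linear maps, computed in a unitary frame. -/
lemma trace_unitary_frame {L M S T : Matrix κ κ ℂ} (hLM : L * M = 1) :
    ((M * S * cc L) * cc (M * T * cc L)).trace = (S * cc T).trace := by
  have h : cc L * cc M = 1 := by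
    rw [← cc_mul, hLM]; ext i j; by_cases h : i = j <;> simp [cc, Matrix.one_apply, h]
  have : (M * S * cc L) * cc (M * T * cc L) = M * (S * cc T * L) := by
    rw [cc_mul, cc_mul, cc_cc]
    calc _ = M * S * (cc L * cc M) * cc T * L := by simp only [mul_assoc]
      _ = _ := by rw [h]; simp only [mul_assoc, mul_one]
  rw [this, Matrix.trace_mul_comm, mul_assoc, hLM, mul_one]

lemma trace_unitary_frame₂ {L M S T U W : Matrix κ κ ℂ} (hLM : L * M = 1) :
    ((M * S * cc L) * cc (M * T * cc L) * (M * U * cc L) * cc (M * W * cc L)).trace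
      = (S * cc T * U * cc W).trace := by
  have h : cc L * cc M = 1 := by
    rw [← cc_mul, hLM]; ext i j; by_cases h : i = j <;> simp [cc, Matrix.one_apply, h]
  have : (M * S * cc L) * cc (M * T * cc L) * (M * U * cc L) * cc (M * W * cc L)
      = M * (S * cc T * U * cc W * L) := by
    rw [cc_mul, cc_mul, cc_mul, cc_mul, cc_cc]
    calc _ = M * S * (cc L * cc M) * cc T * (L * M) * U * (cc L * cc M) * cc W * L := by
          simp only [mul_assoc]
      _ = _ := by rw [h, hLM]; simp only [mul_assoc, mul_one]
  rw [this, Matrix.trace_mul_comm, mul_assoc, hLM, mul_one]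

omit [Fintype κ] [DecidableEq κ] in
lemma cc_eq_conjTranspose {S : Matrix κ κ ℂ} (hS : Sᵀ = S) : cc S = Sᴴ := by
  conv_rhs => rw [← hS]
  rfl

lemma trace_mul_cc_nonneg (hg : g.PosDef) (hA : Aᵀ * g = gᵀ * A) : 0 ≤ (A * cc A).trace := by
  obtain ⟨L, M, -, hLM, h⟩ := exists_unitary_frame hg
  obtain ⟨S, hS, rfl⟩ := h A hA
  rw [trace_unitary_frame hLM, cc_eq_conjTranspose hS]
  exact (Matrix.posSemidef_self_mul_conjTranspose S).trace_nonneg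

lemma eq_zero_of_trace_mul_cc (hg : g.PosDef) (hA : Aᵀ * g = gᵀ * A) (h0 : (A * cc A).trace = 0) :
    A = 0 := by
  obtain ⟨L, M, -, hLM, h⟩ := exists_unitary_frame hg
  obtain ⟨S, hS, rfl⟩ := h A hA
  rw [trace_unitary_frame hLM, cc_eq_conjTranspose hS,
    Matrix.trace_mul_conjTranspose_self_eq_zero_iff] at h0
  simp [h0]

lemma trace_four_nonneg (hg : g.PosDef) (hA : Aᵀ * g = gᵀ * A) (hB : Bᵀ * g = gᵀ * B) :
    0 ≤ (A * cc B * B * cc A).trace := by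
  obtain ⟨L, M, -, hLM, h⟩ := exists_unitary_frame hg
  obtain ⟨S, hS, rfl⟩ := h A hA
  obtain ⟨T, hT, rfl⟩ := h B hB
  rw [trace_unitary_frame₂ hLM, cc_eq_conjTranspose hS, cc_eq_conjTranspose hT]
  have := (Matrix.posSemidef_self_mul_conjTranspose (S * Tᴴ)).trace_nonneg
  simpa [Matrix.conjTranspose_mul, mul_assoc] using this

lemma trace_four_nonneg' (hg : g.PosDef) (hA : Aᵀ * g = gᵀ * A) (hB : Bᵀ * g = gᵀ * B) :
    0 ≤ (B * cc B * A * cc A).trace := by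
  obtain ⟨L, M, -, hLM, h⟩ := exists_unitary_frame hg
  obtain ⟨S, hS, rfl⟩ := h A hA
  obtain ⟨T, hT, rfl⟩ := h B hB
  rw [trace_unitary_frame₂ hLM, cc_eq_conjTranspose hS, cc_eq_conjTranspose hT]
  have := (Matrix.posSemidef_self_mul_conjTranspose (Sᴴ * T)).trace_nonneg
  rw [Matrix.trace_mul_comm (T * Tᴴ * S)]
  simpa [Matrix.conjTranspose_mul, mul_assoc] using this

/-- The Cauchy–Schwarz inequality for the eigenvalues of the positive operator `A Ā`. -/
lemma sq_trace_le (hg : g.PosDef) (hA : Aᵀ * g = gᵀ * A) :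
    (A * cc A).trace.re ^ 2 ≤ Fintype.card κ * (A * cc A * A * cc A).trace.re := by
  obtain ⟨L, M, -, hLM, h⟩ := exists_unitary_frame hg
  obtain ⟨S, hS, rfl⟩ := h A hA
  rw [trace_unitary_frame₂ hLM, trace_unitary_frame hLM, cc_eq_conjTranspose hS]
  set P := S * Sᴴ with hP
  have hPh : Pᴴ = P := by simp [hP]
  have h2 : S * Sᴴ * S * Sᴴ = P * P := by simp only [hP, mul_assoc]
  rw [h2]
  -- Positivity of the trace of the square of `N P - tr P`, where `N` is the size of the matrix.
  rcases isEmpty_or_nonempty κ with hκ | hκ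
  · simp [Matrix.trace]
  have hN : (0 : ℝ) < Fintype.card κ := by exact_mod_cast Fintype.card_pos
  set t := P.trace.re
  set N : ℝ := (Fintype.card κ : ℝ)
  have him : P.trace = (t : ℂ) := by
    have : star P.trace = P.trace := by rw [← Matrix.trace_conjTranspose, hPh]
    exact (Complex.conj_eq_iff_re.mp this).symm
  set Q := (N : ℂ) • P - (t : ℂ) • (1 : Matrix κ κ ℂ)
  have hQ : Qᴴ = Q := by
    simp [Q, Matrix.conjTranspose_sub, Matrix.conjTranspose_smul, hPh]
  have h3 := (Matrix.posSemidef_self_mul_conjTranspose Q).trace_nonneg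
  rw [hQ] at h3
  have h4 : (Q * Q).trace = (N : ℂ) ^ 2 * (P * P).trace - N * t ^ 2 := by
    have h5 : (Fintype.card κ : ℂ) = (N : ℂ) := by simp [N]
    simp only [Q, sub_mul, mul_sub, Matrix.trace_sub, smul_mul_assoc, mul_smul_comm, mul_one,
      one_mul, Matrix.trace_smul, smul_eq_mul, him, Matrix.trace_one, h5]
    ring
  have h6 := (Complex.le_def.mp h3).1
  rw [h4] at h6
  have h7 : ((N : ℂ) ^ 2 * (P * P).trace - N * t ^ 2).re = N ^ 2 * (P * P).trace.re - N * t ^ 2 := by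
    rw [Complex.sub_re, ← Complex.ofReal_pow, Complex.re_ofReal_mul]
    norm_cast
  rw [h7, Complex.zero_re] at h6
  have h8 : 0 ≤ N * (N * (P * P).trace.re - t ^ 2) := by nlinarith
  have := nonneg_of_mul_nonneg_right h8 hN
  linarith

/-- The pointwise inner product of two symmetric tensors does not depend on the basis and equals the
trace of the complex-linear map `A ∘ B`. -/
lemma sum_inv_mul_eq_trace {P : Matrix κ κ ℂ} (hP : IsUnit P.det) (hg : g.PosDef)
    (hB : Bᵀ * g = gᵀ * B) :
    ∑ α, ∑ β, (Pᵀ * g * cc P)⁻¹ α β * ((A * cc P)ᵀ * g * cc (B * cc P)) α β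
      = (A * cc B).trace := by
  have hcc1 : cc (1 : Matrix κ κ ℂ) = 1 := by
    ext i j; by_cases h : i = j <;> simp [cc, Matrix.one_apply, h]
  have h0 : ∀ X Y : Matrix κ κ ℂ, ∑ α, ∑ β, X α β * Y α β = (X * Yᵀ).trace := by
    intro X Y; simp [Matrix.trace, Matrix.mul_apply]
  have hPP : P * P⁻¹ = 1 := Matrix.mul_nonsing_inv P hP
  have hPP' : P⁻¹ * P = 1 := Matrix.nonsing_inv_mul P hP
  have hgu : IsUnit g.det := hg.isUnit.map Matrix.detMonoidHom
  have hgg : g * g⁻¹ = 1 := Matrix.mul_nonsing_inv g hgu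
  have hgg' : g⁻¹ * g = 1 := Matrix.nonsing_inv_mul g hgu
  have hinv : (Pᵀ * g * cc P)⁻¹ = cc P⁻¹ * g⁻¹ * (P⁻¹)ᵀ := by
    refine Matrix.inv_eq_right_inv ?_
    have h1 : cc P * cc P⁻¹ = 1 := by rw [← cc_mul, hPP, hcc1]
    have h2 : Pᵀ * (P⁻¹)ᵀ = 1 := by rw [← Matrix.transpose_mul, hPP', Matrix.transpose_one]
    calc Pᵀ * g * cc P * (cc P⁻¹ * g⁻¹ * (P⁻¹)ᵀ) = Pᵀ * (g * (cc P * cc P⁻¹) * g⁻¹) * (P⁻¹)ᵀ := by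
          simp only [mul_assoc]
      _ = 1 := by rw [h1, mul_one, hgg, mul_one, h2]
  have hgt : gᵀ = cc g := by
    have := hg.isHermitian.eq
    conv_rhs => rw [← this]
    ext i j; simp [cc]
  -- The symmetry of `B` in conjugated form.
  have hB' : (cc B)ᵀ * gᵀ = g * cc B := by
    have := congrArg cc hB
    rw [cc_mul, cc_mul] at this
    have h1 : cc gᵀ = g := by rw [hgt, cc_cc]
    rw [h1, ← hgt] at this
    exact this
  rw [h0, hinv, Matrix.transpose_mul, Matrix.transpose_mul, Matrix.transpose_transpose, cc_mul,
    cc_cc, Matrix.transpose_mul]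
  have h3 : (P⁻¹)ᵀ * Pᵀ = 1 := by rw [← Matrix.transpose_mul, hPP, Matrix.transpose_one]
  have h4 : cc P * cc P⁻¹ = 1 := by rw [← cc_mul, hPP, hcc1]
  calc (cc P⁻¹ * g⁻¹ * (P⁻¹)ᵀ * (Pᵀ * (cc B)ᵀ * (gᵀ * (A * cc P)))).trace
      = (cc P⁻¹ * (g⁻¹ * ((P⁻¹)ᵀ * Pᵀ) * ((cc B)ᵀ * gᵀ) * A * cc P)).trace := by
        simp only [mul_assoc]
    _ = (cc P⁻¹ * (cc B * A * cc P)).trace := by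
        rw [h3, mul_one, hB', ← mul_assoc g⁻¹, hgg', one_mul]
    _ = (A * cc B).trace := by
        rw [Matrix.trace_mul_comm, mul_assoc, h4, mul_one, Matrix.trace_mul_comm]

end SymmetricTensors

/-! ### The differential ring of smooth functions on an open set -/

section SmoothRing

variable {E : Type*} [NormedAddCommGroup E] [NormedSpace ℂ E]

/-- The Wirtinger derivative `∂_u F = (D F(u) - i D F(iu)) / 2` in the direction of a vector `u` of
a complex normed space. -/
def wirt (u : E) (F : E → ℂ) (y : E) : ℂ :=
  (1 / 2 : ℂ) * (fderiv ℝ F y u - Complex.I * fderiv ℝ F y (Complex.I • u))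

/-- The conjugate Wirtinger derivative `(D F(u) + i D F(iu)) / 2`. -/
def wirtBar (u : E) (F : E → ℂ) (y : E) : ℂ :=
  (1 / 2 : ℂ) * (fderiv ℝ F y u + Complex.I * fderiv ℝ F y (Complex.I • u))

lemma fderiv_star_comp (F : E → ℂ) (y u : E) :
    fderiv ℝ (fun z => star (F z)) y u = star (fderiv ℝ F y u) := by
  rw [fderiv_star]
  simp

lemma star_wirt (u : E) (F : E → ℂ) (y : E) :
    star (wirt u F y) = wirtBar u (fun z => star (F z)) y := by
  simp only [wirt, wirtBar, fderiv_star_comp]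
  simp [Complex.conj_I]

lemma fderiv_eq_wirt (u : E) (F : E → ℂ) (y : E) :
    fderiv ℝ F y u = wirt u F y + wirtBar u F y := by
  simp only [wirt, wirtBar]; ring

lemma wirt_congr {u : E} {F G : E → ℂ} {y : E} (h : F =ᶠ[nhds y] G) : wirt u F y = wirt u G y := by
  simp only [wirt, h.fderiv_eq]

lemma wirtBar_congr {u : E} {F G : E → ℂ} {y : E} (h : F =ᶠ[nhds y] G) :
    wirtBar u F y = wirtBar u G y := by
  simp only [wirtBar, h.fderiv_eq]

lemma wirt_add {u : E} {F G : E → ℂ} {y : E} (hF : DifferentiableAt ℝ F y)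
    (hG : DifferentiableAt ℝ G y) : wirt u (F + G) y = wirt u F y + wirt u G y := by
  simp only [wirt, fderiv_add hF hG, _root_.add_apply]; ring

lemma wirt_mul {u : E} {F G : E → ℂ} {y : E} (hF : DifferentiableAt ℝ F y)
    (hG : DifferentiableAt ℝ G y) : wirt u (F * G) y = F y * wirt u G y + G y * wirt u F y := by
  simp only [wirt, fderiv_mul hF hG, _root_.add_apply, _root_.smul_apply,
    smul_eq_mul]
  ring

lemma contDiffAt_fderiv_apply {F : E → ℂ} {y : E} (hF : ContDiffAt ℝ ∞ F y) (u : E) :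
    ContDiffAt ℝ ∞ (fun z => fderiv ℝ F z u) y :=
  (hF.fderiv_right (m := ∞) (by simp)).clm_apply contDiffAt_const

lemma ContDiffOn.wirt {F : E → ℂ} {W : Set E} (hF : ContDiffOn ℝ ∞ F W) (hW : IsOpen W) (u : E) :
    ContDiffOn ℝ ∞ (wirt u F) W := by
  intro y hy
  have h := hF.contDiffAt (hW.mem_nhds hy)
  exact (contDiffAt_const.mul ((contDiffAt_fderiv_apply h u).sub
    (contDiffAt_const.mul (contDiffAt_fderiv_apply h _)))).contDiffWithinAt

lemma fderiv_fderiv_symm {F : E → ℂ} {y : E} (hF : ContDiffAt ℝ ∞ F y) (u v : E) :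
    fderiv ℝ (fun z => fderiv ℝ F z v) y u = fderiv ℝ (fun z => fderiv ℝ F z u) y v := by
  have hd : DifferentiableAt ℝ (fderiv ℝ F) y :=
    (hF.fderiv_right (m := ∞) (by simp)).differentiableAt (by simp)
  have h : ∀ w : E, fderiv ℝ (fun z => fderiv ℝ F z w) y
      = (ContinuousLinearMap.apply ℝ ℂ w).comp (fderiv ℝ (fderiv ℝ F) y) := by
    intro w
    exact ((ContinuousLinearMap.apply ℝ ℂ w).hasFDerivAt.comp y hd.hasFDerivAt).fderiv
  rw [h, h]
  simpa using (hF.isSymmSndFDerivAt (by simpa using WithTop.coe_le_coe.mpr (le_top : (2 : ℕ∞) ≤ ⊤))) u v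

lemma fderiv_wirt {F : E → ℂ} {y : E} (hF : ContDiffAt ℝ ∞ F y) (u v : E) :
    fderiv ℝ (wirt v F) y u = (1 / 2 : ℂ) * (fderiv ℝ (fun z => fderiv ℝ F z v) y u
      - Complex.I * fderiv ℝ (fun z => fderiv ℝ F z (Complex.I • v)) y u) := by
  have h1 := (contDiffAt_fderiv_apply hF v).differentiableAt (by simp)
  have h2 := (contDiffAt_fderiv_apply hF (Complex.I • v)).differentiableAt (by simp)
  have := ((h1.hasFDerivAt.sub (h2.hasFDerivAt.const_mul Complex.I)).const_mul (1 / 2 : ℂ)).fderiv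
  have h3 : fderiv ℝ (wirt v F) y = fderiv ℝ (fun z => (1 / 2 : ℂ) * (fderiv ℝ F z v
      - Complex.I * fderiv ℝ F z (Complex.I • v))) y := rfl
  rw [h3]
  erw [this]
  simp

lemma fderiv_wirtBar {F : E → ℂ} {y : E} (hF : ContDiffAt ℝ ∞ F y) (u v : E) :
    fderiv ℝ (wirtBar v F) y u = (1 / 2 : ℂ) * (fderiv ℝ (fun z => fderiv ℝ F z v) y u
      + Complex.I * fderiv ℝ (fun z => fderiv ℝ F z (Complex.I • v)) y u) := by
  have h1 := (contDiffAt_fderiv_apply hF v).differentiableAt (by simp)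
  have h2 := (contDiffAt_fderiv_apply hF (Complex.I • v)).differentiableAt (by simp)
  have := ((h1.hasFDerivAt.add (h2.hasFDerivAt.const_mul Complex.I)).const_mul (1 / 2 : ℂ)).fderiv
  have h3 : fderiv ℝ (wirtBar v F) y = fderiv ℝ (fun z => (1 / 2 : ℂ) * (fderiv ℝ F z v
      + Complex.I * fderiv ℝ F z (Complex.I • v))) y := rfl
  rw [h3]
  erw [this]
  simp [mul_add]

lemma wirt_comm {F : E → ℂ} {y : E} (hF : ContDiffAt ℝ ∞ F y) (u v : E) :
    wirt u (wirt v F) y = wirt v (wirt u F) y := by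
  rw [wirt, wirt, fderiv_wirt hF, fderiv_wirt hF, fderiv_wirt hF, fderiv_wirt hF,
    fderiv_fderiv_symm hF u v, fderiv_fderiv_symm hF u (Complex.I • v),
    fderiv_fderiv_symm hF (Complex.I • u) v, fderiv_fderiv_symm hF (Complex.I • u) (Complex.I • v)]
  ring

lemma wirt_wirtBar_comm {F : E → ℂ} {y : E} (hF : ContDiffAt ℝ ∞ F y) (u v : E) :
    wirt u (wirtBar v F) y = wirtBar v (wirt u F) y := by
  rw [wirt, wirtBar, fderiv_wirtBar hF, fderiv_wirt hF, fderiv_wirtBar hF, fderiv_wirt hF,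
    fderiv_fderiv_symm hF u v, fderiv_fderiv_symm hF u (Complex.I • v),
    fderiv_fderiv_symm hF (Complex.I • u) v, fderiv_fderiv_symm hF (Complex.I • u) (Complex.I • v)]
  ring

variable (W : TopologicalSpace.Opens E)

open Classical in
/-- Extension by zero of a function on an open set. -/
def extendZero (f : W → ℂ) (y : E) : ℂ := if h : y ∈ W then f ⟨y, h⟩ else 0

variable {W}

omit [NormedSpace ℂ E] in
lemma extendZero_of_mem (f : W → ℂ) {y : E} (h : y ∈ W) : extendZero W f y = f ⟨y, h⟩ := by
  simp [extendZero, h]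

omit [NormedSpace ℂ E] in
lemma extendZero_restrict (F : E → ℂ) : Set.EqOn (extendZero W fun y => F y) F W := fun y hy => by
  rw [extendZero_of_mem _ hy]

variable (W) in
/-- The star algebra of complex-valued functions on the open set `W` that are smooth in the real
sense. -/
def SmoothRing : StarSubalgebra ℂ (W → ℂ) where
  carrier := {f | ContDiffOn ℝ ∞ (extendZero W f) W}
  mul_mem' {f g} hf hg := (ContDiffOn.mul hf hg).congr fun y hy => by
    simp [extendZero_of_mem _ (show y ∈ W from hy)]
  add_mem' {f g} hf hg := (ContDiffOn.add hf hg).congr fun y hy => by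
    simp [extendZero_of_mem _ (show y ∈ W from hy)]
  algebraMap_mem' r := (contDiffOn_const (c := r)).congr fun y hy => by
    simp [extendZero_of_mem _ (show y ∈ W from hy)]
  star_mem' {f} hf := (Complex.conjCLE.contDiff.comp_contDiffOn hf).congr fun y hy => by
    simp [extendZero_of_mem _ (show y ∈ W from hy)]

namespace SmoothRing

/-- The smooth function on `W` given by a function on the ambient space. -/
def mk (F : E → ℂ) (hF : ContDiffOn ℝ ∞ F (W : Set E)) : SmoothRing W :=
  ⟨fun y => F y, hF.congr (extendZero_restrict F)⟩

/-- An element of the ring as a function on the ambient space that vanishes off `W`. -/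
def fn (f : SmoothRing W) : E → ℂ := extendZero W f.1

lemma contDiffOn_fn (f : SmoothRing W) : ContDiffOn ℝ ∞ (fn f) (W : Set E) := f.2

lemma contDiffAt_fn (f : SmoothRing W) {y : E} (hy : y ∈ W) : ContDiffAt ℝ ∞ (fn f) y :=
  f.2.contDiffAt (W.isOpen.mem_nhds hy)

lemma differentiableAt_fn (f : SmoothRing W) {y : E} (hy : y ∈ W) : DifferentiableAt ℝ (fn f) y :=
  (contDiffAt_fn f hy).differentiableAt (by simp)

lemma fn_mk {F : E → ℂ} (hF : ContDiffOn ℝ ∞ F (W : Set E)) {y : E} (hy : y ∈ W) : (fn (mk F hF)) y = F y :=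
  extendZero_restrict F hy

lemma fn_mk_eventuallyEq {F : E → ℂ} (hF : ContDiffOn ℝ ∞ F (W : Set E)) {y : E} (hy : y ∈ W) :
    (fn (mk F hF)) =ᶠ[nhds y] F :=
  Filter.eventuallyEq_of_mem (W.isOpen.mem_nhds hy) fun _ hz => fn_mk hF hz

lemma fn_add (f g : SmoothRing W) : (fn (f + g)) = (fn f) + (fn g) := by
  funext y; by_cases hy : y ∈ W <;> simp [fn, extendZero, hy]

lemma fn_mul (f g : SmoothRing W) : (fn (f * g)) = (fn f) * (fn g) := by
  funext y; by_cases hy : y ∈ W <;> simp [fn, extendZero, hy]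

lemma fn_star (f : SmoothRing W) : (fn (star f)) = fun y => star ((fn f) y) := by
  funext y; by_cases hy : y ∈ W <;> simp [fn, extendZero, hy]

lemma fn_injective {f g : SmoothRing W} (h : ∀ y ∈ W, (fn f) y = (fn g) y) : f = g := by
  apply Subtype.ext
  funext y
  have := h y.1 y.2
  simpa [fn, extendZero_of_mem _ y.2] using this

/-- Evaluation at a point of `W`. -/
def eval (y : W) : SmoothRing W →+* ℂ where
  toFun f := f.1 y
  map_one' := rfl
  map_mul' _ _ := rfl
  map_zero' := rfl
  map_add' _ _ := rfl

lemma eval_eq_fn (f : SmoothRing W) {y : E} (hy : y ∈ W) : eval ⟨y, hy⟩ f = (fn f) y :=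
  (extendZero_of_mem f.1 hy).symm

lemma isUnit_of_ne_zero {f : SmoothRing W} (h : ∀ y ∈ W, (fn f) y ≠ 0) : IsUnit f := by
  refine IsUnit.of_mul_eq_one (mk (fun y => ((fn f) y)⁻¹) ((contDiffOn_fn f).inv h)) ?_
  refine fn_injective fun y hy => ?_
  rw [fn_mul, Pi.mul_apply, fn_mk _ hy, mul_inv_cancel₀ (h y hy), ← eval_eq_fn _ hy, map_one]

lemma fn_mk_wirt (u : E) (f : SmoothRing W) {y : E} (hy : y ∈ W) :
    fn (mk (wirt u (fn f)) (ContDiffOn.wirt (contDiffOn_fn f) W.isOpen u)) y = wirt u (fn f) y :=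
  fn_mk _ hy

/-- The Wirtinger derivation in the direction `u`. -/
def deriv (u : E) : Derivation ℤ (SmoothRing W) (SmoothRing W) :=
  Derivation.mk'
    (AddMonoidHom.toIntLinearMap (AddMonoidHom.mk'
      (fun f => mk (wirt u (fn f)) (ContDiffOn.wirt (contDiffOn_fn f) W.isOpen u)) (by
        intro f g
        refine fn_injective fun y hy => ?_
        refine (fn_mk_wirt u _ hy).trans (Eq.trans ?_ (congrFun (fn_add _ _) y).symm)
        rw [fn_add, Pi.add_apply, fn_mk_wirt _ _ hy, fn_mk_wirt _ _ hy,
          wirt_add (differentiableAt_fn f hy) (differentiableAt_fn g hy)])))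
    (by
      intro f g
      refine fn_injective fun y hy => ?_
      simp only [AddMonoidHom.coe_toIntLinearMap, AddMonoidHom.mk'_apply, smul_eq_mul]
      refine (fn_mk_wirt u _ hy).trans (Eq.trans ?_ (congrFun (fn_add _ _) y).symm)
      rw [Pi.add_apply]
      refine Eq.trans ?_ (congrArg₂ _ (congrFun (fn_mul _ _) y).symm
        (congrFun (fn_mul _ _) y).symm)
      rw [fn_mul, Pi.mul_apply, Pi.mul_apply, fn_mk_wirt _ _ hy, fn_mk_wirt _ _ hy,
        wirt_mul (differentiableAt_fn f hy) (differentiableAt_fn g hy)])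

lemma fn_deriv (u : E) (f : SmoothRing W) {y : E} (hy : y ∈ W) :
    (fn (deriv u f)) y = wirt u (fn f) y :=
  fn_mk (ContDiffOn.wirt (contDiffOn_fn f) W.isOpen u) hy

lemma fn_deriv_eventuallyEq (u : E) (f : SmoothRing W) {y : E} (hy : y ∈ W) :
    (fn (deriv u f)) =ᶠ[nhds y] wirt u (fn f) :=
  fn_mk_eventuallyEq (ContDiffOn.wirt (contDiffOn_fn f) W.isOpen u) hy

lemma fn_star_deriv_star (u : E) (f : SmoothRing W) {y : E} (hy : y ∈ W) :
    (fn (star (deriv u (star f)))) y = wirtBar u (fn f) y := by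
  rw [fn_star]
  simp only [fn_deriv u _ hy, fn_star, star_wirt, star_star]

lemma fn_star_deriv_star_eventuallyEq (u : E) (f : SmoothRing W) {y : E} (hy : y ∈ W) :
    (fn (star (deriv u (star f)))) =ᶠ[nhds y] wirtBar u (fn f) :=
  Filter.eventuallyEq_of_mem (W.isOpen.mem_nhds hy) fun _ hz => fn_star_deriv_star u f hz

lemma deriv_comm (u v : E) (f : SmoothRing W) : deriv u (deriv v f) = deriv v (deriv u f) := by
  refine fn_injective fun y hy => ?_
  rw [fn_deriv _ _ hy, fn_deriv _ _ hy, wirt_congr (fn_deriv_eventuallyEq v f hy),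
    wirt_congr (fn_deriv_eventuallyEq u f hy), wirt_comm (contDiffAt_fn f hy)]

lemma deriv_star_deriv (u v : E) (f : SmoothRing W) :
    deriv u (star (deriv v (star f))) = star (deriv v (star (deriv u f))) := by
  refine fn_injective fun y hy => ?_
  rw [fn_deriv _ _ hy, fn_star_deriv_star _ _ hy,
    wirt_congr (fn_star_deriv_star_eventuallyEq v f hy),
    wirtBar_congr (fn_deriv_eventuallyEq u f hy), wirt_wirtBar_comm (contDiffAt_fn f hy)]

end SmoothRing

end SmoothRing

/-! ### Poisson–Kähler forms in fibred coordinates -/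

section LocalForm

open scoped ComplexOrder

variable {m n : ℕ}

/-- The coordinate basis of `ℂ^m × ℂ^n`, with the base directions first. -/
def coordBasis : Fin m ⊕ Fin n → (Fin m → ℂ) × (Fin n → ℂ)
  | .inl j => (Pi.single j 1, 0)
  | .inr α => (0, Pi.single α 1)

lemma sum_coordBasis_inr (w : Fin n → ℂ) :
    ∑ α, w α • (coordBasis (.inr α) : (Fin m → ℂ) × (Fin n → ℂ)) = (0, w) := by
  have : ∑ α, w α • (Pi.single α 1 : Fin n → ℂ) = w := by
    ext β; simp [Finset.sum_apply, Pi.single_apply]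
  rw [Prod.ext_iff]
  constructor
  · simp [coordBasis, Prod.fst_sum]
  · simpa [coordBasis, Prod.snd_sum] using this

lemma sum_coordBasis_inl (v : Fin m → ℂ) :
    ∑ j, v j • (coordBasis (.inl j) : (Fin m → ℂ) × (Fin n → ℂ)) = (v, 0) := by
  have : ∑ j, v j • (Pi.single j 1 : Fin m → ℂ) = v := by
    ext β; simp [Finset.sum_apply, Pi.single_apply]
  rw [Prod.ext_iff]
  constructor
  · simpa [coordBasis, Prod.fst_sum] using this
  · simp [coordBasis, Prod.snd_sum]

/-- The closed two-form `w` on an open subset `W` of `ℂ^m × ℂ^n` is of type `(1,1)`, positive on the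
fibres of the projection to `ℂ^m` and satisfies `w^{n+1} = 0`. -/
structure IsLocalPoissonKahler (W : TopologicalSpace.Opens ((Fin m → ℂ) × (Fin n → ℂ)))
    (w : (Fin m → ℂ) × (Fin n → ℂ) → ((Fin m → ℂ) × (Fin n → ℂ)) [⋀^Fin 2]→L[ℝ] ℝ) : Prop where
  smooth : ContDiffOn ℝ ∞ w W
  closed : ∀ y ∈ W, extDeriv w y = 0
  oneOne : ∀ y ∈ W, ∀ u v, w y ![Complex.I • u, Complex.I • v] = w y ![u, v]
  pos : ∀ y ∈ W, ∀ u : Fin n → ℂ, u ≠ 0 → 0 < w y ![(0, u), Complex.I • (0, u)]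
  degenerate : ∀ y ∈ W, ∀ v, wedgePow (w y) (n + 1) v = 0

lemma closed_two_form {E : Type*} [NormedAddCommGroup E] [NormedSpace ℝ E]
    {w : E → E [⋀^Fin 2]→L[ℝ] ℝ} {y : E} (hw : DifferentiableAt ℝ w y) (u v z : E) :
    extDeriv w y ![u, v, z] = fderiv ℝ (fun x => w x ![v, z]) y u - fderiv ℝ (fun x => w x ![u, z]) y v
      + fderiv ℝ (fun x => w x ![u, v]) y z := by
  rw [extDeriv_apply hw]
  have h0 : Fin.removeNth 0 ![u, v, z] = ![v, z] := by ext i; fin_cases i <;> rfl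
  have h1 : Fin.removeNth 1 ![u, v, z] = ![u, z] := by ext i; fin_cases i <;> rfl
  have h2 : Fin.removeNth 2 ![u, v, z] = ![u, v] := by ext i; fin_cases i <;> rfl
  simp [Fin.sum_univ_three, h0, h1, h2, sub_eq_add_neg]

namespace IsLocalPoissonKahler

variable {W : TopologicalSpace.Opens ((Fin m → ℂ) × (Fin n → ℂ))}
  {w : (Fin m → ℂ) × (Fin n → ℂ) → ((Fin m → ℂ) × (Fin n → ℂ)) [⋀^Fin 2]→L[ℝ] ℝ}

lemma contDiffOn_apply (h : IsLocalPoissonKahler W w) (u v : (Fin m → ℂ) × (Fin n → ℂ)) :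
    ContDiffOn ℝ ∞ (fun y => w y ![u, v]) W :=
  (ContinuousAlternatingMap.apply ℝ _ ℝ ![u, v]).contDiff.comp_contDiffOn h.smooth

lemma contDiffOn_herm2 (h : IsLocalPoissonKahler W w) (u v : (Fin m → ℂ) × (Fin n → ℂ)) :
    ContDiffOn ℝ ∞ (fun y => herm2 (w y) u v) W := by
  have h1 : ∀ u v, ContDiffOn ℝ ∞ (fun y => (w y ![u, v] : ℂ)) W := fun u v =>
    Complex.ofRealCLM.contDiff.comp_contDiffOn (h.contDiffOn_apply u v)
  exact ((h1 _ _).sub (contDiffOn_const.mul (h1 _ _))).div_const 2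

lemma differentiableAt_apply (h : IsLocalPoissonKahler W w) {y : (Fin m → ℂ) × (Fin n → ℂ)}
    (hy : y ∈ W) (u v : (Fin m → ℂ) × (Fin n → ℂ)) :
    DifferentiableAt ℝ (fun x => w x ![u, v]) y :=
  ((h.contDiffOn_apply u v).contDiffAt (W.isOpen.mem_nhds hy)).differentiableAt (by simp)

lemma fderiv_herm2 (h : IsLocalPoissonKahler W w) {y : (Fin m → ℂ) × (Fin n → ℂ)}
    (hy : y ∈ W) (u v z : (Fin m → ℂ) × (Fin n → ℂ)) :
    fderiv ℝ (fun x => herm2 (w x) u v) y z =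
      ((fderiv ℝ (fun x => w x ![u, Complex.I • v]) y z : ℂ)
        - Complex.I * (fderiv ℝ (fun x => w x ![u, v]) y z : ℂ)) / 2 := by
  have h1 : ∀ u v, HasFDerivAt (fun x => (w x ![u, v] : ℂ))
      (Complex.ofRealCLM.comp (fderiv ℝ (fun x => w x ![u, v]) y)) y := fun u v =>
    Complex.ofRealCLM.hasFDerivAt.comp y (h.differentiableAt_apply hy u v).hasFDerivAt
  have h2 := ((h1 u (Complex.I • v)).sub ((h1 u v).const_mul Complex.I)).const_mul (2⁻¹ : ℂ)
  have h3 : (fun x => herm2 (w x) u v) = fun x => (2⁻¹ : ℂ) * ((w x ![u, Complex.I • v] : ℂ)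
      - Complex.I * (w x ![u, v] : ℂ)) := by
    funext x; simp only [herm2]; ring
  rw [h3]
  erw [h2.fderiv]
  simp
  ring

/-- A closed `(1,1)`-form satisfies the Kähler identity `∂_u H(v, z) = ∂_v H(u, z)`. -/
lemma wirt_herm2 (h : IsLocalPoissonKahler W w) {y : (Fin m → ℂ) × (Fin n → ℂ)} (hy : y ∈ W)
    (u v z : (Fin m → ℂ) × (Fin n → ℂ)) :
    wirt u (fun x => herm2 (w x) v z) y = wirt v (fun x => herm2 (w x) u z) y := by
  have hd : DifferentiableAt ℝ w y :=
    (h.smooth.contDiffAt (W.isOpen.mem_nhds hy)).differentiableAt (by simp)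
  have hc : ∀ a b c, fderiv ℝ (fun x => w x ![b, c]) y a - fderiv ℝ (fun x => w x ![a, c]) y b
      + fderiv ℝ (fun x => w x ![a, b]) y c = 0 := by
    intro a b c
    rw [← closed_two_form hd, h.closed y hy]; rfl
  have hI : ∀ a b c, fderiv ℝ (fun x => w x ![Complex.I • a, Complex.I • b]) y c
      = fderiv ℝ (fun x => w x ![a, b]) y c := by
    intro a b c
    congr 1
    exact Filter.EventuallyEq.fderiv_eq
      (Filter.eventuallyEq_of_mem (W.isOpen.mem_nhds hy) fun x hx => h.oneOne x hx a b)
  have hI' : ∀ a b c, fderiv ℝ (fun x => w x ![Complex.I • a, b]) y c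
      = -fderiv ℝ (fun x => w x ![a, Complex.I • b]) y c := by
    intro a b c
    have : fderiv ℝ (fun x => w x ![Complex.I • a, b]) y
        = fderiv ℝ (fun x => -w x ![a, Complex.I • b]) y :=
      Filter.EventuallyEq.fderiv_eq
        (Filter.eventuallyEq_of_mem (W.isOpen.mem_nhds hy) fun x hx =>
          form_I_left (h.oneOne x hx) a b)
    rw [this, fderiv_fun_neg]; simp
  simp only [wirt, h.fderiv_herm2 hy]
  have e1 := hc u v (Complex.I • z)
  have e2 := hc u v z
  have e3 := hc (Complex.I • u) v z
  have e4 := hc u (Complex.I • v) z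
  have e5 := hc (Complex.I • u) (Complex.I • v) z
  have e6 := hc (Complex.I • u) v (Complex.I • z)
  have e7 := hc u (Complex.I • v) (Complex.I • z)
  have e8 := hc (Complex.I • u) (Complex.I • v) (Complex.I • z)
  simp only [hI, hI'] at e1 e2 e3 e4 e5 e6 e7 e8
  apply Complex.ext
  · simp
    linarith
  · simp
    linarith

end IsLocalPoissonKahler

end LocalForm

section LocalForm

open scoped ComplexOrder

variable {m n : ℕ}

namespace IsLocalPoissonKahler

variable {W : TopologicalSpace.Opens ((Fin m → ℂ) × (Fin n → ℂ))}
  {w : (Fin m → ℂ) × (Fin n → ℂ) → ((Fin m → ℂ) × (Fin n → ℂ)) [⋀^Fin 2]→L[ℝ] ℝ}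

/-- The coefficients `H_{A B̄}` of the form, as smooth functions. -/
def coeff (h : IsLocalPoissonKahler W w) (A B : Fin m ⊕ Fin n) : SmoothRing W :=
  SmoothRing.mk (fun y => herm2 (w y) (coordBasis A) (coordBasis B)) (h.contDiffOn_herm2 _ _)

/-- The matrix of the fibre metric over the ring of smooth functions. -/
def gram (h : IsLocalPoissonKahler W w) : Matrix (Fin n) (Fin n) (SmoothRing W) :=
  Matrix.of fun α β => h.coeff (.inr α) (.inr β)

/-- The matrix of the fibre metric at a point. -/
def gramAt (w : (Fin m → ℂ) × (Fin n → ℂ) → ((Fin m → ℂ) × (Fin n → ℂ)) [⋀^Fin 2]→L[ℝ] ℝ)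
    (y : (Fin m → ℂ) × (Fin n → ℂ)) : Matrix (Fin n) (Fin n) ℂ :=
  Matrix.of fun α β => herm2 (w y) (coordBasis (.inr α)) (coordBasis (.inr β))

lemma fn_coeff (h : IsLocalPoissonKahler W w) (A B : Fin m ⊕ Fin n)
    {y : (Fin m → ℂ) × (Fin n → ℂ)} (hy : y ∈ W) :
    SmoothRing.fn (h.coeff A B) y = herm2 (w y) (coordBasis A) (coordBasis B) :=
  SmoothRing.fn_mk _ hy

lemma gram_map_eval (h : IsLocalPoissonKahler W w) {y : (Fin m → ℂ) × (Fin n → ℂ)} (hy : y ∈ W) :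
    h.gram.map (SmoothRing.eval ⟨y, hy⟩) = gramAt w y := by
  ext α β
  simp only [Matrix.map_apply, gram, Matrix.of_apply, SmoothRing.eval_eq_fn, h.fn_coeff _ _ hy,
    gramAt]

lemma posDef (h : IsLocalPoissonKahler W w) {y : (Fin m → ℂ) × (Fin n → ℂ)} (hy : y ∈ W) :
    (gramAt w y).PosDef := by
  have hα := h.oneOne y hy
  refine Matrix.PosDef.of_dotProduct_mulVec_pos ?_ ?_
  · ext α β
    simp [gramAt, Matrix.conjTranspose_apply, ← herm2_conj hα (coordBasis (.inr β))]
  · intro x hx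
    have h1 : star x ⬝ᵥ (gramAt w y).mulVec x = herm2 (w y) (0, star x) (0, star x) := by
      rw [← sum_coordBasis_inr, herm2_sum_left hα]
      simp only [dotProduct, Matrix.mulVec, gramAt, Matrix.of_apply, herm2_sum_right hα]
      refine Finset.sum_congr rfl fun α _ => ?_
      congr 1
      refine Finset.sum_congr rfl fun β _ => ?_
      simp [mul_comm]
    rw [h1, herm2_self]
    have h2 := h.pos y hy (star x) (by simpa using hx)
    exact_mod_cast half_pos h2

lemma isUnit_det_gram (h : IsLocalPoissonKahler W w) : IsUnit h.gram.det := by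
  refine SmoothRing.isUnit_of_ne_zero fun y hy => ?_
  have h1 : SmoothRing.fn h.gram.det y = (gramAt w y).det := by
    rw [← SmoothRing.eval_eq_fn _ hy, RingHom.map_det, ← h.gram_map_eval hy]; rfl
  rw [h1]
  exact (h.posDef hy).det_pos.ne'

/-- The coefficients `a_j^α` of the horizontal lift `∂_j + ∑ a_j^α ∂_α` of `∂_j`. -/
def horiz (h : IsLocalPoissonKahler W w) (j : Fin m) (α : Fin n) : SmoothRing W :=
  -∑ β, h.coeff (.inl j) (.inr β) * h.gram⁻¹ β α

lemma coeff_add_horiz (h : IsLocalPoissonKahler W w) (j : Fin m) (β : Fin n) :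
    h.coeff (.inl j) (.inr β) + ∑ α, h.horiz j α * h.coeff (.inr α) (.inr β) = 0 := by
  have h1 : (fun α => h.horiz j α) = -Matrix.vecMul (fun β => h.coeff (.inl j) (.inr β)) h.gram⁻¹ := by
    funext α; simp [horiz, Matrix.vecMul, dotProduct]
  have h2 : Matrix.vecMul (fun α => h.horiz j α) h.gram = -fun β => h.coeff (.inl j) (.inr β) := by
    rw [h1, Matrix.neg_vecMul, Matrix.vecMul_vecMul, Matrix.nonsing_inv_mul _ h.isUnit_det_gram,
      Matrix.vecMul_one]
  have h3 := congrFun h2 β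
  simp only [Matrix.vecMul, dotProduct, gram, Matrix.of_apply, Pi.neg_apply] at h3
  rw [h3, add_neg_cancel]

/-- The horizontal lift of a vector `v` of the base to a point `y`. -/
def lift (h : IsLocalPoissonKahler W w) (y : (Fin m → ℂ) × (Fin n → ℂ)) (v : Fin m → ℂ) :
    (Fin m → ℂ) × (Fin n → ℂ) :=
  (v, fun α => ∑ j, v j * SmoothRing.fn (h.horiz j α) y)

lemma lift_add (h : IsLocalPoissonKahler W w) (y : (Fin m → ℂ) × (Fin n → ℂ)) (v v' : Fin m → ℂ) :
    h.lift y (v + v') = h.lift y v + h.lift y v' := by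
  ext <;> simp [lift, add_mul, Finset.sum_add_distrib]

lemma lift_smul (h : IsLocalPoissonKahler W w) (y : (Fin m → ℂ) × (Fin n → ℂ)) (z : ℂ)
    (v : Fin m → ℂ) : h.lift y (z • v) = z • h.lift y v := by
  ext <;> simp [lift, Finset.mul_sum, mul_assoc]

lemma lift_eq_sum (h : IsLocalPoissonKahler W w) (y : (Fin m → ℂ) × (Fin n → ℂ)) (v : Fin m → ℂ) :
    h.lift y v = ∑ j, v j • (coordBasis (.inl j) +
      ∑ α, SmoothRing.fn (h.horiz j α) y • coordBasis (.inr α)) := by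
  simp only [smul_add, Finset.sum_add_distrib, sum_coordBasis_inl, sum_coordBasis_inr]
  have : ∀ (z : ℂ) (a : Fin n → ℂ), z • ((0, a) : (Fin m → ℂ) × (Fin n → ℂ)) = (0, z • a) := by
    intro z a; simp
  simp only [this]
  ext <;> simp [lift, Prod.fst_sum, Prod.snd_sum, Finset.sum_apply]

lemma lift_single (h : IsLocalPoissonKahler W w) (y : (Fin m → ℂ) × (Fin n → ℂ)) (j : Fin m) :
    h.lift y (Pi.single j 1) = coordBasis (.inl j) +
      ∑ α, SmoothRing.fn (h.horiz j α) y • coordBasis (.inr α) := by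
  rw [lift_eq_sum, Finset.sum_eq_single j]
  · simp
  · intro b _ hb; simp [hb]
  · simp

lemma herm2_lift_coordBasis (h : IsLocalPoissonKahler W w) {y : (Fin m → ℂ) × (Fin n → ℂ)}
    (hy : y ∈ W) (v : Fin m → ℂ) (β : Fin n) :
    herm2 (w y) (h.lift y v) (coordBasis (.inr β)) = 0 := by
  have hα := h.oneOne y hy
  rw [lift_eq_sum, herm2_sum_left hα]
  refine Finset.sum_eq_zero fun j _ => ?_
  rw [herm2_add_left, herm2_sum_left hα]
  have h1 := congrArg (SmoothRing.eval ⟨y, hy⟩) (h.coeff_add_horiz j β)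
  simp only [map_add, map_sum, map_mul, map_zero, SmoothRing.eval_eq_fn, h.fn_coeff _ _ hy] at h1
  rw [h1, mul_zero]

lemma herm2_lift_vert (h : IsLocalPoissonKahler W w) {y : (Fin m → ℂ) × (Fin n → ℂ)}
    (hy : y ∈ W) (v : Fin m → ℂ) (u : Fin n → ℂ) : herm2 (w y) (h.lift y v) (0, u) = 0 := by
  rw [← sum_coordBasis_inr, herm2_sum_right (h.oneOne y hy)]
  exact Finset.sum_eq_zero fun β _ => by rw [h.herm2_lift_coordBasis hy, mul_zero]

/-- The Gram determinant of a horizontal vector and the fibre basis vanishes because `w^{n+1} = 0`,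
so horizontal vectors are isotropic. -/
lemma herm2_lift_self (h : IsLocalPoissonKahler W w) {y : (Fin m → ℂ) × (Fin n → ℂ)}
    (hy : y ∈ W) (v : Fin m → ℂ) : herm2 (w y) (h.lift y v) (h.lift y v) = 0 := by
  have hα := h.oneOne y hy
  let u : Fin (n + 1) → (Fin m → ℂ) × (Fin n → ℂ) :=
    Fin.cons (h.lift y v) fun α => coordBasis (.inr α)
  have h1 := wedgePow_eq_det hα u
  rw [h.degenerate y hy, Matrix.det_succ_row_zero, Fin.sum_univ_succ, Finset.sum_eq_zero] at h1
  · have h2 : (Matrix.of fun i j => herm2 (w y) (u i) (u j)).submatrix Fin.succ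
        (Fin.succAbove 0) = gramAt w y := by
      ext α β; simp [u, gramAt]
    rw [h2] at h1
    have h3 := (h.posDef hy).det_pos.ne'
    have h4 : ((n + 1).factorial : ℂ) ≠ 0 := by exact_mod_cast (n + 1).factorial_ne_zero
    have h5 : (2 : ℂ) ^ (n + 1) ≠ 0 := pow_ne_zero _ two_ne_zero
    simpa [h3, h4, h5, u] using h1.symm
  · intro β _
    have : herm2 (w y) (u 0) (u β.succ) = 0 := by
      simpa [u] using h.herm2_lift_coordBasis hy v β
    simp [this]

lemma herm2_lift_lift (h : IsLocalPoissonKahler W w) {y : (Fin m → ℂ) × (Fin n → ℂ)}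
    (hy : y ∈ W) (v v' : Fin m → ℂ) : herm2 (w y) (h.lift y v) (h.lift y v') = 0 := by
  have hα := h.oneOne y hy
  have h1 := h.herm2_lift_self hy (v + v')
  have h2 := h.herm2_lift_self hy (v + Complex.I • v')
  simp only [lift_add, lift_smul, herm2_add_left, herm2_add_right, herm2_smul_left hα,
    herm2_smul_right hα, h.herm2_lift_self hy] at h1 h2
  simp only [Complex.star_def, Complex.conj_I, mul_zero, add_zero, zero_add] at h1 h2
  linear_combination (1 / 2 : ℂ) * h1 + (Complex.I / 2) * h2 +
    (herm2 (w y) (h.lift y v) (h.lift y v') / 2 - herm2 (w y) (h.lift y v') (h.lift y v) / 2)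
      * Complex.I_mul_I

lemma coeff_add_horiz_base (h : IsLocalPoissonKahler W w) (j k : Fin m) :
    h.coeff (.inl j) (.inl k) + ∑ α, h.horiz j α * h.coeff (.inr α) (.inl k) = 0 := by
  refine SmoothRing.fn_injective fun y hy => ?_
  have hα := h.oneOne y hy
  have h1 := h.herm2_lift_lift hy (Pi.single j 1) (Pi.single k 1)
  rw [h.lift_single y k, herm2_add_right, herm2_sum_right hα, Finset.sum_eq_zero, add_zero,
    h.lift_single y j, herm2_add_left, herm2_sum_left hα] at h1
  · rw [← SmoothRing.eval_eq_fn _ hy, ← SmoothRing.eval_eq_fn _ hy]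
    simpa only [map_add, map_sum, map_mul, map_zero, SmoothRing.eval_eq_fn, h.fn_coeff _ _ hy]
      using h1
  · intro β _; rw [h.herm2_lift_coordBasis hy, mul_zero]

/-- The differential algebra of the horizontal distribution of a Poisson–Kähler form. -/
def calculus (h : IsLocalPoissonKahler W w) :
    HorizontalCalculus (SmoothRing W) (Fin m) (Fin n) where
  d A := SmoothRing.deriv (coordBasis A)
  H := h.coeff
  a := h.horiz
  d_comm A B f := SmoothRing.deriv_comm _ _ f
  d_dbar A B f := SmoothRing.deriv_star_deriv _ _ f
  star_H A B := SmoothRing.fn_injective fun y hy => by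
    rw [SmoothRing.fn_star, h.fn_coeff _ _ hy]
    simp only [h.fn_coeff _ _ hy, herm2_conj (h.oneOne y hy)]
  closed A B C := SmoothRing.fn_injective fun y hy => by
    rw [SmoothRing.fn_deriv _ _ hy, SmoothRing.fn_deriv _ _ hy]
    refine (wirt_congr (SmoothRing.fn_mk_eventuallyEq (h.contDiffOn_herm2 _ _) hy)).trans ?_
    refine Eq.trans ?_
      (wirt_congr (SmoothRing.fn_mk_eventuallyEq (h.contDiffOn_herm2 _ _) hy)).symm
    exact h.wirt_herm2 hy _ _ _
  lift_vert := h.coeff_add_horiz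
  lift_base := h.coeff_add_horiz_base
  nondeg := h.isUnit_det_gram

end IsLocalPoissonKahler

end LocalForm

/-! ### Pointwise curvature inequality -/

section Pointwise

open scoped ComplexOrder

variable {m n : ℕ}

/-- The coefficients of a sesquilinear form, evaluated on two coordinate vectors. -/
def sesq {ι : Type*} [Fintype ι] (G : ι → ι → ℂ) (a b : ι → ℂ) : ℂ :=
  ∑ j, ∑ k, a j * star (b k) * G j k

lemma cc_sum {κ ι : Type*} [Fintype ι] (c : ι → ℂ) (M : ι → Matrix κ κ ℂ) :
    cc (∑ i, c i • M i) = ∑ i, star (c i) • cc (M i) := by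
  ext α β
  simp [cc, Matrix.sum_apply]

lemma trace_mul_cc_sum {κ ι ι' : Type*} [Fintype κ] [Fintype ι] [Fintype ι'] (a : ι → ℂ)
    (b : ι' → ℂ) (M : ι → Matrix κ κ ℂ) (N : ι' → Matrix κ κ ℂ) :
    ((∑ i, a i • M i) * cc (∑ i, b i • N i)).trace
      = ∑ j, ∑ k, a j * star (b k) * (M j * cc (N k)).trace := by
  rw [cc_sum, Finset.sum_mul, Matrix.trace_sum]
  refine Finset.sum_congr rfl fun j _ => ?_
  rw [Finset.mul_sum, Matrix.trace_sum]
  refine Finset.sum_congr rfl fun k _ => ?_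
  rw [smul_mul_smul_comm, Matrix.trace_smul, smul_eq_mul]

lemma trace_mul_four_sum {κ ι : Type*} [Fintype κ] [Fintype ι] (a b c d : ι → ℂ)
    (M N P Q : ι → Matrix κ κ ℂ) :
    ((∑ i, a i • M i) * (∑ i, b i • N i) * (∑ i, c i • P i) * (∑ i, d i • Q i)).trace
      = ∑ j, ∑ q, ∑ l, ∑ k, a j * b q * c l * d k * (M j * N q * P l * Q k).trace := by
  rw [mul_assoc, mul_assoc, Finset.sum_mul, Matrix.trace_sum]
  refine Finset.sum_congr rfl fun j _ => ?_
  rw [Finset.sum_mul, Finset.mul_sum, Matrix.trace_sum]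
  refine Finset.sum_congr rfl fun q _ => ?_
  rw [Finset.sum_mul, Finset.mul_sum, Finset.mul_sum, Matrix.trace_sum]
  refine Finset.sum_congr rfl fun l _ => ?_
  rw [Finset.mul_sum, Finset.mul_sum, Finset.mul_sum, Matrix.trace_sum]
  refine Finset.sum_congr rfl fun k _ => ?_
  rw [smul_mul_smul_comm, smul_mul_smul_comm, smul_mul_smul_comm, Matrix.trace_smul, smul_eq_mul]
  simp only [mul_assoc]

lemma sum_reverse_three {ι : Type*} [Fintype ι] (F : ι → ι → ι → ℂ) :
    ∑ q, ∑ l, ∑ k, F q l k = ∑ k, ∑ l, ∑ q, F q l k := by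
  rw [Finset.sum_comm, Finset.sum_congr rfl fun l _ => Finset.sum_comm, Finset.sum_comm]

lemma sum_swap_pairs {ι : Type*} [Fintype ι] (F : ι → ι → ι → ι → ℂ) :
    ∑ l, ∑ q, ∑ j, ∑ k, F l q j k = ∑ j, ∑ k, ∑ l, ∑ q, F l q j k := by
  rw [Finset.sum_congr rfl fun l _ => Finset.sum_comm, Finset.sum_comm]
  refine Finset.sum_congr rfl fun j _ => ?_
  rw [Finset.sum_congr rfl fun l _ => Finset.sum_comm, Finset.sum_comm]

lemma symm_sum {κ ι : Type*} [Fintype κ] [Fintype ι] {g : Matrix κ κ ℂ} (a : ι → ℂ)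
    (M : ι → Matrix κ κ ℂ) (h : ∀ i, (M i).transpose * g = g.transpose * M i) :
    (∑ i, a i • M i).transpose * g = g.transpose * ∑ i, a i • M i := by
  rw [Matrix.transpose_sum, Finset.sum_mul, Finset.mul_sum]
  exact Finset.sum_congr rfl fun i _ => by
    rw [Matrix.transpose_smul, smul_mul_assoc, mul_smul_comm, h]

variable {κ ι : Type*} [Fintype κ] [DecidableEq κ] [Fintype ι]

/-- The pointwise form of the curvature inequality.  `A j` are the Kodaira–Spencer tensors, `A₂ j l`
their covariant derivatives, and the tensors `∑ r, x r • A r` are arbitrary comparison tensors, used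
to absorb the term of the curvature that is quadratic in first derivatives. -/
lemma pointwise_curvature {g : Matrix κ κ ℂ} (hg : g.PosDef) {A : ι → Matrix κ κ ℂ}
    {A₂ : ι → ι → Matrix κ κ ℂ} (hA : ∀ j, (A j).transpose * g = g.transpose * A j)
    (hA₂ : ∀ j l, (A₂ j l).transpose * g = g.transpose * A₂ j l) (a b x : ι → ℂ) :
    (∑ j, ∑ k, ∑ l, ∑ q, a j * star (a k) * b l * star (b q) *
        ((A₂ j l * cc (A₂ k q)).trace + (A j * cc (A q) * A l * cc (A k)).trace
          + (A l * cc (A q) * A j * cc (A k)).trace)).re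
      - 2 * (∑ j, ∑ l, ∑ r, a j * b l * star (x r) * (A₂ j l * cc (A r)).trace).re
      + (sesq (fun j k => (A j * cc (A k)).trace) x x).re
    ≥ ((∑ j, a j • A j) * cc (∑ j, b j • A j) * (∑ j, b j • A j) * cc (∑ j, a j • A j)).trace.re
      + ((∑ j, b j • A j) * cc (∑ j, b j • A j) * (∑ j, a j • A j) * cc (∑ j, a j • A j)).trace.re := by
  set P := ∑ r, x r • A r with hP
  set S := ∑ jl : ι × ι, (a jl.1 * b jl.2) • A₂ jl.1 jl.2 with hS
  have hPs : P.transpose * g = g.transpose * P := symm_sum _ _ hA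
  have hSs : S.transpose * g = g.transpose * S := symm_sum _ _ fun jl => hA₂ jl.1 jl.2
  have hD : (S - P).transpose * g = g.transpose * (S - P) := by
    rw [Matrix.transpose_sub, sub_mul, mul_sub, hPs, hSs]
  have h0 := (Complex.le_def.mp (trace_mul_cc_nonneg hg hD)).1
  have hcc : cc (S - P) = cc S - cc P := by ext i j; simp [cc]
  have hsw : (P * cc S).trace = star (S * cc P).trace := by
    have h1 : star (S * cc P).trace = (cc (S * cc P)).trace := by
      simp only [Matrix.trace, star_sum]; rfl
    rw [h1, cc_mul, cc_cc, Matrix.trace_mul_comm]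
  rw [hcc, sub_mul, mul_sub, mul_sub, Matrix.trace_sub, Matrix.trace_sub, Matrix.trace_sub, hsw] at h0
  simp only [Complex.sub_re, Complex.star_def, Complex.conj_re, Complex.zero_re] at h0
  have e1 : (S * cc S).trace = ∑ j, ∑ k, ∑ l, ∑ q, a j * star (a k) * b l * star (b q) *
      (A₂ j l * cc (A₂ k q)).trace := by
    rw [hS, trace_mul_cc_sum, Fintype.sum_prod_type]
    refine Finset.sum_congr rfl fun j _ => ?_
    simp only [Fintype.sum_prod_type]
    rw [Finset.sum_comm]
    refine Finset.sum_congr rfl fun k _ => Finset.sum_congr rfl fun l _ =>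
      Finset.sum_congr rfl fun q _ => ?_
    rw [star_mul']; ring
  have e2 : (S * cc P).trace = ∑ j, ∑ l, ∑ r, a j * b l * star (x r) * (A₂ j l * cc (A r)).trace := by
    rw [hS, hP, trace_mul_cc_sum, Fintype.sum_prod_type]
  have e3 : (P * cc P).trace = sesq (fun j k => (A j * cc (A k)).trace) x x := by
    rw [hP, trace_mul_cc_sum]; rfl
  have e4 : ((∑ j, a j • A j) * cc (∑ j, b j • A j) * (∑ j, b j • A j) * cc (∑ j, a j • A j)).trace
      = ∑ j, ∑ k, ∑ l, ∑ q, a j * star (a k) * b l * star (b q) *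
        (A j * cc (A q) * A l * cc (A k)).trace := by
    rw [cc_sum, cc_sum, trace_mul_four_sum]
    refine Finset.sum_congr rfl fun j _ => ?_
    rw [sum_reverse_three]
    refine Finset.sum_congr rfl fun k _ => Finset.sum_congr rfl fun l _ =>
      Finset.sum_congr rfl fun q _ => by ring
  have e5 : ((∑ j, b j • A j) * cc (∑ j, b j • A j) * (∑ j, a j • A j) * cc (∑ j, a j • A j)).trace
      = ∑ j, ∑ k, ∑ l, ∑ q, a j * star (a k) * b l * star (b q) *
        (A l * cc (A q) * A j * cc (A k)).trace := by
    rw [cc_sum, cc_sum, trace_mul_four_sum, sum_swap_pairs]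
    refine Finset.sum_congr rfl fun j _ => Finset.sum_congr rfl fun k _ =>
      Finset.sum_congr rfl fun l _ => Finset.sum_congr rfl fun q _ => by ring
  simp only [mul_add, Finset.sum_add_distrib, Complex.add_re]
  rw [← e1, ← e2, ← e3, ← e4, ← e5]
  linarith

end Pointwise

/-! ### Differentiation under the fibre integral in fibred coordinates -/

section ParametricIntegral

variable {E₁ E₂ : Type*} [NormedAddCommGroup E₁] [NormedSpace ℝ E₁]
  [NormedAddCommGroup E₂] [NormedSpace ℝ E₂] [FiniteDimensional ℝ E₂]
  [MeasurableSpace E₂] [BorelSpace E₂] (μ : Measure E₂) [μ.IsAddHaarMeasure]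

omit [NormedSpace ℝ E₁] [NormedSpace ℝ E₂] [FiniteDimensional ℝ E₂] in
lemma integrable_slice {F : E₁ × E₂ → ℂ} (hF : Continuous F) (hc : HasCompactSupport F) (y : E₁) :
    Integrable (fun z => F (y, z)) μ := by
  refine Continuous.integrable_of_hasCompactSupport (by fun_prop) ?_
  refine HasCompactSupport.of_support_subset_isCompact (hc.isCompact.image continuous_snd) ?_
  intro z hz
  exact ⟨(y, z), subset_tsupport _ hz, rfl⟩

lemma hasFDerivAt_integral_slice {F : E₁ × E₂ → ℂ} (hF : ContDiff ℝ 1 F)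
    (hc : HasCompactSupport F) (y : E₁) :
    HasFDerivAt (fun x => ∫ z, F (x, z) ∂μ)
      (∫ z, (fderiv ℝ F (y, z)).comp (ContinuousLinearMap.inl ℝ E₁ E₂) ∂μ) y := by
  have hF' : Continuous (fderiv ℝ F) := hF.continuous_fderiv (by simp)
  have hG : Continuous fun p => (fderiv ℝ F p).comp (ContinuousLinearMap.inl ℝ E₁ E₂) := by fun_prop
  have hGc : HasCompactSupport fun p => (fderiv ℝ F p).comp (ContinuousLinearMap.inl ℝ E₁ E₂) :=
    (hc.fderiv (𝕜 := ℝ)).comp_left (g := fun L : E₁ × E₂ →L[ℝ] ℂ =>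
      L.comp (ContinuousLinearMap.inl ℝ E₁ E₂)) (by simp)
  obtain ⟨C, hC⟩ := hGc.exists_bound_of_continuous hG
  set K : Set E₂ := Prod.snd '' tsupport F with hK
  have hKc : IsCompact K := hc.isCompact.image continuous_snd
  refine hasFDerivAt_integral_of_dominated_of_fderiv_le (s := Set.univ)
    (bound := K.indicator fun _ => C) (F' := fun x z =>
      (fderiv ℝ F (x, z)).comp (ContinuousLinearMap.inl ℝ E₁ E₂)) Filter.univ_mem ?_ ?_ ?_ ?_ ?_ ?_
  · exact Filter.Eventually.of_forall fun x => (integrable_slice μ hF.continuous hc x).1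
  · exact integrable_slice μ hF.continuous hc y
  · exact Continuous.aestronglyMeasurable (by fun_prop)
  · refine Filter.Eventually.of_forall fun z x _ => ?_
    by_cases hz : z ∈ K
    · simpa [hz] using hC (x, z)
    · have : fderiv ℝ F (x, z) = 0 := by
        refine image_eq_zero_of_notMem_tsupport (f := fderiv ℝ F) fun h => hz ?_
        exact ⟨(x, z), tsupport_fderiv_subset ℝ h, rfl⟩
      simp [hz, this]
  · exact (integrable_indicator_iff hKc.measurableSet).mpr
      (integrableOn_const (hs := hKc.measure_lt_top.ne))
  · refine Filter.Eventually.of_forall fun z x _ => ?_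
    have h1 : HasFDerivAt F (fderiv ℝ F (x, z)) (x, z) :=
      (hF.differentiable (by simp) (x, z)).hasFDerivAt
    exact h1.comp x ((hasFDerivAt_id x).prodMk (hasFDerivAt_const z x))

lemma fderiv_integral_slice_apply {F : E₁ × E₂ → ℂ} (hF : ContDiff ℝ 1 F)
    (hc : HasCompactSupport F) (y v : E₁) :
    fderiv ℝ (fun x => ∫ z, F (x, z) ∂μ) y v = ∫ z, fderiv ℝ F (y, z) (v, 0) ∂μ := by
  have hF' : Continuous (fderiv ℝ F) := hF.continuous_fderiv (by simp)
  rw [(hasFDerivAt_integral_slice μ hF hc y).fderiv, ContinuousLinearMap.integral_apply]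
  · rfl
  · have hG : Continuous fun z => (fderiv ℝ F (y, z)).comp (ContinuousLinearMap.inl ℝ E₁ E₂) := by
      fun_prop
    refine hG.integrable_of_hasCompactSupport ?_
    refine HasCompactSupport.of_support_subset_isCompact (hc.isCompact.image continuous_snd) ?_
    intro z hz
    refine ⟨(y, z), tsupport_fderiv_subset ℝ (subset_tsupport _ (fun h => hz ?_)), rfl⟩
    simp [h]

lemma integral_fderiv_vert_eq_zero {F : E₁ × E₂ → ℂ} (hF : ContDiff ℝ 1 F)
    (hc : HasCompactSupport F) (y : E₁) (u : E₂) : ∫ z, fderiv ℝ F (y, z) (0, u) ∂μ = 0 := by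
  have hF' : Continuous (fderiv ℝ F) := hF.continuous_fderiv (by simp)
  have h1 : ∀ z, fderiv ℝ F (y, z) (0, u) = fderiv ℝ (fun z => F (y, z)) z u := by
    intro z
    have h2 : HasFDerivAt F (fderiv ℝ F (y, z)) (y, z) :=
      (hF.differentiable (by simp) (y, z)).hasFDerivAt
    have h3 := h2.comp z ((hasFDerivAt_const y z).prodMk (hasFDerivAt_id z))
    have h4 : fderiv ℝ (fun z => F (y, z)) z = _ := h3.fderiv
    rw [h4]; simp
  have hint : Integrable (fun z => fderiv ℝ F (y, z) (0, u)) μ := by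
    have hcs : HasCompactSupport fun p => fderiv ℝ F p (0, u) :=
      (hc.fderiv (𝕜 := ℝ)).comp_left (g := fun L : E₁ × E₂ →L[ℝ] ℂ => L (0, u)) (by simp)
    exact integrable_slice μ (by fun_prop) hcs y
  have h5 := integral_mul_fderiv_eq_neg_fderiv_mul_of_integrable (μ := μ) (𝕜 := ℂ)
    (f := fun _ : E₂ => (1 : ℂ)) (g := fun z => F (y, z)) (v := u) (by simp)
    (by simpa [← h1] using hint) (by simpa using integrable_slice μ hF.continuous hc y)
    (fun _ _ => by fun_prop) (fun z _ =>
      (hF.differentiable (by simp)).differentiableAt.comp z (by fun_prop))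
  simpa [h1] using h5

end ParametricIntegral

section LocalTransport

open scoped ComplexOrder

namespace SmoothRing

variable {E : Type*} [NormedAddCommGroup E] [NormedSpace ℂ E] {W : TopologicalSpace.Opens E}

/-- A smooth function on `W` has compact support in `W`. -/
def CompactSupp (f : SmoothRing W) : Prop :=
  ∃ K : Set E, IsCompact K ∧ K ⊆ W ∧ ∀ y ∉ K, fn f y = 0

lemma CompactSupp.mul_right {f : SmoothRing W} (hf : CompactSupp f) (g : SmoothRing W) :
    CompactSupp (f * g) := by
  obtain ⟨K, hK, hKW, h⟩ := hf
  exact ⟨K, hK, hKW, fun y hy => by rw [fn_mul, Pi.mul_apply, h y hy, zero_mul]⟩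

lemma CompactSupp.mul_left {f : SmoothRing W} (hf : CompactSupp f) (g : SmoothRing W) :
    CompactSupp (g * f) := by rw [mul_comm]; exact hf.mul_right g

lemma CompactSupp.hasCompactSupport {f : SmoothRing W} (hf : CompactSupp f) :
    HasCompactSupport (fn f) := by
  obtain ⟨K, hK, -, h⟩ := hf
  exact HasCompactSupport.intro hK h

lemma CompactSupp.contDiff {f : SmoothRing W} (hf : CompactSupp f) : ContDiff ℝ ∞ (fn f) := by
  obtain ⟨K, hK, hKW, h⟩ := hf
  rw [contDiff_iff_contDiffAt]
  intro y
  by_cases hy : y ∈ W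
  · exact contDiffAt_fn f hy
  · have hy' : y ∈ Kᶜ := fun h => hy (hKW h)
    exact (contDiffAt_const (c := (0 : ℂ))).congr_of_eventuallyEq
      (Filter.eventuallyEq_of_mem (hK.isClosed.isOpen_compl.mem_nhds hy') fun z hz => h z hz)

lemma CompactSupp.wirt_fn {f : SmoothRing W} (hf : CompactSupp f) (u y : E) :
    wirt u (fn f) y = fn (deriv u f) y := by
  by_cases hy : y ∈ W
  · rw [fn_deriv u f hy]
  · obtain ⟨K, hK, hKW, h⟩ := hf
    have hy' : y ∈ Kᶜ := fun h => hy (hKW h)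
    have h1 : fn f =ᶠ[nhds y] fun _ => 0 :=
      Filter.eventuallyEq_of_mem (hK.isClosed.isOpen_compl.mem_nhds hy') fun z hz => h z hz
    rw [wirt_congr h1]
    simp [wirt, fn, extendZero, hy]

lemma CompactSupp.deriv {f : SmoothRing W} (hf : CompactSupp f) (u : E) :
    CompactSupp (deriv u f) := by
  obtain ⟨K, hK, hKW, h⟩ := id hf
  refine ⟨K, hK, hKW, fun y hy => ?_⟩
  have h1 : fn f =ᶠ[nhds y] fun _ => 0 :=
      Filter.eventuallyEq_of_mem (hK.isClosed.isOpen_compl.mem_nhds hy) fun z hz => h z hz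
  rw [← hf.wirt_fn, wirt_congr h1]
  simp [wirt]

end SmoothRing

variable {m n : ℕ} {W : TopologicalSpace.Opens ((Fin m → ℂ) × (Fin n → ℂ))}
  {w : (Fin m → ℂ) × (Fin n → ℂ) → ((Fin m → ℂ) × (Fin n → ℂ)) [⋀^Fin 2]→L[ℝ] ℝ}

lemma wirt_integral_slice {F : (Fin m → ℂ) × (Fin n → ℂ) → ℂ} (hF : ContDiff ℝ 1 F)
    (hc : HasCompactSupport F) (y : Fin m → ℂ) (l : Fin m) :
    wirt (Pi.single l 1) (fun x => ∫ z, F (x, z)) y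
      = ∫ z, wirt (coordBasis (.inl l)) F (y, z) := by
  have hF' : Continuous (fderiv ℝ F) := hF.continuous_fderiv (by simp)
  have hint : ∀ v, Integrable (fun z : Fin n → ℂ => fderiv ℝ F (y, z) v) := by
    intro v
    have hcs : HasCompactSupport fun p => fderiv ℝ F p v :=
      (hc.fderiv (𝕜 := ℝ)).comp_left (g := fun L : _ →L[ℝ] ℂ => L v) (by simp)
    exact integrable_slice volume (by fun_prop) hcs y
  simp only [wirt, fderiv_integral_slice_apply volume hF hc]
  rw [integral_const_mul, integral_sub (hint _) ((hint _).const_mul _), integral_const_mul]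
  simp [coordBasis]

lemma integral_wirt_vert {F : (Fin m → ℂ) × (Fin n → ℂ) → ℂ} (hF : ContDiff ℝ 1 F)
    (hc : HasCompactSupport F) (y : Fin m → ℂ) (α : Fin n) :
    ∫ z, wirt (coordBasis (.inr α)) F (y, z) = 0 := by
  have hF' : Continuous (fderiv ℝ F) := hF.continuous_fderiv (by simp)
  have hint : ∀ v, Integrable (fun z : Fin n → ℂ => fderiv ℝ F (y, z) v) := by
    intro v
    have hcs : HasCompactSupport fun p => fderiv ℝ F p v :=
      (hc.fderiv (𝕜 := ℝ)).comp_left (g := fun L : _ →L[ℝ] ℂ => L v) (by simp)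
    exact integrable_slice volume (by fun_prop) hcs y
  have h0 : Complex.I • ((0, Pi.single α 1) : (Fin m → ℂ) × (Fin n → ℂ))
      = (0, Complex.I • Pi.single α 1) := by simp
  simp only [wirt, coordBasis, h0]
  rw [integral_const_mul, integral_sub (hint _) ((hint _).const_mul _), integral_const_mul,
    integral_fderiv_vert_eq_zero volume hF hc, integral_fderiv_vert_eq_zero volume hF hc]
  simp

namespace IsLocalPoissonKahler

/-- The integral of `f` over the part of the fibre over `y` that lies in the coordinate domain, with
respect to the density `det g`. -/
def localIntegral (h : IsLocalPoissonKahler W w) (f : SmoothRing W) (y : Fin m → ℂ) : ℂ :=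
  ∫ z, SmoothRing.fn (f * h.gram.det) (y, z)

lemma differentiable_localIntegral (h : IsLocalPoissonKahler W w) {f : SmoothRing W}
    (hf : SmoothRing.CompactSupp f) : Differentiable ℝ (h.localIntegral f) := fun y =>
  (hasFDerivAt_integral_slice volume ((hf.mul_right _).contDiff.of_le (by simp))
    (hf.mul_right _).hasCompactSupport y).differentiableAt

/-- Fibre integrals are differentiated by differentiating the integrand along the horizontal
lift. -/
lemma wirt_localIntegral (h : IsLocalPoissonKahler W w) {f : SmoothRing W}
    (hf : SmoothRing.CompactSupp f) (l : Fin m) (y : Fin m → ℂ) :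
    wirt (Pi.single l 1) (h.localIntegral f) y = h.localIntegral (h.calculus.V l f) y := by
  have hF := hf.mul_right h.gram.det
  have hF' : ∀ α, SmoothRing.CompactSupp (h.horiz l α * (f * h.gram.det)) := fun α => hF.mul_left _
  have h0 : h.localIntegral f = fun x => ∫ z, SmoothRing.fn (f * h.gram.det) (x, z) := rfl
  have h1 : wirt (Pi.single l 1) (h.localIntegral f) y
      = ∫ z, SmoothRing.fn (SmoothRing.deriv (coordBasis (.inl l)) (f * h.gram.det)) (y, z) := by
    have := wirt_integral_slice (hF.contDiff.of_le (by simp)) hF.hasCompactSupport y l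
    rw [h0, this]
    simp only [hF.wirt_fn]
  have h2 : ∀ α, ∫ z, SmoothRing.fn (SmoothRing.deriv (coordBasis (.inr α))
      (h.horiz l α * (f * h.gram.det))) (y, z) = 0 := by
    intro α
    have := integral_wirt_vert ((hF' α).contDiff.of_le (by simp)) (hF' α).hasCompactSupport y α
    simpa only [(hF' α).wirt_fn] using this
  have hint : ∀ g : SmoothRing W, SmoothRing.CompactSupp g →
      Integrable fun z => SmoothRing.fn g (y, z) := fun g hg =>
    integrable_slice volume hg.contDiff.continuous hg.hasCompactSupport y
  have key : h.calculus.V l f * h.gram.det = SmoothRing.deriv (coordBasis (.inl l)) (f * h.gram.det)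
      + ∑ α, SmoothRing.deriv (coordBasis (.inr α)) (h.horiz l α * (f * h.gram.det)) :=
    h.calculus.V_mul_det l f
  have hsum : ∀ s : Finset (Fin n), Integrable (fun z => SmoothRing.fn (∑ α ∈ s,
      SmoothRing.deriv (coordBasis (.inr α)) (h.horiz l α * (f * h.gram.det))) (y, z)) ∧
      ∫ z, SmoothRing.fn (∑ α ∈ s,
      SmoothRing.deriv (coordBasis (.inr α)) (h.horiz l α * (f * h.gram.det))) (y, z) = 0 := by
    intro s
    induction s using Finset.cons_induction with
    | empty =>
      have : ∀ x : (Fin m → ℂ) × (Fin n → ℂ), SmoothRing.fn (0 : SmoothRing W) x = 0 := by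
        intro x; by_cases hx : x ∈ W <;> simp [SmoothRing.fn, extendZero, hx]
      simp [this]
    | cons a s ha ih =>
      simp only [Finset.sum_cons, SmoothRing.fn_add, Pi.add_apply]
      refine ⟨(hint _ ((hF' a).deriv _)).add ih.1, ?_⟩
      rw [integral_add (hint _ ((hF' a).deriv _)) ih.1, h2, ih.2, add_zero]
  rw [h1, localIntegral, key]
  simp only [SmoothRing.fn_add, Pi.add_apply]
  rw [integral_add (hint _ (hF.deriv _)) (hsum _).1, (hsum _).2, add_zero]

/-- The Kodaira–Spencer matrix in fibred coordinates at a point. -/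
def ksMatrix (h : IsLocalPoissonKahler W w) (y : W) (j : Fin m) : Matrix (Fin n) (Fin n) ℂ :=
  (h.calculus.A j).map (SmoothRing.eval y)

/-- The covariant derivative of the Kodaira–Spencer matrix at a point. -/
def ksMatrix₂ (h : IsLocalPoissonKahler W w) (y : W) (j l : Fin m) : Matrix (Fin n) (Fin n) ℂ :=
  (h.calculus.A₂ j l).map (SmoothRing.eval y)

lemma map_eval_symm (h : IsLocalPoissonKahler W w) (y : W)
    {M : Matrix (Fin n) (Fin n) (SmoothRing W)}
    (hM : M.transpose * h.gram = h.gram.transpose * M) :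
    (M.map (SmoothRing.eval y)).transpose * gramAt w y
      = (gramAt w y).transpose * M.map (SmoothRing.eval y) := by
  rw [← h.gram_map_eval y.2]
  have := congrArg (fun N => N.map (SmoothRing.eval y)) hM
  simpa [Matrix.map_mul, Matrix.transpose_map] using this

lemma ksMatrix_symm (h : IsLocalPoissonKahler W w) (y : W) (j : Fin m) :
    (h.ksMatrix y j).transpose * gramAt w y = (gramAt w y).transpose * h.ksMatrix y j :=
  h.map_eval_symm y (h.calculus.A_symm j)

lemma ksMatrix₂_symm (h : IsLocalPoissonKahler W w) (y : W) (j l : Fin m) :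
    (h.ksMatrix₂ y j l).transpose * gramAt w y = (gramAt w y).transpose * h.ksMatrix₂ y j l :=
  h.map_eval_symm y (h.calculus.A₂_transpose j l)

lemma eval_trace (y : W) (M : Matrix (Fin n) (Fin n) (SmoothRing W)) :
    SmoothRing.eval y M.trace = (M.map (SmoothRing.eval y)).trace :=
  AddMonoidHom.map_trace (SmoothRing.eval y).toAddMonoidHom M

lemma map_eval_cc (y : W) (M : Matrix (Fin n) (Fin n) (SmoothRing W)) :
    (cc M).map (SmoothRing.eval y) = cc (M.map (SmoothRing.eval y)) := rfl

lemma eval_f (h : IsLocalPoissonKahler W w) (y : W) (j k : Fin m) :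
    SmoothRing.eval y (h.calculus.f j k) = (h.ksMatrix y j * cc (h.ksMatrix y k)).trace := by
  rw [HorizontalCalculus.f, eval_trace, Matrix.map_mul, map_eval_cc]; rfl

lemma eval_V_f (h : IsLocalPoissonKahler W w) (y : W) (l j k : Fin m) :
    SmoothRing.eval y (h.calculus.V l (h.calculus.f j k))
      = (h.ksMatrix₂ y j l * cc (h.ksMatrix y k)).trace := by
  rw [HorizontalCalculus.V_f, eval_trace, Matrix.map_mul, map_eval_cc]; rfl

lemma eval_V_Vbar_f (h : IsLocalPoissonKahler W w) (y : W) (q l j k : Fin m) :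
    SmoothRing.eval y (h.calculus.V l (h.calculus.Vbar q (h.calculus.f j k)))
      = (h.ksMatrix₂ y j l * cc (h.ksMatrix₂ y k q)).trace
        + (h.ksMatrix y j * cc (h.ksMatrix y q) * h.ksMatrix y l * cc (h.ksMatrix y k)).trace
        + (h.ksMatrix y l * cc (h.ksMatrix y q) * h.ksMatrix y j * cc (h.ksMatrix y k)).trace := by
  rw [← HorizontalCalculus.Vbar_V, HorizontalCalculus.Vbar_V_f]
  simp only [map_add, eval_trace, Matrix.map_mul, map_eval_cc]; rfl

end IsLocalPoissonKahler

end LocalTransport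

/-! ### Tensors on complex manifolds in arbitrary holomorphic charts -/

section Charts

variable {E : Type*} [NormedAddCommGroup E] [NormedSpace ℂ E]
variable {M : Type*} [TopologicalSpace M] [ChartedSpace E M]
variable {c c' : OpenPartialHomeomorph M E}

lemma mdifferentiable_chart (hc : c ∈ IsManifold.maximalAtlas 𝓘(ℂ, E) ω M) :
    c.MDifferentiable 𝓘(ℂ, E) 𝓘(ℂ, E) :=
  ⟨(contMDiffOn_of_mem_maximalAtlas hc).mdifferentiableOn (by simp),
    (contMDiffOn_symm_of_mem_maximalAtlas hc).mdifferentiableOn (by simp)⟩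

lemma contDiffAt_transition (hc : c ∈ IsManifold.maximalAtlas 𝓘(ℂ, E) ω M)
    (hc' : c' ∈ IsManifold.maximalAtlas 𝓘(ℂ, E) ω M) {y : E} (hy : y ∈ c.target)
    (hy' : c.symm y ∈ c'.source) : ContDiffAt ℂ ω (fun z => c' (c.symm z)) y := by
  have h := (contMDiffAt_of_mem_maximalAtlas hc' hy').comp y
    (contMDiffAt_symm_of_mem_maximalAtlas hc hy)
  exact h.contDiffAt

omit [NormedSpace ℂ E] [ChartedSpace E M] in
lemma transition_eventually {y : E} (hy : y ∈ c.target) (hy' : c.symm y ∈ c'.source) :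
    ∀ᶠ z in nhds y, z ∈ c.target ∧ c.symm z ∈ c'.source := by
  have := (c.symm.trans c').open_source.mem_nhds (x := y) (by simp [hy, hy'])
  filter_upwards [this] with z hz
  simpa using hz

lemma mfderiv_symm_transition (hc : c ∈ IsManifold.maximalAtlas 𝓘(ℂ, E) ω M)
    (hc' : c' ∈ IsManifold.maximalAtlas 𝓘(ℂ, E) ω M) {y : E} (hy : y ∈ c.target)
    (hy' : c.symm y ∈ c'.source) (u : E) :
    (mfderiv 𝓘(ℂ, E) 𝓘(ℂ, E) c.symm y u : E)
      = mfderiv 𝓘(ℂ, E) 𝓘(ℂ, E) c'.symm (c' (c.symm y)) (fderiv ℂ (fun z => c' (c.symm z)) y u) := by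
  have h1 : (c.symm : E → M) =ᶠ[nhds y] c'.symm ∘ fun z => c' (c.symm z) := by
    filter_upwards [transition_eventually hy hy'] with z hz
    simp [hz.2]
  have h2 : MDifferentiableAt 𝓘(ℂ, E) 𝓘(ℂ, E) (fun z => c' (c.symm z)) y :=
    ((contDiffAt_transition hc hc' hy hy').differentiableAt (by simp)).mdifferentiableAt
  have h3 : MDifferentiableAt 𝓘(ℂ, E) 𝓘(ℂ, E) c'.symm (c' (c.symm y)) :=
    (mdifferentiable_chart hc').mdifferentiableAt_symm (c'.map_source hy')
  have h4 := h1.mfderiv_eq (I := 𝓘(ℂ, E)) (I' := 𝓘(ℂ, E))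
  have h5 := mfderiv_comp y h3 h2
  rw [mfderiv_eq_fderiv] at h5
  have h6 := h4.trans h5
  exact DFunLike.congr_fun (F := E →L[ℂ] E) h6 u

lemma mfderiv_transition (hc : c ∈ IsManifold.maximalAtlas 𝓘(ℂ, E) ω M)
    (hc' : c' ∈ IsManifold.maximalAtlas 𝓘(ℂ, E) ω M) {x : M} (hx : x ∈ c.source)
    (hx' : x ∈ c'.source) (u : TangentSpace 𝓘(ℂ, E) x) :
    (mfderiv 𝓘(ℂ, E) 𝓘(ℂ, E) c' x u : E)
      = fderiv ℂ (fun z => c' (c.symm z)) (c x) (mfderiv 𝓘(ℂ, E) 𝓘(ℂ, E) c x u) := by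
  have h1 : (c' : M → E) =ᶠ[nhds x] (fun z => c' (c.symm z)) ∘ c := by
    filter_upwards [c.open_source.mem_nhds hx] with z hz
    simp [hz]
  have h2 : MDifferentiableAt 𝓘(ℂ, E) 𝓘(ℂ, E) (fun z => c' (c.symm z)) (c x) :=
    ((contDiffAt_transition hc hc' (c.map_source hx)
      (by simpa [hx] using hx')).differentiableAt (by simp)).mdifferentiableAt
  have h3 : MDifferentiableAt 𝓘(ℂ, E) 𝓘(ℂ, E) c x :=
    (mdifferentiable_chart hc).mdifferentiableAt hx
  have h4 := h1.mfderiv_eq (I := 𝓘(ℂ, E)) (I' := 𝓘(ℂ, E))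
  have h5 := mfderiv_comp x h2 h3
  rw [mfderiv_eq_fderiv] at h5
  have h6 := h4.trans h5
  exact DFunLike.congr_fun (F := E →L[ℂ] E) h6 u

lemma mfderiv_symm_mfderiv (hc : c ∈ IsManifold.maximalAtlas 𝓘(ℂ, E) ω M) {x : M}
    (hx : x ∈ c.source) (u : TangentSpace 𝓘(ℂ, E) x) :
    (mfderiv 𝓘(ℂ, E) 𝓘(ℂ, E) c.symm (c x) (mfderiv 𝓘(ℂ, E) 𝓘(ℂ, E) c x u) : E) = u :=
  DFunLike.congr_fun (F := E →L[ℂ] E) ((mdifferentiable_chart hc).symm_comp_deriv hx) u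

lemma mfderiv_mfderiv_symm (hc : c ∈ IsManifold.maximalAtlas 𝓘(ℂ, E) ω M) {y : E}
    (hy : y ∈ c.target) (u : E) :
    (mfderiv 𝓘(ℂ, E) 𝓘(ℂ, E) c (c.symm y) (mfderiv 𝓘(ℂ, E) 𝓘(ℂ, E) c.symm y u) : E) = u :=
  DFunLike.congr_fun (F := E →L[ℂ] E) ((mdifferentiable_chart hc).comp_symm_deriv hy) u

/-- The two-form `Ω` written in the holomorphic chart `c`. -/
def TwoForm.formIn (Ω : TwoForm E M) (c : OpenPartialHomeomorph M E) (y : E) :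
    E [⋀^Fin 2]→L[ℝ] ℝ :=
  (Ω (c.symm y)).compContinuousLinearMap
    ((mfderiv 𝓘(ℂ, E) 𝓘(ℂ, E) c.symm y).restrictScalars ℝ)

lemma TwoForm.formIn_apply (Ω : TwoForm E M) (c : OpenPartialHomeomorph M E) (y u v : E) :
    Ω.formIn c y ![u, v] = Ω (c.symm y) ![mfderiv 𝓘(ℂ, E) 𝓘(ℂ, E) c.symm y u,
      mfderiv 𝓘(ℂ, E) 𝓘(ℂ, E) c.symm y v] := by
  refine congrArg (Ω (c.symm y)) (funext fun i => ?_)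
  fin_cases i <;> rfl

lemma TwoForm.herm2_formIn (Ω : TwoForm E M) (c : OpenPartialHomeomorph M E) (y u v : E) :
    herm2 (Ω.formIn c y) u v = Ω.herm (c.symm y) (mfderiv 𝓘(ℂ, E) 𝓘(ℂ, E) c.symm y u)
      (mfderiv 𝓘(ℂ, E) 𝓘(ℂ, E) c.symm y v) := by
  have h := (mfderiv 𝓘(ℂ, E) 𝓘(ℂ, E) c.symm y).map_smul Complex.I v
  simp only [herm2, TwoForm.herm, TwoForm.formIn_apply]
  erw [h]

lemma TwoForm.formIn_transition (Ω : TwoForm E M) (hc : c ∈ IsManifold.maximalAtlas 𝓘(ℂ, E) ω M)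
    (hc' : c' ∈ IsManifold.maximalAtlas 𝓘(ℂ, E) ω M) {y : E} (hy : y ∈ c.target)
    (hy' : c.symm y ∈ c'.source) :
    Ω.formIn c y = (Ω.formIn c' (c' (c.symm y))).compContinuousLinearMap
      (fderiv ℝ (fun z => c' (c.symm z)) y) := by
  have h1 : fderiv ℝ (fun z => c' (c.symm z)) y
      = (fderiv ℂ (fun z => c' (c.symm z)) y).restrictScalars ℝ :=
    ((contDiffAt_transition hc hc' hy hy').differentiableAt (by simp)).fderiv_restrictScalars ℝ
  ext v
  rw [h1]
  have h2 : ∀ x, x = c.symm y → ∀ L : E →L[ℂ] E,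
      (Ω (c.symm y)).compContinuousLinearMap (L.restrictScalars ℝ) v
        = (Ω x).compContinuousLinearMap (L.restrictScalars ℝ) v := by
    rintro x rfl L; rfl
  refine Eq.trans ?_ (h2 _ (c'.left_inv hy') ((mfderiv 𝓘(ℂ, E) 𝓘(ℂ, E) c'.symm
    (c' (c.symm y)) : E →L[ℂ] E).comp (fderiv ℂ (fun z => c' (c.symm z)) y)))
  exact congrArg (Ω (c.symm y)) (funext fun i => mfderiv_symm_transition hc hc' hy hy' (v i))

lemma contDiffAt_transition_real (hc : c ∈ IsManifold.maximalAtlas 𝓘(ℂ, E) ω M)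
    (hc' : c' ∈ IsManifold.maximalAtlas 𝓘(ℂ, E) ω M) {y : E} (hy : y ∈ c.target)
    (hy' : c.symm y ∈ c'.source) : ContDiffAt ℝ ∞ (fun z => c' (c.symm z)) y :=
  ((contDiffAt_transition hc hc' hy hy').restrict_scalars ℝ).of_le (by simp)

lemma contDiff_curryLeft {E : Type*} [NormedAddCommGroup E] [NormedSpace ℝ E] {k : ℕ} :
    ContDiff ℝ ∞ (fun α : E [⋀^Fin (k + 1)]→L[ℝ] ℝ => α.curryLeft) := by
  refine IsBoundedLinearMap.contDiff (IsLinearMap.with_bound ⟨fun _ _ => rfl, fun _ _ => rfl⟩ 1 ?_)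
  intro α
  rw [one_mul]
  exact (ContinuousAlternatingMap.norm_curryLeft (𝕜 := ℝ) α).le

/-- The pull-back of a smooth form by a smooth map is smooth. -/
lemma contDiffAt_pullback {E F : Type*} [NormedAddCommGroup E] [NormedSpace ℝ E]
    [NormedAddCommGroup F] [NormedSpace ℝ F]
    {w : E → E [⋀^Fin 2]→L[ℝ] ℝ} {f : F → E} {y : F} (hw : ContDiffAt ℝ ∞ w (f y))
    (hf : ContDiffAt ℝ ∞ f y) (u v : F) :
    ContDiffAt ℝ ∞ (fun z => w (f z) ![fderiv ℝ f z u, fderiv ℝ f z v]) y := by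
  have hf' : ContDiffAt ℝ ∞ (fderiv ℝ f) y := hf.fderiv_right (by simp)
  have h1 : ContDiffAt ℝ ∞ (fun z => (w (f z)).curryLeft) y :=
    contDiff_curryLeft.contDiffAt.comp y (hw.comp y hf)
  have h2 := h1.clm_apply (hf'.clm_apply (contDiffAt_const (c := u)))
  have h3 : ContDiffAt ℝ ∞ (fun z => ((w (f z)).curryLeft (fderiv ℝ f z u)).curryLeft) y :=
    contDiff_curryLeft.contDiffAt.comp y h2
  have h4 := h3.clm_apply (hf'.clm_apply (contDiffAt_const (c := v)))
  exact (ContinuousAlternatingMap.apply ℝ _ ℝ ![]).contDiff.contDiffAt.comp y h4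

/-- On a finite-dimensional space a form with smooth coefficients is smooth. -/
lemma contDiffAt_form_of_apply {E F : Type*} [NormedAddCommGroup E] [NormedSpace ℝ E]
    [FiniteDimensional ℝ E] [NormedAddCommGroup F] [NormedSpace ℝ F]
    {w : F → E [⋀^Fin 2]→L[ℝ] ℝ} {y : F}
    (hw : ∀ u v, ContDiffAt ℝ ∞ (fun z => w z ![u, v]) y) : ContDiffAt ℝ ∞ w y := by
  let b := Module.finBasis ℝ E
  let T : (E [⋀^Fin 2]→L[ℝ] ℝ) →ₗ[ℝ] (Fin 2 → Fin (Module.finrank ℝ E)) → ℝ :=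
    { toFun := fun α i => α fun k => b (i k)
      map_add' := fun _ _ => rfl
      map_smul' := fun _ _ => rfl }
  have hT : LinearMap.ker T = ⊥ := by
    rw [LinearMap.ker_eq_bot]
    intro α β hαβ
    apply ContinuousAlternatingMap.toAlternatingMap_injective
    refine Module.Basis.ext_alternating b fun i _ => ?_
    exact congrFun hαβ i
  obtain ⟨S, hS⟩ := T.exists_leftInverse_of_injective hT
  have hS' : w = fun z => (LinearMap.toContinuousLinearMap S) (T (w z)) := by
    funext z
    exact (LinearMap.congr_fun hS (w z)).symm
  rw [hS']
  refine (LinearMap.toContinuousLinearMap S).contDiff.contDiffAt.comp y ?_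
  rw [contDiffAt_pi]
  intro i
  have h1 : (fun z => T (w z) i) = fun z => w z ![b (i 0), b (i 1)] := by
    funext z
    show w z _ = w z _
    congr 1
    ext k; fin_cases k <;> rfl
  rw [h1]
  exact hw _ _

variable [IsManifold 𝓘(ℂ, E) ω M] [FiniteDimensional ℂ E] {Ω : TwoForm E M}

lemma IsClosedOneOne.contDiffAt_formIn (hΩ : IsClosedOneOne Ω)
    (hc : c ∈ IsManifold.maximalAtlas 𝓘(ℂ, E) ω M) {y : E} (hy : y ∈ c.target) :
    ContDiffAt ℝ ∞ (Ω.formIn c) y := by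
  have : FiniteDimensional ℝ E := FiniteDimensional.complexToReal E
  set c' := chartAt E (c.symm y) with hc'
  have hm : c' ∈ IsManifold.maximalAtlas 𝓘(ℂ, E) ω M := IsManifold.chart_mem_maximalAtlas _
  have hy' : c.symm y ∈ c'.source := mem_chart_source _ _
  refine contDiffAt_form_of_apply fun u v => ?_
  have h1 : ContDiffAt ℝ ∞ (Ω.formIn c') (c' (c.symm y)) :=
    (hΩ.smooth (c.symm y)).contDiffAt (c'.open_target.mem_nhds (c'.map_source hy'))
  refine (contDiffAt_pullback (f := fun z => c' (c.symm z)) h1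
    (contDiffAt_transition_real hc hm hy hy') u v).congr_of_eventuallyEq ?_
  filter_upwards [transition_eventually hy hy'] with z hz
  rw [Ω.formIn_transition hc hm hz.1 hz.2, ContinuousAlternatingMap.compContinuousLinearMap_apply]
  congr 1
  ext i; fin_cases i <;> rfl

lemma IsClosedOneOne.extDeriv_formIn (hΩ : IsClosedOneOne Ω)
    (hc : c ∈ IsManifold.maximalAtlas 𝓘(ℂ, E) ω M) {y : E} (hy : y ∈ c.target) :
    extDeriv (Ω.formIn c) y = 0 := by
  set c' := chartAt E (c.symm y) with hc'
  have hm : c' ∈ IsManifold.maximalAtlas 𝓘(ℂ, E) ω M := IsManifold.chart_mem_maximalAtlas _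
  have hy' : c.symm y ∈ c'.source := mem_chart_source _ _
  have h0 : Ω.formIn c =ᶠ[nhds y] fun z => (Ω.formIn c' (c' (c.symm z))).compContinuousLinearMap
      (fderiv ℝ (fun z => c' (c.symm z)) z) := by
    filter_upwards [transition_eventually hy hy'] with z hz
    rw [Ω.formIn_transition hc hm hz.1 hz.2]
  rw [h0.extDeriv_eq, extDeriv_pullback (r := ∞)]
  · have h1 : extDeriv (Ω.formIn c') (c' (c.symm y)) = 0 :=
      hΩ.closed (c.symm y) _ (c'.map_source hy')
    rw [h1]; ext; simp
  · exact (hΩ.contDiffAt_formIn hm (c'.map_source hy')).differentiableAt (by simp)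
  · exact contDiffAt_transition_real hc hm hy hy'
  · rw [minSmoothness_of_isRCLikeNormedField]; exact WithTop.coe_le_coe.mpr le_top

omit [FiniteDimensional ℂ E] [IsManifold 𝓘(ℂ, E) ω M] in
lemma IsClosedOneOne.oneOne_formIn (hΩ : IsClosedOneOne Ω) (y u v : E) :
    Ω.formIn c y ![Complex.I • u, Complex.I • v] = Ω.formIn c y ![u, v] := by
  have h := fun u => (mfderiv 𝓘(ℂ, E) 𝓘(ℂ, E) c.symm y).map_smul Complex.I u
  rw [TwoForm.formIn_apply, TwoForm.formIn_apply]
  refine Eq.trans ?_ (hΩ.oneOne _ _ _)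
  erw [h, h]

/-- A vector field in the holomorphic chart `c`. -/
def fieldIn (V : ∀ x : M, TangentSpace 𝓘(ℂ, E) x) (c : OpenPartialHomeomorph M E) (y : E) : E :=
  mfderiv 𝓘(ℂ, E) 𝓘(ℂ, E) c (c.symm y) (V (c.symm y))

omit [FiniteDimensional ℂ E] in
/-- The `∂̄`-derivative of a vector field may be computed in every holomorphic chart. -/
lemma dbar_eq (V : ∀ x : M, TangentSpace 𝓘(ℂ, E) x)
    (hc : c ∈ IsManifold.maximalAtlas 𝓘(ℂ, E) ω M) {y : E} (hy : y ∈ c.target)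
    (hV : DifferentiableAt ℝ (fieldIn V c) y) (a : E) :
    (dbar V (c.symm y) (mfderiv 𝓘(ℂ, E) 𝓘(ℂ, E) c.symm y a) : E)
      = mfderiv 𝓘(ℂ, E) 𝓘(ℂ, E) c.symm y
        ((1 / 2 : ℂ) • (fderiv ℝ (fieldIn V c) y a
          + Complex.I • fderiv ℝ (fieldIn V c) y (Complex.I • a))) := by
  set c' := chartAt E (c.symm y) with hc'
  have hm : c' ∈ IsManifold.maximalAtlas 𝓘(ℂ, E) ω M := IsManifold.chart_mem_maximalAtlas _
  have hy' : c.symm y ∈ c'.source := mem_chart_source _ _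
  set ψ : E → E := fun z => c' (c.symm z) with hψ
  have hψd := contDiffAt_transition hc hm hy hy'
  have hψ1 : HasFDerivAt ψ ((fderiv ℂ ψ y).restrictScalars ℝ) y :=
    (hψd.differentiableAt (by simp)).hasFDerivAt.restrictScalars ℝ
  have hψ2 : HasFDerivAt (fderiv ℂ ψ) ((fderiv ℂ (fderiv ℂ ψ) y).restrictScalars ℝ) y :=
    ((hψd.fderiv_right (m := ω) (by simp)).differentiableAt (by simp)).hasFDerivAt.restrictScalars ℝ
  -- near `ψ y` the two coordinate expressions are related by the inverse transition map
  set θ : E → E := fun z => c (c'.symm z) with hθ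
  have hb : (mfderiv 𝓘(ℂ, E) 𝓘(ℂ, E) c' (c.symm y) (mfderiv 𝓘(ℂ, E) 𝓘(ℂ, E) c.symm y a) : E)
      = fderiv ℂ ψ y a := by
    rw [mfderiv_symm_transition hc hm hy hy', ]
    have := mfderiv_mfderiv_symm hm (c'.map_source hy') (fderiv ℂ ψ y a)
    rwa [c'.left_inv hy'] at this
  have hrel : (fun z => fieldIn V c' (ψ z)) =ᶠ[nhds y] fun z => fderiv ℂ ψ z (fieldIn V c z) := by
    filter_upwards [transition_eventually hy hy'] with z hz
    have h1 := mfderiv_transition hc hm (c.map_target hz.1) hz.2 (V (c.symm z))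
    rw [c.right_inv hz.1] at h1
    simp only [fieldIn, hψ]
    rw [c'.left_inv hz.2]
    exact h1
  have hθd : DifferentiableAt ℝ θ (ψ y) :=
    (((contDiffAt_transition hm hc (c'.map_source hy') (by
      rw [c'.left_inv hy']; exact c.map_target hy)).differentiableAt (by simp))).restrictScalars ℝ
  have hθψ : θ (ψ y) = y := by simp [hθ, hψ, c'.left_inv hy', c.right_inv hy]
  have hV' : DifferentiableAt ℝ (fieldIn V c') (ψ y) := by
    have h1 : DifferentiableAt ℝ (fun z => fderiv ℂ ψ (θ z) (fieldIn V c (θ z))) (ψ y) := by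
      have h2 : DifferentiableAt ℝ (fun z => fderiv ℂ ψ z (fieldIn V c z)) (θ (ψ y)) := by
        rw [hθψ]
        have h3 : HasFDerivAt (fun z => (fderiv ℂ ψ z).restrictScalars ℝ)
          ((ContinuousLinearMap.restrictScalarsL ℂ E E ℝ ℝ).comp
            ((fderiv ℂ (fderiv ℂ ψ) y).restrictScalars ℝ)) y :=
          (ContinuousLinearMap.restrictScalarsL ℂ E E ℝ ℝ).hasFDerivAt.comp y hψ2
        exact (h3.clm_apply hV.hasFDerivAt).differentiableAt
      exact h2.comp (ψ y) hθd
    refine h1.congr_of_eventuallyEq ?_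
    have h4 : Filter.Tendsto θ (nhds (ψ y)) (nhds y) := by
      have := hθd.continuousAt.tendsto
      rwa [hθψ] at this
    filter_upwards [h4.eventually hrel, c'.open_target.mem_nhds (c'.map_source hy'),
      transition_eventually (c := c') (c' := c) (c'.map_source hy') (by
      rw [c'.left_inv hy']; exact c.map_target hy)] with z hz hz1 hz2
    rw [← hz]
    simp [hψ, hθ, c.left_inv hz2.2, c'.right_inv hz1]
  have key : ∀ u, fderiv ℝ (fieldIn V c') (ψ y) (fderiv ℂ ψ y u)
      = fderiv ℂ ψ y (fderiv ℝ (fieldIn V c) y u) + fderiv ℂ (fderiv ℂ ψ) y u (fieldIn V c y) := by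
    intro u
    have h1 := hV'.hasFDerivAt.comp y hψ1
    have h3 : HasFDerivAt (fun z => (fderiv ℂ ψ z).restrictScalars ℝ)
          ((ContinuousLinearMap.restrictScalarsL ℂ E E ℝ ℝ).comp
            ((fderiv ℂ (fderiv ℂ ψ) y).restrictScalars ℝ)) y :=
          (ContinuousLinearMap.restrictScalarsL ℂ E E ℝ ℝ).hasFDerivAt.comp y hψ2
    have h2 := (h3.clm_apply hV.hasFDerivAt)
    have h5 := h1.unique (h2.congr_of_eventuallyEq hrel)
    exact DFunLike.congr_fun h5 u
  have h7 := mfderiv_symm_transition hc hm hy hy' ((1 / 2 : ℂ) • (fderiv ℝ (fieldIn V c) y a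
          + Complex.I • fderiv ℝ (fieldIn V c) y (Complex.I • a)))
  rw [h7]
  have h8 : (dbar V (c.symm y) (mfderiv 𝓘(ℂ, E) 𝓘(ℂ, E) c.symm y a) : E)
      = mfderiv 𝓘(ℂ, E) 𝓘(ℂ, E) c'.symm (ψ y) ((1 / 2 : ℂ) •
        (fderiv ℝ (fieldIn V c') (ψ y) (fderiv ℂ ψ y a)
          + Complex.I • fderiv ℝ (fieldIn V c') (ψ y) (Complex.I • fderiv ℂ ψ y a))) := by
    rw [← hb]; rfl
  rw [h8]
  have h9 : (1 / 2 : ℂ) • (fderiv ℝ (fieldIn V c') (ψ y) (fderiv ℂ ψ y a)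
      + Complex.I • fderiv ℝ (fieldIn V c') (ψ y) (Complex.I • fderiv ℂ ψ y a))
      = fderiv ℂ ψ y ((1 / 2 : ℂ) • (fderiv ℝ (fieldIn V c) y a
          + Complex.I • fderiv ℝ (fieldIn V c) y (Complex.I • a))) := by
    rw [← map_smul (fderiv ℂ ψ y), key, key]
    simp only [map_smul, map_add, smul_apply, smul_add]
    rw [smul_smul Complex.I Complex.I, Complex.I_mul_I]
    module
  exact congrArg (mfderiv 𝓘(ℂ, E) 𝓘(ℂ, E) c'.symm (ψ y)) h9

end Charts

/-! ### Poisson–Kähler fibrations in fibred charts -/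

section FibredCharts

open scoped ComplexOrder

variable {m n : ℕ}
variable {X : Type*} [TopologicalSpace X] [ChartedSpace ((Fin m → ℂ) × (Fin n → ℂ)) X]
variable {B : Type*} [TopologicalSpace B] [ChartedSpace (Fin m → ℂ) B]

namespace FibredChart

variable {p : X → B} (c : FibredChart (m := m) (n := n) p)

/-- The differential of the inverse of the chart of the total space, at a point of `ℂ^m × ℂ^n`. -/
abbrev dsymm (y : (Fin m → ℂ) × (Fin n → ℂ)) :
    ((Fin m → ℂ) × (Fin n → ℂ)) →L[ℂ]
      TangentSpace 𝓘(ℂ, (Fin m → ℂ) × (Fin n → ℂ)) (c.total.symm y) :=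
  mfderiv 𝓘(ℂ, (Fin m → ℂ) × (Fin n → ℂ)) 𝓘(ℂ, (Fin m → ℂ) × (Fin n → ℂ)) c.total.symm y

/-- The differential of the base chart. -/
abbrev dbase (t : B) : TangentSpace 𝓘(ℂ, Fin m → ℂ) t →L[ℂ] (Fin m → ℂ) :=
  mfderiv 𝓘(ℂ, Fin m → ℂ) 𝓘(ℂ, Fin m → ℂ) c.base t

/-- The image of the chart. -/
def dom : TopologicalSpace.Opens ((Fin m → ℂ) × (Fin n → ℂ)) := ⟨c.total.target, c.total.open_target⟩

lemma base_proj {y : (Fin m → ℂ) × (Fin n → ℂ)} (hy : y ∈ c.dom) :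
    c.base (p (c.total.symm y)) = y.1 := by
  rw [← c.fst_eq _ (c.total.map_target hy), c.total.right_inv hy]

lemma proj_mem {y : (Fin m → ℂ) × (Fin n → ℂ)} (hy : y ∈ c.dom) :
    p (c.total.symm y) ∈ c.base.source := c.map_source _ (c.total.map_target hy)

lemma proj_eq {y : (Fin m → ℂ) × (Fin n → ℂ)} (hy : y ∈ c.dom) :
    p (c.total.symm y) = c.base.symm y.1 := by
  rw [← c.base_proj hy, c.base.left_inv (c.proj_mem hy)]

lemma dsymm_surj {y : (Fin m → ℂ) × (Fin n → ℂ)} (hy : y ∈ c.dom)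
    (u : TangentSpace 𝓘(ℂ, (Fin m → ℂ) × (Fin n → ℂ)) (c.total.symm y)) : ∃ a, c.dsymm y a = u := by
  have h := mfderiv_symm_mfderiv c.total_mem (c.total.map_target hy) u
  rw [c.total.right_inv hy] at h
  exact ⟨_, h⟩

lemma dsymm_inj {y : (Fin m → ℂ) × (Fin n → ℂ)} (hy : y ∈ c.dom)
    {a b : (Fin m → ℂ) × (Fin n → ℂ)} (h : c.dsymm y a = c.dsymm y b) : a = b := by
  rw [← mfderiv_mfderiv_symm c.total_mem hy a, ← mfderiv_mfderiv_symm c.total_mem hy b]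
  exact congrArg _ h

lemma dbase_inj {t : B} (ht : t ∈ c.base.source) {a b : TangentSpace 𝓘(ℂ, Fin m → ℂ) t}
    (h : c.dbase t a = c.dbase t b) : a = b := by
  have h1 := mfderiv_symm_mfderiv c.base_mem ht a
  have h2 := mfderiv_symm_mfderiv c.base_mem ht b
  exact h1.symm.trans ((congrArg _ h).trans h2)

lemma mdifferentiableAt_proj {x : X} (hx : x ∈ c.total.source) :
    MDifferentiableAt 𝓘(ℂ, (Fin m → ℂ) × (Fin n → ℂ)) 𝓘(ℂ, Fin m → ℂ) p x := by
  have h1 : p =ᶠ[nhds x] c.base.symm ∘ (Prod.fst ∘ c.total) := by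
    filter_upwards [c.total.open_source.mem_nhds hx] with z hz
    simp only [Function.comp_apply]
    rw [c.fst_eq z hz, c.base.left_inv (c.map_source z hz)]
  refine MDifferentiableAt.congr_of_eventuallyEq ?_ h1
  have h2 : MDifferentiableAt 𝓘(ℂ, (Fin m → ℂ) × (Fin n → ℂ)) 𝓘(ℂ, Fin m → ℂ)
      (Prod.fst ∘ c.total) x :=
    MDifferentiableAt.comp x (differentiableAt_fst.mdifferentiableAt)
      ((mdifferentiable_chart c.total_mem).mdifferentiableAt hx)
  refine MDifferentiableAt.comp x ?_ h2
  refine (mdifferentiable_chart c.base_mem).mdifferentiableAt_symm ?_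
  simp only [Function.comp_apply]
  rw [c.fst_eq x hx]
  exact c.base.map_source (c.map_source x hx)

lemma dbase_mfderiv_proj {y : (Fin m → ℂ) × (Fin n → ℂ)} (hy : y ∈ c.dom)
    (a : (Fin m → ℂ) × (Fin n → ℂ)) :
    c.dbase (p (c.total.symm y)) (mfderiv 𝓘(ℂ, (Fin m → ℂ) × (Fin n → ℂ)) 𝓘(ℂ, Fin m → ℂ) p
      (c.total.symm y) (c.dsymm y a)) = a.1 := by
  have h0 : c.base ∘ (p ∘ c.total.symm) =ᶠ[nhds y] Prod.fst := by
    filter_upwards [c.total.open_target.mem_nhds hy] with z hz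
    exact c.base_proj hz
  have h1 := h0.mfderiv_eq (I := 𝓘(ℂ, (Fin m → ℂ) × (Fin n → ℂ))) (I' := 𝓘(ℂ, Fin m → ℂ))
  have h2 : MDifferentiableAt 𝓘(ℂ, (Fin m → ℂ) × (Fin n → ℂ)) 𝓘(ℂ, (Fin m → ℂ) × (Fin n → ℂ))
    c.total.symm y := (mdifferentiable_chart c.total_mem).mdifferentiableAt_symm hy
  have h3 := c.mdifferentiableAt_proj (c.total.map_target hy)
  have h4 : MDifferentiableAt 𝓘(ℂ, Fin m → ℂ) 𝓘(ℂ, Fin m → ℂ) c.base (p (c.total.symm y)) :=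
    (mdifferentiable_chart c.base_mem).mdifferentiableAt (c.proj_mem hy)
  have h5 := mfderiv_comp y h4 (h3.comp y h2)
  rw [mfderiv_comp y h3 h2, h1, mfderiv_eq_fderiv] at h5
  have h6 := DFunLike.congr_fun (F := ((Fin m → ℂ) × (Fin n → ℂ)) →L[ℂ] (Fin m → ℂ)) h5 a
  have h7 : fderiv ℂ (Prod.fst : (Fin m → ℂ) × (Fin n → ℂ) → _) y a = a.1 := by
    rw [fderiv_fst]; rfl
  exact h6.symm.trans h7

lemma dsymm_mem_vert {y : (Fin m → ℂ) × (Fin n → ℂ)} (hy : y ∈ c.dom)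
    (a : (Fin m → ℂ) × (Fin n → ℂ)) :
    c.dsymm y a ∈ vert (E := (Fin m → ℂ) × (Fin n → ℂ)) (F := Fin m → ℂ) p (c.total.symm y)
      ↔ a.1 = 0 := by
  have h := c.dbase_mfderiv_proj hy a
  constructor
  · intro h1
    have h2 : mfderiv 𝓘(ℂ, (Fin m → ℂ) × (Fin n → ℂ)) 𝓘(ℂ, Fin m → ℂ) p
      (c.total.symm y) (c.dsymm y a) = 0 := h1
    rw [h2, map_zero] at h
    exact h.symm
  · intro h1
    refine c.dbase_inj (c.proj_mem hy) ?_
    rw [map_zero]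
    exact h.trans h1

lemma exists_dsymm_of_mem_vert {y : (Fin m → ℂ) × (Fin n → ℂ)} (hy : y ∈ c.dom)
    {u : TangentSpace 𝓘(ℂ, (Fin m → ℂ) × (Fin n → ℂ)) (c.total.symm y)}
    (hu : u ∈ vert (E := (Fin m → ℂ) × (Fin n → ℂ)) (F := Fin m → ℂ) p (c.total.symm y)) :
    ∃ a : Fin n → ℂ, c.dsymm y (0, a) = u := by
  obtain ⟨a, rfl⟩ := c.dsymm_surj hy u
  exact ⟨a.2, by rw [← (c.dsymm_mem_vert hy a).1 hu]⟩

end FibredChart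

variable [IsManifold 𝓘(ℂ, (Fin m → ℂ) × (Fin n → ℂ)) ω X] {p : X → B}
  {Ω : TwoForm ((Fin m → ℂ) × (Fin n → ℂ)) X}

/-- A relatively Kähler form whose `(n+1)`-st wedge power vanishes. -/
structure IsPoissonKahlerForm (p : X → B) (Ω : TwoForm ((Fin m → ℂ) × (Fin n → ℂ)) X) : Prop
    extends IsRelativeKahlerForm (F := Fin m → ℂ) p Ω where
  degenerate : ∀ (x : X)
    (v : Fin (n + 1) × Fin 2 → TangentSpace 𝓘(ℂ, (Fin m → ℂ) × (Fin n → ℂ)) x),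
    wedgePow (Ω x) (n + 1) v = 0

lemma IsPoissonKahlerForm.isLocal (hΩ : IsPoissonKahlerForm p Ω)
    (c : FibredChart (m := m) (n := n) p) :
    IsLocalPoissonKahler c.dom (Ω.formIn c.total) where
  smooth y hy := (hΩ.contDiffAt_formIn c.total_mem hy).contDiffWithinAt
  closed y hy := hΩ.extDeriv_formIn c.total_mem hy
  oneOne y _ u v := hΩ.oneOne_formIn y u v
  pos y hy u hu := by
    have h1 := hΩ.pos_fibre (c.total.symm y) (c.dsymm y (0, u)) ((c.dsymm_mem_vert hy _).2 rfl) ?_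
    · rw [TwoForm.formIn_apply]
      have h2 := (c.dsymm y).map_smul Complex.I (0, u)
      erw [h2]
      exact h1
    · intro h
      have := c.dsymm_inj hy (h.trans (map_zero (c.dsymm y)).symm)
      exact hu (congrArg Prod.snd this)
  degenerate y hy v := by
    have h1 := hΩ.degenerate (c.total.symm y) (fun i => c.dsymm y (v i))
    rw [← h1]
    simp only [wedgePow, TwoForm.formIn_apply]
    rfl

variable (hΩ : IsPoissonKahlerForm p Ω) (c : FibredChart (m := m) (n := n) p)
include hΩ

lemma hlift_eq {y : (Fin m → ℂ) × (Fin n → ℂ)} (hy : y ∈ c.dom)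
    (v : TangentSpace 𝓘(ℂ, Fin m → ℂ) (p (c.total.symm y))) :
    hlift p Ω (c.total.symm y) v
      = c.dsymm y ((hΩ.isLocal c).lift y (c.dbase (p (c.total.symm y)) v)) := by
  set P := fun u : TangentSpace 𝓘(ℂ, (Fin m → ℂ) × (Fin n → ℂ)) (c.total.symm y) =>
    mfderiv 𝓘(ℂ, (Fin m → ℂ) × (Fin n → ℂ)) 𝓘(ℂ, Fin m → ℂ) p (c.total.symm y) u = v ∧
      ∀ w ∈ vert (E := (Fin m → ℂ) × (Fin n → ℂ)) (F := Fin m → ℂ) p (c.total.symm y),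
        Ω (c.total.symm y) ![u, w] = 0 with hP
  have h1 : P (c.dsymm y ((hΩ.isLocal c).lift y (c.dbase (p (c.total.symm y)) v))) := by
    refine ⟨c.dbase_inj (c.proj_mem hy) (c.dbase_mfderiv_proj hy _), fun w hw => ?_⟩
    obtain ⟨a, rfl⟩ := c.exists_dsymm_of_mem_vert hy hw
    have h2 := form_eq_zero_of_herm2 ((hΩ.isLocal c).oneOne y hy) _ _
      ((hΩ.isLocal c).herm2_lift_vert hy (c.dbase (p (c.total.symm y)) v) a)
    rw [TwoForm.formIn_apply] at h2
    exact h2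
  have h2 : P (hlift p Ω (c.total.symm y) v) := Classical.epsilon_spec ⟨_, h1⟩
  by_contra hne
  have h3 := hΩ.pos_fibre (c.total.symm y) (hlift p Ω (c.total.symm y) v -
    c.dsymm y ((hΩ.isLocal c).lift y (c.dbase (p (c.total.symm y)) v))) ?_ (sub_ne_zero.2 hne)
  · set u := hlift p Ω (c.total.symm y) v
    set u' := c.dsymm y ((hΩ.isLocal c).lift y (c.dbase (p (c.total.symm y)) v))
    have hv : Complex.I • (u - u') ∈ vert (E := (Fin m → ℂ) × (Fin n → ℂ)) (F := Fin m → ℂ) p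
        (c.total.symm y) := by
      refine Submodule.smul_mem _ _ ?_
      exact LinearMap.sub_mem_ker_iff.2 (h2.1.trans h1.1.symm)
    have h4 := h2.2 _ hv
    have h5 := h1.2 _ hv
    rw [sub_eq_add_neg u u', form_add_left, form_neg_left, ← sub_eq_add_neg u u', h4, h5] at h3
    simp at h3
  · exact LinearMap.sub_mem_ker_iff.2 (h2.1.trans h1.1.symm)

end FibredCharts

/-! ### Kodaira–Spencer tensors in fibred charts -/

section KodairaSpencer

open scoped ComplexOrder

variable {m n : ℕ}

lemma wirtBar_vert {F : (Fin m → ℂ) × (Fin n → ℂ) → ℂ} (y : (Fin m → ℂ) × (Fin n → ℂ))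
    (a : Fin n → ℂ) :
    wirtBar (0, a) F y = ∑ β, star (a β) * wirtBar (coordBasis (.inr β)) F y := by
  have h0 : ∀ (z : ℂ) (L : ((Fin m → ℂ) × (Fin n → ℂ)) →L[ℝ] ℂ) (u : (Fin m → ℂ) × (Fin n → ℂ)),
      L (z • u) + Complex.I * L (Complex.I • z • u)
        = star z * (L u + Complex.I * L (Complex.I • u)) := by
    intro z L u
    have h1 : z • u = z.re • u + z.im • (Complex.I • u) := by
      conv_lhs => rw [← Complex.re_add_im z]
      rw [add_smul, mul_smul]
      simp
    have h2 : Complex.I • z • u = z.re • (Complex.I • u) - z.im • u := by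
      rw [h1, smul_add, smul_comm, smul_comm Complex.I z.im, smul_smul, Complex.I_mul_I]
      module
    have h3 : star z = z.re - z.im * Complex.I := by
      rw [Complex.star_def]; apply Complex.ext <;> simp
    rw [h2, h1, map_add, map_sub, L.map_smul, L.map_smul, L.map_smul, L.map_smul, h3]
    simp only [Complex.real_smul]
    linear_combination ((z.im : ℂ) * L (Complex.I • u)) * Complex.I_mul_I
  simp only [wirtBar]
  rw [← sum_coordBasis_inr, Finset.smul_sum, map_sum, map_sum, Finset.mul_sum,
    ← Finset.sum_add_distrib, Finset.mul_sum]
  refine Finset.sum_congr rfl fun β _ => ?_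
  rw [h0]; ring

lemma IsLocalPoissonKahler.eval_A {W : TopologicalSpace.Opens ((Fin m → ℂ) × (Fin n → ℂ))}
    {w : (Fin m → ℂ) × (Fin n → ℂ) → ((Fin m → ℂ) × (Fin n → ℂ)) [⋀^Fin 2]→L[ℝ] ℝ}
    (h : IsLocalPoissonKahler W w) (y : W) (j : Fin m) (α β : Fin n) :
    h.ksMatrix y j α β = wirtBar (coordBasis (.inr β)) (SmoothRing.fn (h.horiz j α)) y := by
  rw [← SmoothRing.fn_star_deriv_star _ _ y.2, ← SmoothRing.eval_eq_fn]; rfl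

variable {X : Type*} [TopologicalSpace X] [ChartedSpace ((Fin m → ℂ) × (Fin n → ℂ)) X]
variable {B : Type*} [TopologicalSpace B] [ChartedSpace (Fin m → ℂ) B]
variable {p : X → B}
  {Ω : TwoForm ((Fin m → ℂ) × (Fin n → ℂ)) X}

variable [IsManifold 𝓘(ℂ, Fin m → ℂ) ω B]

lemma FibredChart.dbase_coordField (c : FibredChart (m := m) (n := n) p) (t : B)
    (v : TangentSpace 𝓘(ℂ, Fin m → ℂ) t) :
    c.dbase t (coordField t v t) = c.dbase t v := by
  refine congrArg _ ?_
  exact mfderiv_symm_mfderiv (IsManifold.chart_mem_maximalAtlas t) (mem_chart_source _ t) v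

lemma FibredChart.differentiableAt_coordField (c : FibredChart (m := m) (n := n) p) {t : B}
    (ht : t ∈ c.base.source) (v : TangentSpace 𝓘(ℂ, Fin m → ℂ) t) :
    DifferentiableAt ℝ (fun z => c.dbase (c.base.symm z) (coordField t v (c.base.symm z)))
      (c.base t) := by
  set χ := chartAt (Fin m → ℂ) t
  have hχ : χ ∈ IsManifold.maximalAtlas 𝓘(ℂ, Fin m → ℂ) ω B := IsManifold.chart_mem_maximalAtlas t
  have hχt : t ∈ χ.source := mem_chart_source _ t
  set a : Fin m → ℂ := mfderiv 𝓘(ℂ, Fin m → ℂ) 𝓘(ℂ, Fin m → ℂ) χ t v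
  have h1 : (fun z => c.dbase (c.base.symm z) (coordField t v (c.base.symm z)))
      =ᶠ[nhds (c.base t)] fun z => fderiv ℂ (fun z => c.base (χ.symm z)) (χ (c.base.symm z)) a := by
    filter_upwards [transition_eventually (c' := χ) (c.base.map_source ht)
      (by rwa [c.base.left_inv ht])] with z hz
    have h2 := mfderiv_transition hχ c.base_mem hz.2 (c.base.map_target hz.1)
      (coordField t v (c.base.symm z))
    refine h2.trans (congrArg _ ?_)
    have h3 := mfderiv_mfderiv_symm hχ (χ.map_source hz.2) a
    rw [χ.left_inv hz.2] at h3
    exact h3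
  refine DifferentiableAt.congr_of_eventuallyEq ?_ h1
  have h4 : DifferentiableAt ℝ (fun z => χ (c.base.symm z)) (c.base t) :=
    (contDiffAt_transition_real c.base_mem hχ (c.base.map_source ht)
      (by rwa [c.base.left_inv ht])).differentiableAt (by simp)
  have h5 : DifferentiableAt ℝ (fun z => fderiv ℂ (fun z => c.base (χ.symm z)) z a)
      (χ (c.base.symm (c.base t))) := by
    rw [c.base.left_inv ht]
    have h6 := (contDiffAt_transition hχ c.base_mem (χ.map_source hχt)
      (by rwa [χ.left_inv hχt]))
    exact (((h6.fderiv_right (m := ω) (by simp)).differentiableAt (by simp)).clm_apply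
      (differentiableAt_const a)).restrictScalars ℝ
  exact h5.comp (c.base t) h4

variable [IsManifold 𝓘(ℂ, (Fin m → ℂ) × (Fin n → ℂ)) ω X] (hΩ : IsPoissonKahlerForm p Ω) (c : FibredChart (m := m) (n := n) p)
include hΩ

/-- The Kodaira–Spencer matrix of a base vector with coordinates `ξ`. -/
def ksAt (y : c.dom) (ξ : Fin m → ℂ) : Matrix (Fin n) (Fin n) ℂ :=
  ∑ j, ξ j • (hΩ.isLocal c).ksMatrix y j

/-- In fibred coordinates `κ_v = ∑ v^j ∂a_j^α/∂ζ̄^β dζ̄^β ⊗ ∂_α`. -/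
lemma kappa_eq {y : (Fin m → ℂ) × (Fin n → ℂ)} (hy : y ∈ c.dom) {t : B}
    (ht : p (c.total.symm y) = t) (v : TangentSpace 𝓘(ℂ, Fin m → ℂ) t) (a : Fin n → ℂ) :
    kappa p Ω t v (c.total.symm y) (c.dsymm y (0, a))
      = c.dsymm y (0, (ksAt hΩ c ⟨y, hy⟩ (c.dbase t v)).mulVec (star a)) := by
  set h := hΩ.isLocal c
  have hts : t ∈ c.base.source := ht ▸ c.proj_mem hy
  have hy1 : y.1 = c.base t := by rw [← ht, c.base_proj hy]
  set η : (Fin m → ℂ) → Fin m → ℂ :=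
    fun z => c.dbase (c.base.symm z) (coordField t v (c.base.symm z)) with hη
  have hη1 : DifferentiableAt ℝ η y.1 := hy1 ▸ c.differentiableAt_coordField hts v
  have hη0 : η y.1 = c.dbase t v := by
    rw [← c.dbase_coordField t v]
    have : c.base.symm y.1 = t := by rw [hy1, c.base.left_inv hts]
    exact congrArg (fun s => (c.dbase s (coordField t v s) : Fin m → ℂ)) this
  set V : ∀ x' : X, TangentSpace 𝓘(ℂ, (Fin m → ℂ) × (Fin n → ℂ)) x' :=
    fun x' => hlift p Ω x' (coordField t v (p x')) with hV
  have hF : fieldIn V c.total =ᶠ[nhds y] fun z => h.lift z (η z.1) := by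
    filter_upwards [c.total.open_target.mem_nhds hy] with z hz
    have h1 := mfderiv_mfderiv_symm c.total_mem hz
      (h.lift z (c.dbase (p (c.total.symm z)) (coordField t v (p (c.total.symm z)))))
    have h2 : (c.dbase (p (c.total.symm z)) (coordField t v (p (c.total.symm z))) : Fin m → ℂ)
        = η z.1 := congrArg (fun s => (c.dbase s (coordField t v s) : Fin m → ℂ)) (c.proj_eq hz)
    have h3 := hlift_eq hΩ c hz (coordField t v (p (c.total.symm z)))
    exact (congrArg _ h3).trans (h1.trans (congrArg (h.lift z) h2))
  have hη2 : HasFDerivAt (fun z : (Fin m → ℂ) × (Fin n → ℂ) => η z.1)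
      ((fderiv ℝ η y.1).comp (ContinuousLinearMap.fst ℝ _ _)) y :=
    hη1.hasFDerivAt.comp y hasFDerivAt_fst
  have hη3 : ∀ j, HasFDerivAt (fun z : (Fin m → ℂ) × (Fin n → ℂ) => η z.1 j)
      ((ContinuousLinearMap.proj j).comp
        ((fderiv ℝ η y.1).comp (ContinuousLinearMap.fst ℝ _ _))) y :=
    fun j => hasFDerivAt_pi'.1 hη2 j
  have hcomp : ∀ α, HasFDerivAt (fun z => (h.lift z (η z.1)).2 α) (∑ j,
      (η y.1 j • fderiv ℝ (SmoothRing.fn (h.horiz j α)) y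
        + SmoothRing.fn (h.horiz j α) y • ((ContinuousLinearMap.proj j).comp
        ((fderiv ℝ η y.1).comp (ContinuousLinearMap.fst ℝ _ _))))) y := by
    intro α
    exact HasFDerivAt.fun_sum (u := Finset.univ) fun j _ =>
      (hη3 j).mul (SmoothRing.differentiableAt_fn (h.horiz j α) hy).hasFDerivAt
  have hL : HasFDerivAt (fun z => h.lift z (η z.1)) _ y :=
    hη2.prodMk (hasFDerivAt_pi.2 hcomp)
  have hd : DifferentiableAt ℝ (fieldIn V c.total) y :=
    hL.differentiableAt.congr_of_eventuallyEq hF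
  have key := dbar_eq V c.total_mem hy hd (0, a)
  refine key.trans (congrArg _ ?_)
  rw [hF.fderiv_eq, hL.fderiv]
  refine Prod.ext ?_ (funext fun α => ?_)
  · simp
  · have e1 : ((ksAt hΩ c ⟨y, hy⟩ (c.dbase t v)).mulVec (star a)) α
        = ∑ j, η y.1 j * wirtBar (0, a) (SmoothRing.fn (h.horiz j α)) y := by
      simp only [wirtBar_vert, Matrix.mulVec, dotProduct, ksAt, Matrix.sum_apply, Matrix.smul_apply,
        IsLocalPoissonKahler.eval_A, Finset.sum_mul, Finset.mul_sum, hη0]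
      rw [Finset.sum_comm]
      refine Finset.sum_congr rfl fun j _ => Finset.sum_congr rfl fun β _ => ?_
      simp only [smul_eq_mul, Pi.star_apply]
      ring
    refine Eq.trans ?_ e1.symm
    simp [wirtBar, Finset.mul_sum, ← Finset.sum_add_distrib]
    refine Finset.sum_congr rfl fun j _ => ?_
    ring

end KodairaSpencer

section

variable {E : Type*} [NormedAddCommGroup E] [NormedSpace ℂ E]
variable {M : Type*} [TopologicalSpace M] [ChartedSpace E M] [IsManifold 𝓘(ℂ, E) ω M]

lemma trans_mem_maximalAtlas {c : OpenPartialHomeomorph M E}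
    (hc : c ∈ IsManifold.maximalAtlas 𝓘(ℂ, E) ω M) (e : OpenPartialHomeomorph E E)
    (he : ContDiffOn ℂ ω e e.source) (he' : ContDiffOn ℂ ω e.symm e.target) :
    c.trans e ∈ IsManifold.maximalAtlas 𝓘(ℂ, E) ω M := by
  refine OpenPartialHomeomorph.mem_maximalAtlas_of_contMDiffOn _ ?_ ?_
  · refine (he.contMDiffOn.comp (t := e.source) ((contMDiffOn_of_mem_maximalAtlas hc).mono ?_) ?_)
    · intro x hx; rw [OpenPartialHomeomorph.trans_source] at hx; exact hx.1
    · intro x hx; rw [OpenPartialHomeomorph.trans_source] at hx; exact hx.2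
  · refine ((contMDiffOn_symm_of_mem_maximalAtlas hc).comp (t := c.target)
      (he'.contMDiffOn.mono ?_) ?_)
    · intro x hx; rw [OpenPartialHomeomorph.trans_target] at hx; exact hx.1
    · intro x hx; rw [OpenPartialHomeomorph.trans_target] at hx; exact hx.2

end

section

variable {m n : ℕ}
variable {X : Type*} [TopologicalSpace X] [ChartedSpace ((Fin m → ℂ) × (Fin n → ℂ)) X]
  [IsManifold 𝓘(ℂ, (Fin m → ℂ) × (Fin n → ℂ)) ω X]
variable {B : Type*} [TopologicalSpace B] [ChartedSpace (Fin m → ℂ) B]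

/-- Around every point of the total space of a submersion there is a fibred chart with a prescribed
chart of the base. -/
lemma exists_fibredChart {p : X → B}
    (hp : Manifold.IsSubmersion 𝓘(ℂ, (Fin m → ℂ) × (Fin n → ℂ)) 𝓘(ℂ, Fin m → ℂ) ω p) (x : X)
    {φ : OpenPartialHomeomorph B (Fin m → ℂ)}
    (hφ : φ ∈ IsManifold.maximalAtlas 𝓘(ℂ, Fin m → ℂ) ω B) (hx : p x ∈ φ.source) :
    ∃ c : FibredChart (m := m) (n := n) p, c.base = φ ∧ x ∈ c.total.source := by
  obtain ⟨C, _, _, h⟩ := hp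
  have hx' := h x
  have : FiniteDimensional ℂ ((Fin m → ℂ) × C) := hx'.equiv.toLinearEquiv.finiteDimensional
  have : FiniteDimensional ℂ C :=
    Module.Finite.of_surjective (LinearMap.snd ℂ (Fin m → ℂ) C) LinearMap.snd_surjective
  have hrank : Module.finrank ℂ C = Module.finrank ℂ (Fin n → ℂ) := by
    have := hx'.equiv.toLinearEquiv.finrank_eq
    rw [Module.finrank_prod, Module.finrank_prod] at this
    omega
  let e : ((Fin m → ℂ) × (Fin n → ℂ)) ≃L[ℂ] ((Fin m → ℂ) × (Fin n → ℂ)) :=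
    hx'.equiv.trans ((ContinuousLinearEquiv.refl ℂ (Fin m → ℂ)).prodCongr
      (ContinuousLinearEquiv.ofFinrankEq hrank))
  have he : ∀ y, (e y).1 = (hx'.equiv y).1 := fun y => rfl
  let θ : OpenPartialHomeomorph ((Fin m → ℂ) × (Fin n → ℂ)) ((Fin m → ℂ) × (Fin n → ℂ)) :=
    e.toHomeomorph.toOpenPartialHomeomorph.trans
      ((hx'.codChart.symm.trans φ).prod (OpenPartialHomeomorph.refl _))
  have hcod := hx'.codChart_mem_maximalAtlas
  have hw : ∀ z ∈ hx'.domChart.source, (e (hx'.domChart z)).1 = hx'.codChart (p z) := by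
    intro z hz
    have h0 : hx'.domChart z ∈ (hx'.domChart.extend 𝓘(ℂ, (Fin m → ℂ) × (Fin n → ℂ))).target := by
      simpa using hx'.domChart.map_source hz
    have := hx'.writtenInCharts h0
    simpa [hx'.domChart.left_inv hz, he] using this.symm
  have hθ1 : ContDiffOn ℂ ω θ θ.source := by
    intro y hy
    simp only [θ, OpenPartialHomeomorph.trans_source, OpenPartialHomeomorph.prod_source,
      OpenPartialHomeomorph.refl_source, Homeomorph.toOpenPartialHomeomorph_source, Set.univ_inter,
      Set.mem_preimage, Set.mem_prod, OpenPartialHomeomorph.symm_source, Set.mem_inter_iff] at hy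
    have h1 : ContDiffAt ℂ ω (fun z => φ (hx'.codChart.symm z)) (e y).1 :=
      contDiffAt_transition hcod hφ hy.1.1 hy.1.2
    have h2 : ContDiffAt ℂ ω (fun z => (φ (hx'.codChart.symm (e z).1), (e z).2)) y :=
      (h1.comp y (e.contDiff.fst.contDiffAt)).prodMk e.contDiff.snd.contDiffAt
    exact h2.contDiffWithinAt
  have hθ2 : ContDiffOn ℂ ω θ.symm θ.target := by
    intro y hy
    simp only [θ, OpenPartialHomeomorph.trans_target, OpenPartialHomeomorph.prod_target,
      OpenPartialHomeomorph.refl_target, Homeomorph.toOpenPartialHomeomorph_target, Set.inter_univ,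
      Set.mem_preimage, Set.mem_prod, OpenPartialHomeomorph.symm_target, Set.mem_inter_iff,
      Set.preimage_univ] at hy
    have h1 : ContDiffAt ℂ ω (fun z => hx'.codChart (φ.symm z)) y.1 :=
      contDiffAt_transition hφ hcod hy.1.1 hy.1.2
    have h2 : ContDiffAt ℂ ω (fun z => e.symm (hx'.codChart (φ.symm z.1), z.2)) y :=
      e.symm.contDiff.contDiffAt.comp y ((h1.comp y contDiffAt_fst).prodMk contDiffAt_snd)
    exact h2.contDiffWithinAt
  have hsrc : ∀ z ∈ (hx'.domChart.trans θ).source, z ∈ hx'.domChart.source ∧ p z ∈ φ.source := by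
    intro z hz
    rw [OpenPartialHomeomorph.trans_source] at hz
    refine ⟨hz.1, ?_⟩
    have h1 := hz.2
    simp only [θ, OpenPartialHomeomorph.trans_source, OpenPartialHomeomorph.prod_source,
      OpenPartialHomeomorph.refl_source, Homeomorph.toOpenPartialHomeomorph_source, Set.univ_inter,
      Set.mem_preimage, Set.mem_prod, OpenPartialHomeomorph.symm_source, Set.mem_inter_iff] at h1
    have h2 := h1.1.2
    change hx'.codChart.symm (e (hx'.domChart z)).1 ∈ φ.source at h2
    rwa [hw z hz.1, hx'.codChart.left_inv (hx'.mapsto_domChart_source_codChart_source hz.1)] at h2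
  refine ⟨⟨hx'.domChart.trans θ, φ, trans_mem_maximalAtlas hx'.domChart_mem_maximalAtlas θ hθ1 hθ2,
    hφ, fun z hz => (hsrc z hz).2, fun z hz => ?_⟩, rfl, ?_⟩
  · have h1 := (hsrc z hz).1
    change φ (hx'.codChart.symm (e (hx'.domChart z)).1) = φ (p z)
    rw [hw z h1, hx'.codChart.left_inv (hx'.mapsto_domChart_source_codChart_source h1)]
  · have h1 := hx'.mem_domChart_source
    have h3 := hx'.mem_codChart_source
    rw [OpenPartialHomeomorph.trans_source]
    refine ⟨h1, ?_⟩
    simp only [θ, OpenPartialHomeomorph.trans_source, OpenPartialHomeomorph.prod_source,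
      OpenPartialHomeomorph.refl_source, Homeomorph.toOpenPartialHomeomorph_source, Set.univ_inter,
      Set.mem_preimage, Set.mem_prod, OpenPartialHomeomorph.symm_source, Set.mem_inter_iff]
    change ((e (hx'.domChart x)).1 ∈ _ ∧ hx'.codChart.symm (e (hx'.domChart x)).1 ∈ φ.source) ∧ _
    rw [hw x h1, hx'.codChart.left_inv h3]
    exact ⟨⟨hx'.codChart.map_source h3, hx⟩, Set.mem_univ _⟩

variable [IsManifold 𝓘(ℂ, Fin m → ℂ) ω B] {p : X → B} {Ω : TwoForm ((Fin m → ℂ) × (Fin n → ℂ)) X}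
  (hΩ : IsPoissonKahlerForm p Ω) (c : FibredChart (m := m) (n := n) p)

omit [IsManifold 𝓘(ℂ, (Fin m → ℂ) × (Fin n → ℂ)) ω X] [IsManifold 𝓘(ℂ, Fin m → ℂ) ω B] in
lemma herm_dsymm (y a b : (Fin m → ℂ) × (Fin n → ℂ)) :
    Ω.herm (c.total.symm y) (c.dsymm y a) (c.dsymm y b) = herm2 (Ω.formIn c.total y) a b :=
  (Ω.herm2_formIn c.total y a b).symm

include hΩ

omit [IsManifold 𝓘(ℂ, Fin m → ℂ) ω B] in
lemma herm2_vert_vert {y : (Fin m → ℂ) × (Fin n → ℂ)} (hy : y ∈ c.dom) (a b : Fin n → ℂ) :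
    herm2 (Ω.formIn c.total y) (0, a) (0, b)
      = ∑ α, ∑ β, a α * IsLocalPoissonKahler.gramAt (Ω.formIn c.total) y α β * star (b β) := by
  have hα := (hΩ.isLocal c).oneOne y hy
  rw [← sum_coordBasis_inr a, herm2_sum_left hα]
  refine Finset.sum_congr rfl fun α _ => ?_
  rw [← sum_coordBasis_inr b, herm2_sum_right hα, Finset.mul_sum]
  refine Finset.sum_congr rfl fun β _ => ?_
  simp only [IsLocalPoissonKahler.gramAt, Matrix.of_apply]
  ring

lemma kappaInner_eq {y : (Fin m → ℂ) × (Fin n → ℂ)} (hy : y ∈ c.dom) {t : B}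
    (ht : p (c.total.symm y) = t) (ξ η : TangentSpace 𝓘(ℂ, Fin m → ℂ) t) :
    kappaInner p Ω t ξ η (c.total.symm y)
      = (ksAt hΩ c ⟨y, hy⟩ (c.dbase t ξ) * cc (ksAt hΩ c ⟨y, hy⟩ (c.dbase t η))).trace := by
  set h := hΩ.isLocal c
  set g := IsLocalPoissonKahler.gramAt (Ω.formIn c.total) y
  set b := Module.finBasis ℂ
    (vert (E := (Fin m → ℂ) × (Fin n → ℂ)) (F := Fin m → ℂ) p (c.total.symm y)) with hb
  choose q hq using fun α => c.exists_dsymm_of_mem_vert hy (b α).2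
  let L : (Fin n → ℂ) →ₗ[ℂ] TangentSpace 𝓘(ℂ, (Fin m → ℂ) × (Fin n → ℂ)) (c.total.symm y) :=
    (c.dsymm y).toLinearMap.comp (LinearMap.inr ℂ (Fin m → ℂ) (Fin n → ℂ))
  have hL : ∀ a, L a = c.dsymm y (0, a) := fun a => rfl
  have hLinj : Function.Injective L := fun a a' haa => congrArg Prod.snd (c.dsymm_inj hy haa)
  have hrange : LinearMap.range L
      = vert (E := (Fin m → ℂ) × (Fin n → ℂ)) (F := Fin m → ℂ) p (c.total.symm y) := by
    ext u
    constructor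
    · rintro ⟨a, rfl⟩; exact (c.dsymm_mem_vert hy _).2 rfl
    · intro hu; obtain ⟨a, ha⟩ := c.exists_dsymm_of_mem_vert hy hu; exact ⟨a, ha⟩
  have hrank : Module.finrank ℂ
      (vert (E := (Fin m → ℂ) × (Fin n → ℂ)) (F := Fin m → ℂ) p (c.total.symm y)) = n := by
    rw [← hrange, LinearMap.finrank_range_of_inj hLinj, Module.finrank_fin_fun]
  have hqli : LinearIndependent ℂ q := by
    refine LinearIndependent.of_comp L ?_
    have : L ∘ q = fun α => (b α : TangentSpace 𝓘(ℂ, (Fin m → ℂ) × (Fin n → ℂ)) (c.total.symm y)) :=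
      funext fun α => hq α
    rw [this]
    exact b.linearIndependent.map' (Submodule.subtype _) (Submodule.ker_subtype _)
  let e := finCongr hrank
  let P : Matrix (Fin n) (Fin n) ℂ := Matrix.of fun β α => q (e.symm α) β
  have hP : IsUnit P.det := by
    rw [← Matrix.isUnit_iff_isUnit_det, ← Matrix.linearIndependent_cols_iff_isUnit]
    exact hqli.comp _ e.symm.injective
  have hK : ∀ (ζ : TangentSpace 𝓘(ℂ, Fin m → ℂ) t) α, kappa p Ω t ζ (c.total.symm y) (b α)
      = c.dsymm y (0, (ksAt hΩ c ⟨y, hy⟩ (c.dbase t ζ)).mulVec (star (q α))) := by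
    intro ζ α
    rw [← hq α]
    exact kappa_eq hΩ c hy ht ζ (q α)
  have hsymm : (ksAt hΩ c ⟨y, hy⟩ (c.dbase t η)).transpose * g
      = g.transpose * ksAt hΩ c ⟨y, hy⟩ (c.dbase t η) :=
    symm_sum _ _ fun j => h.ksMatrix_symm ⟨y, hy⟩ j
  rw [← sum_inv_mul_eq_trace hP (h.posDef hy) hsymm]
  have hG : (Matrix.of fun α β => Ω.herm (c.total.symm y) (b α : TangentSpace
      𝓘(ℂ, (Fin m → ℂ) × (Fin n → ℂ)) (c.total.symm y)) (b β : TangentSpace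
      𝓘(ℂ, (Fin m → ℂ) × (Fin n → ℂ)) (c.total.symm y)))
      = (P.transpose * g * cc P).submatrix e e := by
    ext α β
    rw [Matrix.of_apply, ← hq α, ← hq β, herm_dsymm c, herm2_vert_vert hΩ c hy]
    simp only [Matrix.submatrix_apply, Matrix.mul_apply, Matrix.transpose_apply, P, Matrix.of_apply,
      cc_apply, Equiv.symm_apply_apply, Finset.sum_mul]
    exact Finset.sum_comm
  have hG2 : ∀ α β, Ω.herm (c.total.symm y) (kappa p Ω t ξ (c.total.symm y) (b α))
      (kappa p Ω t η (c.total.symm y) (b β))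
      = ((ksAt hΩ c ⟨y, hy⟩ (c.dbase t ξ) * cc P).transpose * g
        * cc (ksAt hΩ c ⟨y, hy⟩ (c.dbase t η) * cc P)) (e α) (e β) := by
    intro α β
    rw [hK, hK, herm_dsymm c, herm2_vert_vert hΩ c hy]
    have e0 : ∀ (N : Matrix (Fin n) (Fin n) ℂ) α γ,
        (N * cc P) γ (e α) = N.mulVec (star (q α)) γ := by
      intro N α γ
      simp [Matrix.mul_apply, Matrix.mulVec, dotProduct, P, cc_apply]
    simp only [Matrix.mul_apply (M := _ * g), Matrix.mul_apply (N := g), Matrix.transpose_apply,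
      cc_apply, e0, Finset.sum_mul]
    exact Finset.sum_comm
  have e1 : kappaInner p Ω t ξ η (c.total.symm y)
      = ∑ α, ∑ β, (Matrix.of fun α β => Ω.herm (c.total.symm y) (b α : TangentSpace
      𝓘(ℂ, (Fin m → ℂ) × (Fin n → ℂ)) (c.total.symm y)) (b β : TangentSpace
      𝓘(ℂ, (Fin m → ℂ) × (Fin n → ℂ)) (c.total.symm y)))⁻¹ α β
        * Ω.herm (c.total.symm y) (kappa p Ω t ξ (c.total.symm y) (b α))
      (kappa p Ω t η (c.total.symm y) (b β)) := rfl
  rw [e1, hG, Matrix.inv_submatrix_equiv]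
  simp only [hG2, Matrix.submatrix_apply]
  rw [← e.sum_comp]
  refine Finset.sum_congr rfl fun α _ => ?_
  rw [← e.sum_comp]

end

/-! ### The fibre measure -/

section FibreMeasure

open scoped ComplexOrder

variable {m n : ℕ}
variable {X : Type*} [TopologicalSpace X] [ChartedSpace ((Fin m → ℂ) × (Fin n → ℂ)) X]
  [IsManifold 𝓘(ℂ, (Fin m → ℂ) × (Fin n → ℂ)) ω X]
variable {B : Type*} [TopologicalSpace B] [ChartedSpace (Fin m → ℂ) B]

namespace FibredChart

variable {p : X → B} (c c' : FibredChart (m := m) (n := n) p)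

omit [IsManifold 𝓘(ℂ, (Fin m → ℂ) × (Fin n → ℂ)) ω X]

lemma proj_param {t : B} {ζ : Fin n → ℂ} (hζ : ζ ∈ c.domain t) : p (c.param t ζ) = t := by
  rw [FibredChart.param, c.proj_eq hζ.2, c.base.left_inv hζ.1]

lemma param_mem {t : B} {ζ : Fin n → ℂ} (hζ : ζ ∈ c.domain t) : c.param t ζ ∈ c.total.source :=
  c.total.map_target hζ.2

lemma total_param {t : B} {ζ : Fin n → ℂ} (hζ : ζ ∈ c.domain t) :
    c.total (c.param t ζ) = (c.base t, ζ) := c.total.right_inv hζ.2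

lemma total_eq {x : X} (hx : x ∈ c.total.source) :
    c.total x = (c.base (p x), (c.total x).2) := Prod.ext (c.fst_eq x hx) rfl

lemma snd_mem_domain {x : X} (hx : x ∈ c.total.source) : (c.total x).2 ∈ c.domain (p x) :=
  ⟨c.map_source x hx, by rw [← c.total_eq hx]; exact c.total.map_source hx⟩

lemma param_snd {x : X} (hx : x ∈ c.total.source) : c.param (p x) (c.total x).2 = x := by
  rw [FibredChart.param, ← c.total_eq hx, c.total.left_inv hx]

lemma isOpen_domain (t : B) : IsOpen (c.domain t) := by
  by_cases ht : t ∈ c.base.source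
  · have : c.domain t = (fun ζ => (c.base t, ζ)) ⁻¹' c.total.target := by
      ext ζ; simp [FibredChart.domain, ht]
    rw [this]
    exact c.total.open_target.preimage (by fun_prop)
  · have : c.domain t = ∅ := by ext ζ; simp [FibredChart.domain, ht]
    rw [this]; exact isOpen_empty

lemma continuousOn_param (t : B) : ContinuousOn (c.param t) (c.domain t) :=
  c.total.continuousOn_symm.comp (f := fun ζ => (c.base t, ζ)) (by fun_prop) fun _ h => h.2

lemma mfderiv_param {t : B} {ζ : Fin n → ℂ} (hζ : ζ ∈ c.domain t) (a : Fin n → ℂ) :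
    (mfderiv 𝓘(ℂ, Fin n → ℂ) 𝓘(ℂ, (Fin m → ℂ) × (Fin n → ℂ)) (c.param t) ζ a :
      TangentSpace 𝓘(ℂ, (Fin m → ℂ) × (Fin n → ℂ)) (c.param t ζ)) = c.dsymm (c.base t, ζ) (0, a) := by
  have h1 : DifferentiableAt ℂ (fun z : Fin n → ℂ => (c.base t, z)) ζ := by fun_prop
  have h2 := mfderiv_comp ζ ((mdifferentiable_chart c.total_mem).mdifferentiableAt_symm hζ.2)
    h1.mdifferentiableAt
  have h3 : fderiv ℂ (fun z : Fin n → ℂ => (c.base t, z)) ζ a = (0, a) := by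
    have := (hasFDerivAt_const (c.base t) ζ).prodMk (hasFDerivAt_id (𝕜 := ℂ) ζ)
    have h4 : fderiv ℂ (fun z : Fin n → ℂ => (c.base t, z)) ζ = _ := this.fderiv
    rw [h4]; rfl
  rw [mfderiv_eq_fderiv] at h2
  have h5 := DFunLike.congr_fun (F := (Fin n → ℂ) →L[ℂ] ((Fin m → ℂ) × (Fin n → ℂ))) h2 a
  refine h5.trans ?_
  exact congrArg (c.dsymm (c.base t, ζ)) h3

end FibredChart

variable {p : X → B} {Ω : TwoForm ((Fin m → ℂ) × (Fin n → ℂ)) X}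

/-- The fibre volume density is the Gram determinant of the fibre coordinates. -/
lemma density_eq (hΩ : IsPoissonKahlerForm p Ω) (c : FibredChart (m := m) (n := n) p) {t : B}
    {ζ : Fin n → ℂ} (hζ : ζ ∈ c.domain t) :
    (c.density Ω t ζ : ℂ)
      = 2 ^ n * (IsLocalPoissonKahler.gramAt (Ω.formIn c.total) (c.base t, ζ)).det := by
  have h1 := wedgePow_eq_det ((hΩ.isLocal c).oneOne (c.base t, ζ) hζ.2)
    (fun i : Fin n => (coordBasis (.inr i) : (Fin m → ℂ) × (Fin n → ℂ)))
  have h2 : wedgePow (Ω (c.param t ζ)) n (fun k : Fin n × Fin 2 =>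
    mfderiv 𝓘(ℂ, Fin n → ℂ) 𝓘(ℂ, (Fin m → ℂ) × (Fin n → ℂ)) (c.param t) ζ
      (Pi.single k.1 (if k.2 = 0 then 1 else Complex.I) : Fin n → ℂ))
      = wedgePow (Ω.formIn c.total (c.base t, ζ)) n (fun k : Fin n × Fin 2 =>
        (if k.2 = 0 then (1 : ℂ) else Complex.I) •
          (coordBasis (.inr k.1) : (Fin m → ℂ) × (Fin n → ℂ))) := by
    have h3 : ∀ k : Fin n × Fin 2, (mfderiv 𝓘(ℂ, Fin n → ℂ) 𝓘(ℂ, (Fin m → ℂ) × (Fin n → ℂ))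
        (c.param t) ζ (Pi.single k.1 (if k.2 = 0 then 1 else Complex.I) : Fin n → ℂ) :
        TangentSpace 𝓘(ℂ, (Fin m → ℂ) × (Fin n → ℂ)) (c.param t ζ))
        = c.dsymm (c.base t, ζ) ((if k.2 = 0 then (1 : ℂ) else Complex.I) •
          (coordBasis (.inr k.1) : (Fin m → ℂ) × (Fin n → ℂ))) := by
      intro k
      refine (c.mfderiv_param hζ _).trans (congrArg _ ?_)
      refine Prod.ext ?_ ?_
      · simp only [coordBasis, Prod.smul_fst, smul_zero]
      · simp only [coordBasis, Prod.smul_snd]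
        rw [← Pi.single_smul]; simp
    simp only [wedgePow, TwoForm.formIn_apply, h3]
    rfl
  have h4 : (n.factorial : ℂ) ≠ 0 := by exact_mod_cast n.factorial_ne_zero
  rw [FibredChart.density, h2, Complex.ofReal_mul, h1]
  simp only [IsLocalPoissonKahler.gramAt]
  push_cast
  field_simp

lemma density_pos (hΩ : IsPoissonKahlerForm p Ω) (c : FibredChart (m := m) (n := n) p) {t : B}
    {ζ : Fin n → ℂ} (hζ : ζ ∈ c.domain t) : 0 < c.density Ω t ζ := by
  have h1 := ((hΩ.isLocal c).posDef (y := (c.base t, ζ)) hζ.2).det_pos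
  have h2 : (0 : ℂ) < c.density Ω t ζ := by
    rw [density_eq hΩ c hζ]
    exact mul_pos (by positivity) h1
  exact_mod_cast h2

variable [MeasurableSpace X]

/-- The measure that the fibre volume form defines on the part of the fibre in one chart. -/
def chartMeasure (Ω : TwoForm ((Fin m → ℂ) × (Fin n → ℂ)) X) (c : FibredChart (m := m) (n := n) p)
    (t : B) : Measure X :=
  Measure.map (c.param t) (((volume : Measure (Fin n → ℂ)).restrict (c.domain t)).withDensity
      fun ζ => ENNReal.ofReal (c.density Ω t ζ))

variable [BorelSpace X] (c c' : FibredChart (m := m) (n := n) p) (t : B)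

omit [IsManifold 𝓘(ℂ, (Fin m → ℂ) × (Fin n → ℂ)) ω X] in
lemma measurableSet_param_preimage {A : Set X} (hA : MeasurableSet A) :
    MeasurableSet (c.param t ⁻¹' A ∩ c.domain t) := by
  have h1 : Measurable ((c.domain t).domRestrict (c.param t)) :=
    (continuousOn_iff_continuous_domRestrict.1 (c.continuousOn_param t)).measurable
  have h2 : c.param t ⁻¹' A ∩ c.domain t
      = Subtype.val '' ((c.domain t).domRestrict (c.param t) ⁻¹' A) := by
    ext ζ; simp [and_comm, Set.domRestrict]
  rw [h2]
  exact (c.isOpen_domain t).measurableSet.subtype_image (h1 hA)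

omit [IsManifold 𝓘(ℂ, (Fin m → ℂ) × (Fin n → ℂ)) ω X] in
lemma aemeasurable_param : AEMeasurable (c.param t)
    (((volume : Measure (Fin n → ℂ)).restrict (c.domain t)).withDensity
      fun ζ => ENNReal.ofReal (c.density Ω t ζ)) :=
  ((c.continuousOn_param t).aemeasurable (c.isOpen_domain t).measurableSet).mono_ac
    (withDensity_absolutelyContinuous _ _)

omit [IsManifold 𝓘(ℂ, (Fin m → ℂ) × (Fin n → ℂ)) ω X] in
lemma chartMeasure_apply {A : Set X} (hA : MeasurableSet A) :
    chartMeasure Ω c t A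
      = ∫⁻ ζ in c.param t ⁻¹' A ∩ c.domain t, ENNReal.ofReal (c.density Ω t ζ) := by
  rw [chartMeasure, Measure.map_apply_of_aemeasurable (aemeasurable_param c t) hA,
    withDensity_apply', Measure.restrict_restrict' (c.isOpen_domain t).measurableSet]

omit [IsManifold 𝓘(ℂ, (Fin m → ℂ) × (Fin n → ℂ)) ω X] in
lemma chartMeasure_inter {A S : Set X} (hA : MeasurableSet A) (hS : MeasurableSet S)
    (h : ∀ ζ ∈ c.domain t, c.param t ζ ∈ S) :
    chartMeasure Ω c t (A ∩ S) = chartMeasure Ω c t A := by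
  rw [chartMeasure_apply c t hA, chartMeasure_apply c t (hA.inter hS)]
  congr 2
  ext ζ
  simp only [Set.preimage_inter, Set.mem_inter_iff, Set.mem_preimage]
  exact ⟨fun h1 => ⟨h1.1.1, h1.2⟩, fun h1 => ⟨⟨h1.1, h _ h1.2⟩, h1.2⟩⟩

end FibreMeasure

section FibreMeasure

open scoped ComplexOrder

variable {m n : ℕ}
variable {X : Type*} [TopologicalSpace X] [ChartedSpace ((Fin m → ℂ) × (Fin n → ℂ)) X]
  [IsManifold 𝓘(ℂ, (Fin m → ℂ) × (Fin n → ℂ)) ω X]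
variable {B : Type*} [TopologicalSpace B] [ChartedSpace (Fin m → ℂ) B]
variable {p : X → B} {Ω : TwoForm ((Fin m → ℂ) × (Fin n → ℂ)) X}

lemma det_restrictScalars_eq (J : (Fin n → ℂ) →L[ℂ] (Fin n → ℂ)) :
    (J.restrictScalars ℝ).det = ‖J.toLinearMap.det‖ ^ 2 := by
  have h := LinearMap.det_restrictScalars (R := ℝ) (f := J.toLinearMap)
  rw [Algebra.norm_complex_apply, Complex.normSq_eq_norm_sq] at h
  exact h

variable (hΩ : IsPoissonKahlerForm p Ω) (c c' : FibredChart (m := m) (n := n) p)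

/-- The transition map between the fibre coordinates of two fibred charts. -/
def fibreTransition (c c' : FibredChart (m := m) (n := n) p) (t : B) (ζ : Fin n → ℂ) : Fin n → ℂ :=
  (c'.total (c.param t ζ)).2

/-- The differential of the transition map between fibre coordinates. -/
def fibreTransitionDeriv (c c' : FibredChart (m := m) (n := n) p) (t : B) (ζ : Fin n → ℂ) :
    (Fin n → ℂ) →L[ℂ] (Fin n → ℂ) :=
  (ContinuousLinearMap.snd ℂ _ _).comp
    ((fderiv ℂ (fun z => c'.total (c.total.symm z)) (c.base t, ζ)).comp
      (ContinuousLinearMap.inr ℂ _ _))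

omit [IsManifold 𝓘(ℂ, (Fin m → ℂ) × (Fin n → ℂ)) ω X] in
lemma hasFDerivAt_fibreTransition {t : B} {ζ : Fin n → ℂ} (hζ : ζ ∈ c.domain t)
    (hζ' : c.param t ζ ∈ c'.total.source) :
    HasFDerivAt (𝕜 := ℂ) (fibreTransition c c' t) (fibreTransitionDeriv c c' t ζ) ζ := by
  have h1 := ((contDiffAt_transition c.total_mem c'.total_mem hζ.2 hζ').differentiableAt
    (by simp)).hasFDerivAt
  have h2 : HasFDerivAt (𝕜 := ℂ) (fun z : Fin n → ℂ => (c.base t, z))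
      (ContinuousLinearMap.inr ℂ (Fin m → ℂ) (Fin n → ℂ)) ζ :=
    (hasFDerivAt_const (c.base t) ζ).prodMk (hasFDerivAt_id (𝕜 := ℂ) ζ)
  have h3 : HasFDerivAt (𝕜 := ℂ) (fun z : Fin n → ℂ => c'.total (c.param t z)) _ ζ :=
    HasFDerivAt.comp (f := fun z : Fin n → ℂ => (c.base t, z)) ζ h1 h2
  exact h3.snd

omit [IsManifold 𝓘(ℂ, (Fin m → ℂ) × (Fin n → ℂ)) ω X] in
lemma fderiv_transition_vert {t : B} {ζ : Fin n → ℂ} (hζ : ζ ∈ c.domain t)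
    (hζ' : c.param t ζ ∈ c'.total.source) (a : Fin n → ℂ) :
    fderiv ℂ (fun z => c'.total (c.total.symm z)) (c.base t, ζ) (0, a)
      = (0, fibreTransitionDeriv c c' t ζ a) := by
  have h1 := ((contDiffAt_transition c.total_mem c'.total_mem hζ.2 hζ').differentiableAt
    (by simp)).hasFDerivAt
  have h2 : HasFDerivAt (𝕜 := ℂ) (fun z : Fin n → ℂ => (c.base t, z))
      (ContinuousLinearMap.inr ℂ (Fin m → ℂ) (Fin n → ℂ)) ζ :=
    (hasFDerivAt_const (c.base t) ζ).prodMk (hasFDerivAt_id (𝕜 := ℂ) ζ)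
  have h3 : HasFDerivAt (𝕜 := ℂ) (fun z : Fin n → ℂ => c'.total (c.param t z)) _ ζ :=
    HasFDerivAt.comp (f := fun z : Fin n → ℂ => (c.base t, z)) ζ h1 h2
  -- the base coordinate is constant along the fibre
  have h4 : (fun z : Fin n → ℂ => (c'.total (c.param t z)).1) =ᶠ[nhds ζ] fun _ => c'.base t := by
    have hc : ContinuousAt (c.param t) ζ :=
      (c.continuousOn_param t).continuousAt ((c.isOpen_domain t).mem_nhds hζ)
    filter_upwards [(c.isOpen_domain t).mem_nhds hζ,
      hc.preimage_mem_nhds (c'.total.open_source.mem_nhds hζ')] with z hz hz'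
    rw [c'.fst_eq _ hz', c.proj_param hz]
  have h5 := (h3.fst.congr_of_eventuallyEq h4.symm).unique (hasFDerivAt_const (c'.base t) ζ)
  refine Prod.ext ?_ rfl
  exact DFunLike.congr_fun h5 a

include hΩ in
lemma gramAt_transition {t : B} {ζ : Fin n → ℂ} (hζ : ζ ∈ c.domain t)
    (hζ' : c.param t ζ ∈ c'.total.source) :
    (IsLocalPoissonKahler.gramAt (Ω.formIn c.total) (c.base t, ζ)).det
      = ‖(fibreTransitionDeriv c c' t ζ).toLinearMap.det‖ ^ 2 *
        (IsLocalPoissonKahler.gramAt (Ω.formIn c'.total)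
          (c'.base t, fibreTransition c c' t ζ)).det := by
  have hy' : c'.total (c.total.symm (c.base t, ζ)) = (c'.base t, fibreTransition c c' t ζ) := by
    have := c'.total_eq hζ'
    rwa [c.proj_param hζ] at this
  have hd : (c'.base t, fibreTransition c c' t ζ) ∈ c'.dom := by
    rw [← hy']; exact c'.total.map_source hζ'
  set J := fibreTransitionDeriv c c' t ζ
  set K := LinearMap.toMatrix' J.toLinearMap
  have h1 : fderiv ℝ (fun z => c'.total (c.total.symm z)) (c.base t, ζ)
      = (fderiv ℂ (fun z => c'.total (c.total.symm z)) (c.base t, ζ)).restrictScalars ℝ :=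
    ((contDiffAt_transition c.total_mem c'.total_mem hζ.2 hζ').differentiableAt
      (by simp)).fderiv_restrictScalars ℝ
  have h2 : ∀ u v, Ω.formIn c.total (c.base t, ζ) ![u, v]
      = Ω.formIn c'.total (c'.base t, fibreTransition c c' t ζ)
        ![fderiv ℂ (fun z => c'.total (c.total.symm z)) (c.base t, ζ) u,
          fderiv ℂ (fun z => c'.total (c.total.symm z)) (c.base t, ζ) v] := by
    intro u v
    rw [Ω.formIn_transition c.total_mem c'.total_mem hζ.2 hζ', h1, hy']
    refine congrArg (Ω.formIn c'.total (c'.base t, fibreTransition c c' t ζ)) (funext fun i => ?_)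
    fin_cases i <;> rfl
  have h3 : ∀ a b : Fin n → ℂ, herm2 (Ω.formIn c.total (c.base t, ζ)) (0, a) (0, b)
      = herm2 (Ω.formIn c'.total (c'.base t, fibreTransition c c' t ζ)) (0, J a) (0, J b) := by
    intro a b
    have hI : Complex.I • ((0, b) : (Fin m → ℂ) × (Fin n → ℂ)) = (0, Complex.I • b) := by simp
    simp only [herm2, h2, fderiv_transition_vert c c' hζ hζ', hI, map_smul]
    simp [J]
  have h4 : IsLocalPoissonKahler.gramAt (Ω.formIn c.total) (c.base t, ζ)
      = K.transpose * IsLocalPoissonKahler.gramAt (Ω.formIn c'.total)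
        (c'.base t, fibreTransition c c' t ζ) * cc K := by
    ext α β
    have h5 : IsLocalPoissonKahler.gramAt (Ω.formIn c.total) (c.base t, ζ) α β
        = herm2 (Ω.formIn c.total (c.base t, ζ)) (0, Pi.single α 1) (0, Pi.single β 1) := rfl
    rw [h5, h3, herm2_vert_vert hΩ c' hd]
    simp only [Matrix.mul_apply, Matrix.transpose_apply, cc_apply, Finset.sum_mul, K,
      LinearMap.toMatrix'_apply]
    exact Finset.sum_comm
  have h6 : (cc K).det = star K.det := by
    have : cc K = (starRingEnd ℂ).mapMatrix K := rfl
    rw [this, ← RingHom.map_det]; rfl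
  have h7 : K.det = J.toLinearMap.det := LinearMap.det_toMatrix' _
  rw [h4, Matrix.det_mul, Matrix.det_mul, Matrix.det_transpose, h6, h7]
  have h8 := Complex.mul_conj (J.toLinearMap.det)
  rw [Complex.normSq_eq_norm_sq] at h8
  push_cast at h8
  rw [← h8, Complex.star_def]
  ring

variable [MeasurableSpace X] [BorelSpace X]

include hΩ in
/-- The measures in two charts agree on the overlap, by the change of variables formula. -/
lemma chartMeasure_congr (t : B) {A : Set X} (hA : MeasurableSet A) (hAc : A ⊆ c.total.source)
    (hAc' : A ⊆ c'.total.source) : chartMeasure Ω c t A = chartMeasure Ω c' t A := by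
  rw [chartMeasure_apply c t hA, chartMeasure_apply c' t hA]
  set s := c.param t ⁻¹' A ∩ c.domain t
  have himg : fibreTransition c c' t '' s = c'.param t ⁻¹' A ∩ c'.domain t := by
    ext ζ
    constructor
    · rintro ⟨z, ⟨hz1, hz2⟩, rfl⟩
      have h1 := c'.snd_mem_domain (hAc' hz1)
      have h2 := c'.param_snd (hAc' hz1)
      rw [c.proj_param hz2] at h1 h2
      refine ⟨?_, h1⟩
      rw [Set.mem_preimage]
      exact h2 ▸ hz1
    · rintro ⟨hz1, hz2⟩
      have h1 := c.snd_mem_domain (hAc hz1)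
      have h2 := c.param_snd (hAc hz1)
      rw [c'.proj_param hz2] at h1 h2
      refine ⟨(c.total (c'.param t ζ)).2, ⟨?_, h1⟩, ?_⟩
      · rw [Set.mem_preimage, h2]; exact hz1
      · rw [fibreTransition, h2, c'.total_param hz2]
  have hinj : Set.InjOn (fibreTransition c c' t) s := by
    intro z ⟨hz1, hz2⟩ z' ⟨hz1', hz2'⟩ h
    have h1 := c'.param_snd (hAc' hz1)
    have h2 := c'.param_snd (hAc' hz1')
    rw [c.proj_param hz2] at h1
    rw [c.proj_param hz2'] at h2
    have h3 : c.param t z = c.param t z' := h1.symm.trans (Eq.trans (congrArg _ h) h2)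
    have h4 := congrArg c.total h3
    rw [c.total_param hz2, c.total_param hz2'] at h4
    exact congrArg Prod.snd h4
  rw [← himg, lintegral_image_eq_lintegral_abs_det_fderiv_mul volume
    (measurableSet_param_preimage c t hA)
    (fun ζ hζ => ((hasFDerivAt_fibreTransition c c' hζ.2 (hAc' hζ.1)).restrictScalars
      ℝ).hasFDerivWithinAt) hinj]
  refine setLIntegral_congr_fun (measurableSet_param_preimage c t hA) fun ζ hζ => ?_
  have h1 : c.density Ω t ζ = ‖(fibreTransitionDeriv c c' t ζ).toLinearMap.det‖ ^ 2
      * c'.density Ω t (fibreTransition c c' t ζ) := by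
    have h2 := density_eq hΩ c hζ.2
    have hmem : fibreTransition c c' t ζ ∈ c'.domain t := (himg ▸ ⟨ζ, hζ, rfl⟩ :
      fibreTransition c c' t ζ ∈ c'.param t ⁻¹' A ∩ c'.domain t).2
    have h3 := density_eq hΩ c' hmem
    rw [gramAt_transition hΩ c c' hζ.2 (hAc' hζ.1), mul_left_comm, ← h3] at h2
    exact_mod_cast h2
  rw [det_restrictScalars_eq, abs_of_nonneg (by positivity), ← ENNReal.ofReal_mul (by positivity), h1]

omit [IsManifold 𝓘(ℂ, (Fin m → ℂ) × (Fin n → ℂ)) ω X] [BorelSpace X] in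
lemma chartMeasure_le (t : B) : chartMeasure Ω c t ≤ fibreMeasure p Ω t :=
  le_iSup (fun c : FibredChart (m := m) (n := n) p => chartMeasure Ω c t) c

include hΩ in
/-- The fibre measure restricts to the chart measure. -/
lemma fibreMeasure_restrict (t : B) :
    (fibreMeasure p Ω t).restrict c.total.source = chartMeasure Ω c t := by
  have hU := c.total.open_source.measurableSet
  have key : fibreMeasure p Ω t
      ≤ chartMeasure Ω c t + (fibreMeasure p Ω t).restrict c.total.sourceᶜ := by
    refine iSup_le fun c' => ?_
    rw [Measure.le_iff]
    intro A hA
    have hU' := c'.total.open_source.measurableSet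
    change chartMeasure Ω c' t A ≤ _
    rw [← measure_inter_add_sdiff A hU, Measure.add_apply, Measure.restrict_apply hA]
    refine add_le_add ?_ (chartMeasure_le c' t _)
    rw [← chartMeasure_inter c' t (hA.inter hU) hU' (fun ζ hζ => c'.param_mem hζ),
      ← chartMeasure_congr hΩ c c' t ((hA.inter hU).inter hU') (fun x hx => hx.1.2)
        (fun x hx => hx.2)]
    exact measure_mono fun x hx => hx.1.1
  ext A hA
  rw [Measure.restrict_apply hA]
  refine le_antisymm ?_ ?_
  · refine (key _).trans ?_
    rw [Measure.add_apply, Measure.restrict_apply (hA.inter hU), Set.inter_assoc,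
      Set.inter_compl_self, Set.inter_empty, measure_empty, add_zero]
    exact measure_mono Set.inter_subset_left
  · rw [← chartMeasure_inter c t hA hU (fun ζ hζ => c.param_mem hζ)]
    exact chartMeasure_le c t _

end FibreMeasure

section FibreIntegral

open scoped ComplexOrder

variable {m n : ℕ}
variable {X : Type*} [TopologicalSpace X] [ChartedSpace ((Fin m → ℂ) × (Fin n → ℂ)) X]
  [IsManifold 𝓘(ℂ, (Fin m → ℂ) × (Fin n → ℂ)) ω X]
variable {B : Type*} [TopologicalSpace B] [ChartedSpace (Fin m → ℂ) B]
variable {p : X → B} {Ω : TwoForm ((Fin m → ℂ) × (Fin n → ℂ)) X}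
variable [MeasurableSpace X] [BorelSpace X]

omit [IsManifold 𝓘(ℂ, (Fin m → ℂ) × (Fin n → ℂ)) ω X] in
lemma ae_fibreMeasure_proj [T1Space B] (hp : Continuous p) (t : B) :
    ∀ᵐ x ∂(fibreMeasure p Ω t), p x = t := by
  have hF : MeasurableSet (p ⁻¹' {t}) := (isClosed_singleton.preimage hp).measurableSet
  have key : fibreMeasure p Ω t ≤ (fibreMeasure p Ω t).restrict (p ⁻¹' {t}) := by
    refine iSup_le fun c => ?_
    rw [Measure.le_iff]
    intro A hA
    rw [Measure.restrict_apply hA]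
    change chartMeasure Ω c t A ≤ _
    rw [← chartMeasure_inter c t hA hF (fun ζ hζ => c.proj_param hζ)]
    exact chartMeasure_le c t _
  have h := key (p ⁻¹' {t})ᶜ
  rw [Measure.restrict_apply hF.compl, Set.compl_inter_self, measure_empty] at h
  exact nonpos_iff_eq_zero.1 h

variable (hΩ : IsPoissonKahlerForm p Ω) (c : FibredChart (m := m) (n := n) p)

include hΩ

omit [MeasurableSpace X] [BorelSpace X] in
lemma fn_gram_det {y : (Fin m → ℂ) × (Fin n → ℂ)} (hy : y ∈ c.dom) :
    SmoothRing.fn (hΩ.isLocal c).gram.det y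
      = (IsLocalPoissonKahler.gramAt (Ω.formIn c.total) y).det := by
  rw [← SmoothRing.eval_eq_fn _ hy, RingHom.map_det, ← (hΩ.isLocal c).gram_map_eval hy]; rfl

omit [MeasurableSpace X] [BorelSpace X] in
lemma continuousOn_density (t : B) : ContinuousOn (c.density Ω t) (c.domain t) := by
  have h1 : ContinuousOn (fun ζ => ((2 : ℂ) ^ n *
      SmoothRing.fn (hΩ.isLocal c).gram.det (c.base t, ζ)).re) (c.domain t) := by
    refine Complex.continuous_re.comp_continuousOn (continuousOn_const.mul ?_)
    exact (SmoothRing.contDiffOn_fn _).continuousOn.comp (f := fun ζ => (c.base t, ζ))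
      (by fun_prop) fun _ h => h.2
  refine h1.congr fun ζ hζ => ?_
  simp only
  rw [fn_gram_det hΩ c hζ.2, ← density_eq hΩ c hζ, Complex.ofReal_re]

/-- The fibre integral of a function that vanishes outside of the chart. -/
lemma integral_fibreMeasure_eq {t : B} (ht : t ∈ c.base.source) {g : X → ℂ}
    (hg : ∀ x ∉ c.total.source, g x = 0) (G : SmoothRing c.dom)
    (hG : ∀ y ∈ c.dom, g (c.total.symm y) = SmoothRing.fn G y) :
    ∫ x, g x ∂(fibreMeasure p Ω t) = 2 ^ n * (hΩ.isLocal c).localIntegral G (c.base t) := by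
  have hcont : ContinuousOn g c.total.source := by
    have h1 : ContinuousOn (fun x => SmoothRing.fn G (c.total x)) c.total.source :=
      (SmoothRing.contDiffOn_fn G).continuousOn.comp c.total.continuousOn
        fun x hx => c.total.map_source hx
    refine h1.congr fun x hx => ?_
    have := hG (c.total x) (c.total.map_source hx)
    rwa [c.total.left_inv hx] at this
  have hmeas : AEStronglyMeasurable g (chartMeasure Ω c t) := by
    rw [← fibreMeasure_restrict hΩ c t]
    exact hcont.aestronglyMeasurable c.total.open_source.measurableSet
  have hdm : MeasurableSet (c.domain t) := (c.isOpen_domain t).measurableSet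
  rw [← setIntegral_eq_integral_of_forall_compl_eq_zero (s := c.total.source) fun x hx => hg x hx,
    fibreMeasure_restrict hΩ c t, chartMeasure, integral_map (aemeasurable_param c t) hmeas,
    integral_withDensity_eq_integral_toReal_smul₀
      ((continuousOn_density hΩ c t).aemeasurable hdm).ennreal_ofReal
      (Filter.Eventually.of_forall fun _ => ENNReal.ofReal_lt_top),
    IsLocalPoissonKahler.localIntegral, ← integral_const_mul,
    ← setIntegral_eq_integral_of_forall_compl_eq_zero (s := c.domain t)
      (f := fun z => (2 : ℂ) ^ n * _)]
  · refine setIntegral_congr_fun hdm fun ζ hζ => ?_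
    have h1 : g (c.param t ζ) = SmoothRing.fn G (c.base t, ζ) := hG _ hζ.2
    simp only [SmoothRing.fn_mul, Pi.mul_apply]
    rw [ENNReal.toReal_ofReal (density_pos hΩ c hζ).le, h1, Complex.real_smul, density_eq hΩ c hζ,
      fn_gram_det hΩ c hζ.2]
    ring
  · intro ζ hζ
    have : (c.base t, ζ) ∉ c.dom := fun h => hζ ⟨ht, h⟩
    simp [SmoothRing.fn, extendZero, this]

/-- The fibre measure is finite near each point of the fibre. -/
lemma exists_fibreMeasure_lt_top {x : X} (hx : x ∈ c.total.source) (t : B) :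
    ∃ U ∈ nhds x, fibreMeasure p Ω t U < ⊤ := by
  obtain ⟨K, hK, hKx, hKd⟩ := exists_compact_subset c.total.open_target (c.total.map_source hx)
  refine ⟨c.total.source ∩ c.total ⁻¹' interior K,
    (c.total.isOpen_inter_preimage isOpen_interior).mem_nhds ⟨hx, hKx⟩, ?_⟩
  have hU := (c.total.isOpen_inter_preimage (isOpen_interior (s := K))).measurableSet
  have h1 : fibreMeasure p Ω t (c.total.source ∩ c.total ⁻¹' interior K)
      = chartMeasure Ω c t (c.total.source ∩ c.total ⁻¹' interior K) := by
    rw [← fibreMeasure_restrict hΩ c t, Measure.restrict_apply hU]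
    congr 1
    exact (Set.inter_eq_left.2 Set.inter_subset_left).symm
  rw [h1, chartMeasure_apply c t hU]
  by_cases ht : t ∈ c.base.source
  · set K' : Set (Fin n → ℂ) := (fun ζ => (c.base t, ζ)) ⁻¹' K
    have hK' : IsCompact K' := by
      refine (hK.image continuous_snd).of_isClosed_subset (hK.isClosed.preimage (by fun_prop)) ?_
      intro ζ hζ
      exact ⟨_, hζ, rfl⟩
    have hsub : K' ⊆ c.domain t := fun ζ hζ => ⟨ht, hKd hζ⟩
    have h2 : IntegrableOn (c.density Ω t) K' :=
      ((continuousOn_density hΩ c t).mono hsub).integrableOn_compact hK'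
    refine lt_of_le_of_lt (lintegral_mono_set ?_) (Integrable.lintegral_lt_top h2)
    intro ζ ⟨hζ1, hζ2⟩
    have h3 : c.total (c.param t ζ) ∈ interior K := hζ1.2
    rw [c.total_param hζ2] at h3
    exact interior_subset (s := K) h3
  · have : c.domain t = ∅ := by ext ζ; simp [FibredChart.domain, ht]
    rw [this, Set.inter_empty, Measure.restrict_empty, lintegral_zero_measure]
    exact ENNReal.zero_lt_top

lemma fibreMeasure_lt_top [T1Space B] [IsManifold 𝓘(ℂ, Fin m → ℂ) ω B] (hp : IsProperMap p)
    (hsub : Manifold.IsSubmersion 𝓘(ℂ, (Fin m → ℂ) × (Fin n → ℂ)) 𝓘(ℂ, Fin m → ℂ) ω p) (t : B) :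
    fibreMeasure p Ω t Set.univ < ⊤ := by
  have h1 : fibreMeasure p Ω t Set.univ ≤ fibreMeasure p Ω t (p ⁻¹' {t}) := by
    rw [← measure_inter_add_sdiff Set.univ (isClosed_singleton.preimage hp.continuous).measurableSet]
    have h2 : fibreMeasure p Ω t (Set.univ \ p ⁻¹' {t}) = 0 := by
      rw [← Set.compl_eq_univ_sdiff]
      exact ae_fibreMeasure_proj hp.continuous t
    rw [h2, add_zero]
    exact measure_mono Set.inter_subset_right
  refine lt_of_le_of_lt h1 ?_
  refine IsCompact.measure_lt_top_of_nhdsWithin (hp.isCompact_preimage isCompact_singleton) ?_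
  intro x _
  obtain ⟨c, -, hc⟩ := exists_fibredChart hsub x
    (IsManifold.chart_mem_maximalAtlas (I := 𝓘(ℂ, Fin m → ℂ)) (n := ω) (p x)) (mem_chart_source _ _)
  obtain ⟨U, hU, hlt⟩ := exists_fibreMeasure_lt_top hΩ c hc t
  exact ⟨U, mem_nhdsWithin_of_mem_nhds hU, hlt⟩

end FibreIntegral

/-! ### Differentiation of fibre integrals -/

section Directions

variable {E : Type*} [NormedAddCommGroup E] [NormedSpace ℂ E]

lemma wirt_dir_add (u v : E) (F : E → ℂ) (y : E) : wirt (u + v) F y = wirt u F y + wirt v F y := by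
  simp only [wirt, smul_add, map_add]; ring

lemma wirt_dir_smul (z : ℂ) (u : E) (F : E → ℂ) (y : E) : wirt (z • u) F y = z * wirt u F y := by
  set L := fderiv ℝ F y
  have h1 : z • u = z.re • u + z.im • (Complex.I • u) := by
    conv_lhs => rw [← Complex.re_add_im z]
    rw [add_smul, mul_smul]
    simp
  have h2 : Complex.I • z • u = z.re • (Complex.I • u) - z.im • u := by
    rw [h1, smul_add, smul_comm, smul_comm Complex.I z.im, smul_smul, Complex.I_mul_I]
    module
  have h3 : z = z.re + z.im * Complex.I := (Complex.re_add_im z).symm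
  simp only [wirt]
  rw [h2, h1, map_add, map_sub, L.map_smul, L.map_smul, L.map_smul, L.map_smul]
  conv_rhs => rw [h3]
  simp only [Complex.real_smul]
  linear_combination ((z.im : ℂ) * L (Complex.I • u)) / 2 * Complex.I_mul_I

lemma wirt_dir_sum {ι : Type*} (s : Finset ι) (z : ι → ℂ) (u : ι → E) (F : E → ℂ) (y : E) :
    wirt (∑ i ∈ s, z i • u i) F y = ∑ i ∈ s, z i * wirt (u i) F y := by
  induction s using Finset.cons_induction with
  | empty => simp [wirt]
  | cons a s ha ih => rw [Finset.sum_cons, Finset.sum_cons, wirt_dir_add, wirt_dir_smul, ih]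

lemma wirt_comp {F : E → ℂ} {ψ : E → E} {y : E} (hψ : DifferentiableAt ℂ ψ y)
    (hF : DifferentiableAt ℝ F (ψ y)) (u : E) :
    wirt u (fun z => F (ψ z)) y = wirt (fderiv ℂ ψ y u) F (ψ y) := by
  have h1 := hF.hasFDerivAt.comp y (hψ.hasFDerivAt.restrictScalars ℝ)
  have h2 : fderiv ℝ (fun z => F (ψ z)) y = _ := h1.fderiv
  simp only [wirt, h2]
  simp

variable {M : Type*} [TopologicalSpace M] [ChartedSpace E M]

lemma wirt_transition {c c' : OpenPartialHomeomorph M E}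
    (hc : c ∈ IsManifold.maximalAtlas 𝓘(ℂ, E) ω M) (hc' : c' ∈ IsManifold.maximalAtlas 𝓘(ℂ, E) ω M)
    {x : M} (hx : x ∈ c.source) (hx' : x ∈ c'.source) {f : M → ℂ}
    (hf : DifferentiableAt ℝ (fun y => f (c.symm y)) (c x)) (v : TangentSpace 𝓘(ℂ, E) x) :
    wirt (E := E) (mfderiv 𝓘(ℂ, E) 𝓘(ℂ, E) c' x v) (fun y => f (c'.symm y)) (c' x)
      = wirt (E := E) (mfderiv 𝓘(ℂ, E) 𝓘(ℂ, E) c x v) (fun y => f (c.symm y)) (c x) := by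
  have hy : c' x ∈ c'.target := c'.map_source hx'
  have hy' : c'.symm (c' x) ∈ c.source := by rwa [c'.left_inv hx']
  have h1 : (fun y => f (c'.symm y)) =ᶠ[nhds (c' x)] fun y => f (c.symm (c (c'.symm y))) := by
    filter_upwards [transition_eventually hy hy'] with z hz
    rw [c.left_inv hz.2]
  have h2 := (contDiffAt_transition hc' hc hy hy').differentiableAt (by simp)
  have h3 : ∀ u : E, wirt u (fun y => f (c'.symm y)) (c' x)
      = wirt (fderiv ℂ (fun z => c (c'.symm z)) (c' x) u) (fun y => f (c.symm y)) (c x) := by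
    intro u
    rw [wirt_congr h1, wirt_comp (F := fun y => f (c.symm y)) h2 (by rwa [c'.left_inv hx']),
      c'.left_inv hx']
  exact (h3 _).trans (congrArg (fun u : E => wirt u (fun y => f (c.symm y)) (c x))
    (mfderiv_transition hc' hc hx' hx v).symm)

end Directions

section Transport

variable {m n : ℕ}
variable {X : Type*} [TopologicalSpace X] [ChartedSpace ((Fin m → ℂ) × (Fin n → ℂ)) X]
variable {B : Type*} [TopologicalSpace B] [ChartedSpace (Fin m → ℂ) B]
variable {p : X → B} {Ω : TwoForm ((Fin m → ℂ) × (Fin n → ℂ)) X}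
  {φ : OpenPartialHomeomorph B (Fin m → ℂ)}

/-- The function `f` is smooth over the domain of the chart `φ` of the base: it is smooth in all
fibred charts with base chart `φ`. -/
def SmoothOver (p : X → B) (φ : OpenPartialHomeomorph B (Fin m → ℂ)) (f : X → ℂ) : Prop :=
  ∀ c : FibredChart (m := m) (n := n) p, c.base = φ →
    ContDiffOn ℝ ∞ (fun y => f (c.total.symm y)) c.dom

/-- The coordinate vector `∂_l` of the base chart `φ` at `t`. -/
def coordVec (φ : OpenPartialHomeomorph B (Fin m → ℂ)) (t : B) (l : Fin m) :
    TangentSpace 𝓘(ℂ, Fin m → ℂ) t :=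
  (mfderiv 𝓘(ℂ, Fin m → ℂ) 𝓘(ℂ, Fin m → ℂ) φ.symm (φ t) (Pi.single l 1 : Fin m → ℂ) : Fin m → ℂ)

/-- The derivative of `f` along the horizontal lift of the coordinate field `∂_l`, a vector of type
`(1,0)`; the Wirtinger derivative is taken in the preferred chart at the point. -/
def hder (p : X → B) (Ω : TwoForm ((Fin m → ℂ) × (Fin n → ℂ)) X)
    (φ : OpenPartialHomeomorph B (Fin m → ℂ)) (l : Fin m) (f : X → ℂ) (x : X) : ℂ :=
  wirt (E := (Fin m → ℂ) × (Fin n → ℂ))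
    (mfderiv 𝓘(ℂ, (Fin m → ℂ) × (Fin n → ℂ)) 𝓘(ℂ, (Fin m → ℂ) × (Fin n → ℂ))
      (chartAt ((Fin m → ℂ) × (Fin n → ℂ)) x) x (hlift p Ω x (coordVec φ (p x) l)))
    (fun y => f ((chartAt ((Fin m → ℂ) × (Fin n → ℂ)) x).symm y))
    (chartAt ((Fin m → ℂ) × (Fin n → ℂ)) x x)

/-- A function that is smooth over `φ`, in a fibred chart. -/
def SmoothOver.ring {f : X → ℂ} (hf : SmoothOver (n := n) p φ f)
    (c : FibredChart (m := m) (n := n) p) (hc : c.base = φ) : SmoothRing c.dom :=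
  SmoothRing.mk _ (hf c hc)

namespace SmoothOver

variable {f g : X → ℂ}

lemma fn_ring (hf : SmoothOver (n := n) p φ f) (c : FibredChart (m := m) (n := n) p)
    (hc : c.base = φ) {y : (Fin m → ℂ) × (Fin n → ℂ)} (hy : y ∈ c.dom) :
    SmoothRing.fn (hf.ring c hc) y = f (c.total.symm y) :=
  SmoothRing.fn_mk _ hy

lemma add (hf : SmoothOver (n := n) p φ f) (hg : SmoothOver (n := n) p φ g) :
    SmoothOver (n := n) p φ (f + g) := fun c hc => (hf c hc).add (hg c hc)

lemma mul (hf : SmoothOver (n := n) p φ f) (hg : SmoothOver (n := n) p φ g) :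
    SmoothOver (n := n) p φ (f * g) := fun c hc => (hf c hc).mul (hg c hc)

lemma one_sub (hf : SmoothOver (n := n) p φ f) :
    SmoothOver (n := n) p φ (1 - f) := fun c hc => contDiffOn_const.sub (hf c hc)

lemma conj (hf : SmoothOver (n := n) p φ f) :
    SmoothOver (n := n) p φ (fun x => star (f x)) := fun c hc =>
  Complex.conjCLE.contDiff.comp_contDiffOn (hf c hc)

lemma differentiableAt (hf : SmoothOver (n := n) p φ f) (c : FibredChart (m := m) (n := n) p)
    (hc : c.base = φ) {y : (Fin m → ℂ) × (Fin n → ℂ)} (hy : y ∈ c.dom) :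
    DifferentiableAt ℝ (fun y => f (c.total.symm y)) y :=
  ((hf c hc).contDiffAt (c.dom.isOpen.mem_nhds hy)).differentiableAt (by simp)

end SmoothOver

lemma FibredChart.dbase_coordVec (c : FibredChart (m := m) (n := n) p) {t : B}
    (ht : t ∈ c.base.source) (l : Fin m) : c.dbase t (coordVec c.base t l) = Pi.single l 1 := by
  have h := mfderiv_mfderiv_symm c.base_mem (c.base.map_source ht) (Pi.single l 1)
  rwa [c.base.left_inv ht] at h

variable [IsManifold 𝓘(ℂ, (Fin m → ℂ) × (Fin n → ℂ)) ω X]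
variable (hΩ : IsPoissonKahlerForm p Ω)

include hΩ

lemma hder_eq_wirt (c : FibredChart (m := m) (n := n) p) {f : X → ℂ}
    {y : (Fin m → ℂ) × (Fin n → ℂ)} (hy : y ∈ c.dom)
    (hf : DifferentiableAt ℝ (fun y => f (c.total.symm y)) y) (l : Fin m) :
    hder p Ω c.base l f (c.total.symm y)
      = wirt ((hΩ.isLocal c).lift y (Pi.single l 1)) (fun y => f (c.total.symm y)) y := by
  have h1 := wirt_transition c.total_mem (IsManifold.chart_mem_maximalAtlas (I :=
    𝓘(ℂ, (Fin m → ℂ) × (Fin n → ℂ))) (n := ω) (c.total.symm y)) (c.total.map_target hy)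
    (mem_chart_source _ _) (by rwa [c.total.right_inv hy])
    (hlift p Ω (c.total.symm y) (coordVec c.base (p (c.total.symm y)) l))
  refine h1.trans ?_
  rw [c.total.right_inv hy, hlift_eq hΩ c hy, c.dbase_coordVec (c.proj_mem hy)]
  congr 1
  exact mfderiv_mfderiv_symm c.total_mem hy _

lemma hder_eq (c : FibredChart (m := m) (n := n) p) (hc : c.base = φ) {f : X → ℂ}
    (hf : SmoothOver (n := n) p φ f) {y : (Fin m → ℂ) × (Fin n → ℂ)} (hy : y ∈ c.dom) (l : Fin m) :
    hder p Ω φ l f (c.total.symm y)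
      = SmoothRing.fn ((hΩ.isLocal c).calculus.V l (hf.ring c hc)) y := by
  subst hc
  rw [hder_eq_wirt hΩ c hy (hf.differentiableAt c rfl hy), IsLocalPoissonKahler.lift_single,
    wirt_dir_add, wirt_dir_sum, HorizontalCalculus.V_apply, ← SmoothRing.eval_eq_fn _ hy, map_add,
    map_sum]
  have h1 : ∀ A, SmoothRing.eval ⟨y, hy⟩ ((hΩ.isLocal c).calculus.d A (hf.ring c rfl))
      = wirt (coordBasis A) (fun y => f (c.total.symm y)) y := by
    intro A
    rw [SmoothRing.eval_eq_fn]
    refine (SmoothRing.fn_deriv (coordBasis A) _ hy).trans (wirt_congr ?_)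
    exact SmoothRing.fn_mk_eventuallyEq (hf c rfl) hy
  rw [h1]
  congr 1
  refine Finset.sum_congr rfl fun α _ => ?_
  rw [map_mul, h1, SmoothRing.eval_eq_fn]
  rfl

lemma SmoothOver.hder {f : X → ℂ} (hf : SmoothOver (n := n) p φ f) (l : Fin m) :
    SmoothOver (n := n) p φ (hder p Ω φ l f) := fun c hc =>
  (SmoothRing.contDiffOn_fn ((hΩ.isLocal c).calculus.V l (hf.ring c hc))).congr fun _ hy =>
    hder_eq hΩ c hc hf hy l

omit [IsManifold 𝓘(ℂ, (Fin m → ℂ) × (Fin n → ℂ)) ω X] hΩ in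
/-- A function that is smooth in one fibred chart and has compact support in its domain. -/
lemma SmoothOver.of_compact [T2Space X] (c : FibredChart (m := m) (n := n) p) {K : Set X}
    (hK : IsCompact K) (hKc : K ⊆ c.total.source) {f : X → ℂ} (hf : ∀ x ∉ K, f x = 0)
    (hfc : ContDiffOn ℝ ∞ (fun y => f (c.total.symm y)) c.dom) : SmoothOver (n := n) p φ f := by
  intro c' _ y hy
  refine ContDiffAt.contDiffWithinAt ?_
  by_cases hx : c'.total.symm y ∈ c.total.source
  · have h1 : (fun y => f (c'.total.symm y)) =ᶠ[nhds y]
        fun y => f (c.total.symm (c.total (c'.total.symm y))) := by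
      filter_upwards [transition_eventually hy hx] with z hz
      rw [c.total.left_inv hz.2]
    refine ContDiffAt.congr_of_eventuallyEq ?_ h1
    exact ContDiffAt.comp (g := fun y => f (c.total.symm y))
      (f := fun z => c.total (c'.total.symm z)) y
      (hfc.contDiffAt (c.dom.isOpen.mem_nhds (c.total.map_source hx))) (contDiffAt_transition_real c'.total_mem c.total_mem hy hx)
  · have h1 : (fun y => f (c'.total.symm y)) =ᶠ[nhds y] fun _ => 0 := by
      have h2 : c'.total.symm y ∈ Kᶜ := fun h => hx (hKc h)
      filter_upwards [(c'.total.continuousAt_symm hy).preimage_mem_nhds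
        (hK.isClosed.isOpen_compl.mem_nhds h2)] with z hz
      exact hf _ hz
    exact contDiffAt_const.congr_of_eventuallyEq h1

omit [IsManifold 𝓘(ℂ, (Fin m → ℂ) × (Fin n → ℂ)) ω X] hΩ in
lemma exists_bump [T2Space X] (c : FibredChart (m := m) (n := n) p) {x : X}
    (hx : x ∈ c.total.source) :
    ∃ b : X → ℂ, SmoothOver (n := n) p φ b ∧ (∀ᶠ z in nhds x, b z = 1) ∧
      ∃ K : Set X, IsCompact K ∧ K ⊆ c.total.source ∧ ∀ z ∉ K, b z = 0 := by
  classical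
  obtain ⟨r, hr, hball⟩ := Metric.nhds_basis_closedBall.mem_iff.1
    (c.total.open_target.mem_nhds (c.total.map_source hx))
  let β : ContDiffBump (c.total x) := ⟨r / 2, r, by positivity, by linarith⟩
  let b : X → ℂ := fun z => if z ∈ c.total.source then (β (c.total z) : ℂ) else 0
  set K : Set X := c.total.symm '' Metric.closedBall (c.total x) r
  have hK : IsCompact K := (isCompact_closedBall _ _).image_of_continuousOn
    (c.total.continuousOn_symm.mono hball)
  have hKc : K ⊆ c.total.source := by
    rintro _ ⟨y, hy, rfl⟩; exact c.total.map_target (hball hy)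
  have hb0 : ∀ z ∉ K, b z = 0 := by
    intro z hz
    by_cases hzc : z ∈ c.total.source
    · have h1 : c.total z ∉ Metric.closedBall (c.total x) r := fun h =>
        hz ⟨c.total z, h, c.total.left_inv hzc⟩
      have h2 : β (c.total z) = 0 := β.zero_of_le_dist (by
        rw [Metric.mem_closedBall, not_le] at h1; exact h1.le)
      simp [b, h2]
    · simp [b, hzc]
  refine ⟨b, SmoothOver.of_compact c hK hKc hb0 ?_, ?_, K, hK, hKc, hb0⟩
  · have h1 : ContDiff ℝ ∞ fun y => (β y : ℂ) := Complex.ofRealCLM.contDiff.comp β.contDiff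
    refine h1.contDiffOn.congr fun y hy => ?_
    have h2 : c.total.symm y ∈ c.total.source := c.total.map_target hy
    simp [b, h2, c.total.right_inv hy]
  · filter_upwards [c.total.open_source.mem_nhds hx, (c.total.continuousAt hx).preimage_mem_nhds
      (Metric.closedBall_mem_nhds (c.total x) (half_pos hr))] with z hz1 hz2
    have : β (c.total z) = 1 := β.one_of_mem_closedBall hz2
    simp [b, hz1, this]

end Transport

section Transport

set_option linter.unusedSectionVars false

variable {m n : ℕ}
variable {X : Type*} [TopologicalSpace X] [ChartedSpace ((Fin m → ℂ) × (Fin n → ℂ)) X]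
variable {B : Type*} [TopologicalSpace B] [ChartedSpace (Fin m → ℂ) B]
variable {p : X → B} {Ω : TwoForm ((Fin m → ℂ) × (Fin n → ℂ)) X}
  {φ : OpenPartialHomeomorph B (Fin m → ℂ)}
variable [MeasurableSpace X]

/-- The fibre integral of `f` as a function of the coordinate `φ` of the base. -/
def fibreIntegral (p : X → B) (Ω : TwoForm ((Fin m → ℂ) × (Fin n → ℂ)) X)
    (φ : OpenPartialHomeomorph B (Fin m → ℂ)) (f : X → ℂ) (y : Fin m → ℂ) : ℂ :=
  ∫ x, f x ∂(fibreMeasure p Ω (φ.symm y))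

/-- The horizontal derivative computes the derivative of the fibre integral of `f` at `y`. -/
def TransportAt (p : X → B) (Ω : TwoForm ((Fin m → ℂ) × (Fin n → ℂ)) X)
    (φ : OpenPartialHomeomorph B (Fin m → ℂ)) (y : Fin m → ℂ) (f : X → ℂ) : Prop :=
  DifferentiableAt ℝ (fibreIntegral p Ω φ f) y ∧
    ∀ l, wirt (Pi.single l 1) (fibreIntegral p Ω φ f) y = fibreIntegral p Ω φ (hder p Ω φ l f) y

variable [BorelSpace X] [T2Space X] [IsManifold 𝓘(ℂ, (Fin m → ℂ) × (Fin n → ℂ)) ω X] [IsManifold 𝓘(ℂ, Fin m → ℂ) ω B] [T2Space B]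

section

variable (hsub : Manifold.IsSubmersion 𝓘(ℂ, (Fin m → ℂ) × (Fin n → ℂ)) 𝓘(ℂ, Fin m → ℂ) ω p)
  (hφ : φ ∈ IsManifold.maximalAtlas 𝓘(ℂ, Fin m → ℂ) ω B)
include hsub hφ

lemma SmoothOver.continuousAt {f : X → ℂ} (hf : SmoothOver (n := n) p φ f) {x : X}
    (hx : p x ∈ φ.source) : ContinuousAt f x := by
  obtain ⟨c, hc, hxc⟩ := exists_fibredChart hsub x hφ hx
  have h1 : ContinuousAt (fun y => f (c.total.symm y)) (c.total x) :=
    ((hf c hc).contDiffAt (c.dom.isOpen.mem_nhds (c.total.map_source hxc))).continuousAt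
  have h2 : ContinuousAt (fun z => f (c.total.symm (c.total z))) x :=
    h1.comp (f := c.total) (c.total.continuousAt hxc)
  refine h2.congr ?_
  filter_upwards [c.total.open_source.mem_nhds hxc] with z hz
  rw [c.total.left_inv hz]

lemma SmoothOver.integrable (hΩ : IsPoissonKahlerForm p Ω) (hp : IsProperMap p) {f : X → ℂ}
    (hf : SmoothOver (n := n) p φ f) {t : B} (ht : t ∈ φ.source) :
    Integrable f (fibreMeasure p Ω t) := by
  have : IsFiniteMeasure (fibreMeasure p Ω t) := ⟨fibreMeasure_lt_top hΩ hp hsub t⟩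
  have hc : ContinuousOn f (p ⁻¹' {t}) := fun x hx =>
    (hf.continuousAt hsub hφ (by rw [show p x = t from hx]; exact ht)).continuousWithinAt
  have h1 : IntegrableOn f (p ⁻¹' {t}) (fibreMeasure p Ω t) :=
    hc.integrableOn_compact (hp.isCompact_preimage isCompact_singleton)
  rwa [IntegrableOn, Measure.restrict_eq_self_of_ae_mem] at h1
  exact ae_fibreMeasure_proj hp.continuous t

end

variable (hsub : Manifold.IsSubmersion 𝓘(ℂ, (Fin m → ℂ) × (Fin n → ℂ)) 𝓘(ℂ, Fin m → ℂ) ω p)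
  (hφ : φ ∈ IsManifold.maximalAtlas 𝓘(ℂ, Fin m → ℂ) ω B)
  (hΩ : IsPoissonKahlerForm p Ω) (hp : IsProperMap p)

include hp in
lemma fibreIntegral_congr {f g : X → ℂ} {y : Fin m → ℂ}
    (h : ∀ x, p x = φ.symm y → f x = g x) :
    fibreIntegral p Ω φ f y = fibreIntegral p Ω φ g y := by
  refine integral_congr_ae ?_
  filter_upwards [ae_fibreMeasure_proj hp.continuous (φ.symm y)] with x hx
  exact h x hx

include hsub hφ hΩ hp

lemma fibreIntegral_add {f g : X → ℂ} (hf : SmoothOver (n := n) p φ f)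
    (hg : SmoothOver (n := n) p φ g) {y : Fin m → ℂ} (hy : y ∈ φ.target) :
    fibreIntegral p Ω φ (f + g) y = fibreIntegral p Ω φ f y + fibreIntegral p Ω φ g y :=
  integral_add (hf.integrable hsub hφ hΩ hp (φ.map_target hy))
    (hg.integrable hsub hφ hΩ hp (φ.map_target hy))

lemma TransportAt.add {f g : X → ℂ} (hf : SmoothOver (n := n) p φ f)
    (hg : SmoothOver (n := n) p φ g) {y : Fin m → ℂ} (hy : y ∈ φ.target)
    (h1 : TransportAt p Ω φ y f) (h2 : TransportAt p Ω φ y g) : TransportAt p Ω φ y (f + g) := by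
  have h3 : fibreIntegral p Ω φ (f + g) =ᶠ[nhds y] fibreIntegral p Ω φ f + fibreIntegral p Ω φ g := by
    filter_upwards [φ.open_target.mem_nhds hy] with z hz
    exact fibreIntegral_add hsub hφ hΩ hp hf hg hz
  refine ⟨(h1.1.add h2.1).congr_of_eventuallyEq h3, fun l => ?_⟩
  rw [wirt_congr h3, wirt_add h1.1 h2.1, h1.2, h2.2,
    ← fibreIntegral_add hsub hφ hΩ hp (hf.hder hΩ l) (hg.hder hΩ l) hy]
  refine fibreIntegral_congr hp fun x hx => ?_
  obtain ⟨c, rfl, hxc⟩ := exists_fibredChart hsub x hφ (by rw [hx]; exact φ.map_target hy)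
  have hyc : c.total x ∈ c.dom := c.total.map_source hxc
  rw [Pi.add_apply, ← c.total.left_inv hxc, hder_eq_wirt hΩ c hyc (hf.differentiableAt c rfl hyc),
    hder_eq_wirt hΩ c hyc (hg.differentiableAt c rfl hyc),
    hder_eq_wirt hΩ c hyc ((hf.add hg).differentiableAt c rfl hyc),
    ← wirt_add (hf.differentiableAt c rfl hyc) (hg.differentiableAt c rfl hyc)]
  rfl

lemma TransportAt.of_eventually_zero {f : X → ℂ} (hf : SmoothOver (n := n) p φ f) {y : Fin m → ℂ}
    (hy : y ∈ φ.target) {N : Set B} (hN : IsOpen N) (hyN : φ.symm y ∈ N)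
    (h : ∀ x, p x ∈ N → f x = 0) : TransportAt p Ω φ y f := by
  have h0 : ∀ z, φ.symm z ∈ N → fibreIntegral p Ω φ f z = 0 := by
    intro z hz
    rw [fibreIntegral_congr (g := fun _ => 0) hp fun x hx => h x (by rwa [hx])]
    simp [fibreIntegral]
  have h1 : fibreIntegral p Ω φ f =ᶠ[nhds y] fun _ => 0 := by
    filter_upwards [(φ.continuousAt_symm hy).preimage_mem_nhds (hN.mem_nhds hyN)] with z hz
    exact h0 z hz
  refine ⟨(differentiableAt_const _).congr_of_eventuallyEq h1, fun l => ?_⟩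
  rw [wirt_congr h1, fibreIntegral_congr (g := fun _ => 0) hp]
  · simp [wirt, fibreIntegral]
  · intro x hx
    obtain ⟨c, rfl, hxc⟩ := exists_fibredChart hsub x hφ (by rw [hx]; exact φ.map_target hy)
    have hyc : c.total x ∈ c.dom := c.total.map_source hxc
    have h2 : (fun z => f (c.total.symm z)) =ᶠ[nhds (c.total x)] fun _ => 0 := by
      have h3 : ContinuousAt (fun z => p (c.total.symm z)) (c.total x) :=
        hp.continuous.continuousAt.comp (c.total.continuousAt_symm hyc)
      filter_upwards [h3.preimage_mem_nhds (hN.mem_nhds (by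
        rw [c.total.left_inv hxc, hx]; exact hyN))] with z hz
      exact h _ hz
    rw [← c.total.left_inv hxc, hder_eq_wirt hΩ c hyc (hf.differentiableAt c rfl hyc),
      wirt_congr h2]
    simp [wirt]

lemma TransportAt.of_compact {f : X → ℂ} (hf : SmoothOver (n := n) p φ f) {y : Fin m → ℂ}
    (hy : y ∈ φ.target) (c : FibredChart (m := m) (n := n) p) (hc : c.base = φ) {K : Set X}
    (hK : IsCompact K) (hKc : K ⊆ c.total.source) (h : ∀ x ∉ K, f x = 0) :
    TransportAt p Ω φ y f := by
  subst hc
  have hcs : SmoothRing.CompactSupp (hf.ring c rfl) := by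
    refine ⟨c.total '' K, hK.image_of_continuousOn (c.total.continuousOn.mono hKc), ?_, ?_⟩
    · rintro _ ⟨x, hx, rfl⟩; exact c.total.map_source (hKc hx)
    · intro z hz
      by_cases hzd : z ∈ c.dom
      · rw [hf.fn_ring c rfl hzd]
        exact h _ fun hk => hz ⟨_, hk, c.total.right_inv hzd⟩
      · simp [SmoothRing.fn, extendZero, hzd]
  have h1 : ∀ z ∈ c.base.target, fibreIntegral p Ω c.base f z
      = 2 ^ n * (hΩ.isLocal c).localIntegral (hf.ring c rfl) z := by
    intro z hz
    have := integral_fibreMeasure_eq hΩ c (c.base.map_target hz)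
      (fun x hx => h x fun hk => hx (hKc hk)) (hf.ring c rfl) fun y hy => (hf.fn_ring c rfl hy).symm
    rwa [c.base.right_inv hz] at this
  have h2 : fibreIntegral p Ω c.base f =ᶠ[nhds y]
      (fun _ => 2 ^ n) * (hΩ.isLocal c).localIntegral (hf.ring c rfl) := by
    filter_upwards [c.base.open_target.mem_nhds hy] with z hz
    exact h1 z hz
  have h3 := (hΩ.isLocal c).differentiable_localIntegral hcs y
  refine ⟨((differentiableAt_const _).mul h3).congr_of_eventuallyEq h2, fun l => ?_⟩
  have h4 : fibreIntegral p Ω c.base (hder p Ω c.base l f) y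
      = 2 ^ n * (hΩ.isLocal c).localIntegral ((hΩ.isLocal c).calculus.V l (hf.ring c rfl)) y := by
    have hg : ∀ x ∉ c.total.source, (c.total.source.indicator (hder p Ω c.base l f)) x = 0 :=
      fun x hx => Set.indicator_of_notMem hx _
    have := integral_fibreMeasure_eq hΩ c (c.base.map_target hy) hg
      ((hΩ.isLocal c).calculus.V l (hf.ring c rfl)) fun y hy => by
        rw [Set.indicator_of_mem (c.total.map_target hy)]
        exact hder_eq hΩ c rfl hf hy l
    rw [c.base.right_inv hy] at this
    rw [← this]
    refine fibreIntegral_congr hp fun x hx => ?_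
    by_cases hxc : x ∈ c.total.source
    · rw [Set.indicator_of_mem hxc]
    · rw [Set.indicator_of_notMem hxc]
      obtain ⟨c', hc', hxc'⟩ := exists_fibredChart hsub x hφ (by rw [hx]; exact c.base.map_target hy)
      have hyc : c'.total x ∈ c'.dom := c'.total.map_source hxc'
      have h5 : (fun z => f (c'.total.symm z)) =ᶠ[nhds (c'.total x)] fun _ => 0 := by
        filter_upwards [(c'.total.continuousAt_symm hyc).preimage_mem_nhds
          (hK.isClosed.isOpen_compl.mem_nhds (by
            rw [c'.total.left_inv hxc']; exact fun hk => hxc (hKc hk)))] with z hz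
        exact h _ hz
      rw [← hc', ← c'.total.left_inv hxc',
        hder_eq_wirt hΩ c' hyc (hf.differentiableAt c' hc' hyc), wirt_congr h5]
      simp [wirt]
  rw [wirt_congr h2, wirt_mul (differentiableAt_const _) h3, h4,
    (hΩ.isLocal c).wirt_localIntegral hcs]
  simp [wirt]

/-- Fibre integrals over the compact fibres of a proper submersion are differentiated by
differentiating the integrand along horizontal lifts. -/
lemma transportAt {f : X → ℂ} (hf : SmoothOver (n := n) p φ f) {y : Fin m → ℂ}
    (hy : y ∈ φ.target) : TransportAt p Ω φ y f := by
  classical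
  set t := φ.symm y
  have ht : t ∈ φ.source := φ.map_target hy
  have hex : ∀ x : p ⁻¹' {t}, ∃ c : FibredChart (m := m) (n := n) p, c.base = φ ∧
      ∃ b : X → ℂ, SmoothOver (n := n) p φ b ∧ (∀ᶠ z in nhds x.1, b z = 1) ∧
      ∃ K : Set X, IsCompact K ∧ K ⊆ c.total.source ∧ ∀ z ∉ K, b z = 0 := by
    intro x
    obtain ⟨c, hc, hxc⟩ := exists_fibredChart hsub x.1 hφ (by rw [show p x.1 = t from x.2]; exact ht)
    exact ⟨c, hc, exists_bump c hxc⟩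
  choose c hc b hb hb1 K hK hKc hb0 using hex
  obtain ⟨s, hs⟩ := (hp.isCompact_preimage (isCompact_singleton (x := t))).elim_finite_subcover
    (fun x : p ⁻¹' {t} => interior {z | b x z = 1}) (fun x => isOpen_interior)
    (fun x hx => Set.mem_iUnion.2 ⟨⟨x, hx⟩, mem_interior_iff_mem_nhds.2 (hb1 ⟨x, hx⟩)⟩)
  -- as `p` is closed, the bump functions are equal to `1` near the neighbouring fibres too
  set O : Set X := ⋃ x ∈ s, interior {z | b x z = 1}
  have hO : IsOpen O := isOpen_biUnion fun _ _ => isOpen_interior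
  set N : Set B := (p '' Oᶜ)ᶜ
  have hN : IsOpen N := (hp.isClosedMap _ hO.isClosed_compl).isOpen_compl
  have htN : t ∈ N := by
    rintro ⟨x, hx, hxt⟩
    exact hx (hs hxt)
  have hNO : ∀ x, p x ∈ N → x ∈ O := fun x hx => by
    by_contra h
    exact hx ⟨x, h, rfl⟩
  have key : ∀ (s : Finset (p ⁻¹' {t})) (g : X → ℂ), SmoothOver (n := n) p φ g →
      (∀ x, p x ∈ N → (∀ i ∈ s, b i x ≠ 1) → g x = 0) → TransportAt p Ω φ y g := by
    intro s
    induction s using Finset.induction_on with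
    | empty =>
      intro g hg h
      exact TransportAt.of_eventually_zero hsub hφ hΩ hp hg hy hN htN fun x hx => h x hx (by simp)
    | insert a s ha ih =>
      intro g hg h
      have h1 : g = g * b a + g * (1 - b a) := by ring
      rw [h1]
      refine TransportAt.add hsub hφ hΩ hp (hg.mul (hb a)) (hg.mul (hb a).one_sub) hy ?_ ?_
      · refine TransportAt.of_compact hsub hφ hΩ hp (hg.mul (hb a)) hy (c a) (hc a) (hK a) (hKc a) ?_
        intro x hx
        rw [Pi.mul_apply, hb0 a x hx, mul_zero]
      · refine ih _ (hg.mul (hb a).one_sub) fun x hx hxs => ?_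
        rw [Pi.mul_apply, Pi.sub_apply, Pi.one_apply]
        by_cases hba : b a x = 1
        · rw [hba, sub_self, mul_zero]
        · rw [h x hx, zero_mul]
          intro i hi
          rcases Finset.mem_insert.1 hi with rfl | hi
          · exact hba
          · exact hxs i hi
  refine key s f hf fun x hx hxs => ?_
  obtain ⟨i, hi, hxi⟩ := Set.mem_iUnion₂.1 (hNO x hx)
  exact absurd (interior_subset (s := {z | b i z = 1}) hxi) (hxs i hi)

end Transport

section FibreIntegral

set_option linter.unusedSectionVars false

variable {m n : ℕ}
variable {X : Type*} [TopologicalSpace X] [ChartedSpace ((Fin m → ℂ) × (Fin n → ℂ)) X]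
variable {B : Type*} [TopologicalSpace B] [ChartedSpace (Fin m → ℂ) B]
variable {p : X → B} {Ω : TwoForm ((Fin m → ℂ) × (Fin n → ℂ)) X}
  {φ : OpenPartialHomeomorph B (Fin m → ℂ)}
variable [MeasurableSpace X]
variable [BorelSpace X] [T2Space X] [IsManifold 𝓘(ℂ, (Fin m → ℂ) × (Fin n → ℂ)) ω X]
  [IsManifold 𝓘(ℂ, Fin m → ℂ) ω B] [T2Space B]

lemma wirt_eq_sum (F : (Fin m → ℂ) → ℂ) (u y : Fin m → ℂ) :
    wirt u F y = ∑ l, u l * wirt (Pi.single l 1) F y := by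
  rw [← wirt_dir_sum]
  congr 1
  conv_lhs => rw [pi_eq_sum_univ' u]

lemma star_fibreIntegral (f : X → ℂ) (y : Fin m → ℂ) :
    star (fibreIntegral p Ω φ f y) = fibreIntegral p Ω φ (fun x => star (f x)) y :=
  integral_conj.symm

variable (hsub : Manifold.IsSubmersion 𝓘(ℂ, (Fin m → ℂ) × (Fin n → ℂ)) 𝓘(ℂ, Fin m → ℂ) ω p)
  (hφ : φ ∈ IsManifold.maximalAtlas 𝓘(ℂ, Fin m → ℂ) ω B)
  (hΩ : IsPoissonKahlerForm p Ω) (hp : IsProperMap p)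
include hsub hφ hΩ hp

lemma wirt_fibreIntegral {f : X → ℂ} (hf : SmoothOver (n := n) p φ f) {y : Fin m → ℂ}
    (hy : y ∈ φ.target) (u : Fin m → ℂ) :
    wirt u (fibreIntegral p Ω φ f) y = ∑ l, u l * fibreIntegral p Ω φ (hder p Ω φ l f) y := by
  rw [wirt_eq_sum]
  simp only [(transportAt hsub hφ hΩ hp hf hy).2]

lemma wirtBar_fibreIntegral {f : X → ℂ} (hf : SmoothOver (n := n) p φ f) {y : Fin m → ℂ}
    (hy : y ∈ φ.target) (u : Fin m → ℂ) :
    wirtBar u (fibreIntegral p Ω φ f) y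
      = ∑ l, star (u l) *
        fibreIntegral p Ω φ (fun x => star (hder p Ω φ l (fun x => star (f x)) x)) y := by
  have h1 : fibreIntegral p Ω φ f
      = fun z => star (fibreIntegral p Ω φ (fun x => star (f x)) z) := by
    ext z
    rw [star_fibreIntegral]
    simp
  have h2 := wirt_fibreIntegral hsub hφ hΩ hp hf.conj hy u
  rw [h1]
  have h3 := star_wirt u (fibreIntegral p Ω φ fun x => star (f x)) y
  refine h3.symm.trans ?_
  rw [h2, star_sum]
  refine Finset.sum_congr rfl fun l _ => ?_
  rw [star_mul', star_fibreIntegral]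

/-- Fibre integrals of smooth functions are smooth: their derivatives are combinations of fibre
integrals of smooth functions. -/
lemma contDiffOn_fibreIntegral {f : X → ℂ} (hf : SmoothOver (n := n) p φ f) :
    ContDiffOn ℝ ∞ (fibreIntegral p Ω φ f) φ.target := by
  rw [contDiffOn_infty]
  intro k
  induction k generalizing f with
  | zero =>
    rw [Nat.cast_zero, contDiffOn_zero]
    exact fun y hy => (transportAt hsub hφ hΩ hp hf hy).1.continuousAt.continuousWithinAt
  | succ k ih =>
    rw [Nat.cast_add, Nat.cast_one, contDiffOn_succ_iff_fderiv_of_isOpen φ.open_target]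
    refine ⟨fun y hy => (transportAt hsub hφ hΩ hp hf hy).1.differentiableWithinAt,
      fun h => by simp at h, ?_⟩
    rw [contDiffOn_clm_apply]
    intro u
    have h1 : ContDiffOn ℝ k (fun y => (∑ l, u l * fibreIntegral p Ω φ (hder p Ω φ l f) y)
        + ∑ l, star (u l) *
        fibreIntegral p Ω φ (fun x => star (hder p Ω φ l (fun x => star (f x)) x)) y) φ.target := by
      refine ContDiffOn.add (ContDiffOn.sum fun l _ => ?_) (ContDiffOn.sum fun l _ => ?_)
      · exact contDiffOn_const.mul (ih (hf.hder hΩ l))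
      · exact contDiffOn_const.mul (ih (hf.conj.hder hΩ l).conj)
    refine h1.congr fun y hy => ?_
    rw [fderiv_eq_wirt, wirt_fibreIntegral hsub hφ hΩ hp hf hy,
      wirtBar_fibreIntegral hsub hφ hΩ hp hf hy]

end FibreIntegral

/-! ### The Weil–Petersson pairing in coordinates -/

section Pairing

open scoped ComplexOrder

set_option linter.unusedSectionVars false

variable {m n : ℕ}
variable {X : Type*} [TopologicalSpace X] [ChartedSpace ((Fin m → ℂ) × (Fin n → ℂ)) X]
variable {B : Type*} [TopologicalSpace B] [ChartedSpace (Fin m → ℂ) B]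
variable {p : X → B} {Ω : TwoForm ((Fin m → ℂ) × (Fin n → ℂ)) X}
  {φ : OpenPartialHomeomorph B (Fin m → ℂ)}
variable [IsManifold 𝓘(ℂ, (Fin m → ℂ) × (Fin n → ℂ)) ω X] [IsManifold 𝓘(ℂ, Fin m → ℂ) ω B]

/-- The pointwise inner products `⟨κ_j, κ_k⟩` of the Kodaira–Spencer tensors of the coordinate
fields of `φ`, as functions on the total space. -/
def kfun (p : X → B) (Ω : TwoForm ((Fin m → ℂ) × (Fin n → ℂ)) X)
    (φ : OpenPartialHomeomorph B (Fin m → ℂ)) (j k : Fin m) (x : X) : ℂ :=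
  kappaInner p Ω (p x) (coordVec φ (p x) j) (coordVec φ (p x) k) x

/-- The derivative of `f` along the conjugate of the horizontal lift of `∂_q`. -/
def hderBar (p : X → B) (Ω : TwoForm ((Fin m → ℂ) × (Fin n → ℂ)) X)
    (φ : OpenPartialHomeomorph B (Fin m → ℂ)) (q : Fin m) (f : X → ℂ) (x : X) : ℂ :=
  star (hder p Ω φ q (fun x => star (f x)) x)

variable (hΩ : IsPoissonKahlerForm p Ω)

include hΩ

lemma SmoothOver.hderBar {f : X → ℂ} (hf : SmoothOver (n := n) p φ f) (q : Fin m) :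
    SmoothOver (n := n) p φ (hderBar p Ω φ q f) := (hf.conj.hder hΩ q).conj

lemma ring_hderBar (c : FibredChart (m := m) (n := n) p) (hc : c.base = φ) {f : X → ℂ}
    (hf : SmoothOver (n := n) p φ f) (q : Fin m) :
    (hf.hderBar hΩ q).ring c hc = (hΩ.isLocal c).calculus.Vbar q (hf.ring c hc) := by
  have h1 : hf.conj.ring c hc = star (hf.ring c hc) := rfl
  refine SmoothRing.fn_injective fun y hy => ?_
  rw [SmoothOver.fn_ring _ c hc hy, HorizontalCalculus.Vbar_def, SmoothRing.fn_star, ← h1]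
  exact congrArg star (hder_eq hΩ c hc hf.conj hy q)

lemma ksAt_single (c : FibredChart (m := m) (n := n) p) (y : c.dom) (j : Fin m) :
    ksAt hΩ c y (Pi.single j 1) = (hΩ.isLocal c).ksMatrix y j := by
  rw [ksAt, Finset.sum_eq_single j]
  · simp
  · intro b _ hb; simp [hb]
  · simp

lemma kfun_eq (c : FibredChart (m := m) (n := n) p) (hc : c.base = φ)
    {y : (Fin m → ℂ) × (Fin n → ℂ)} (hy : y ∈ c.dom) (j k : Fin m) :
    kfun p Ω φ j k (c.total.symm y) = SmoothRing.fn ((hΩ.isLocal c).calculus.f j k) y := by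
  subst hc
  rw [kfun, kappaInner_eq hΩ c hy rfl, c.dbase_coordVec (c.proj_mem hy),
    c.dbase_coordVec (c.proj_mem hy), ksAt_single, ksAt_single, ← IsLocalPoissonKahler.eval_f,
    SmoothRing.eval_eq_fn]

lemma smoothOver_kfun (j k : Fin m) : SmoothOver (n := n) p φ (kfun p Ω φ j k) := fun c hc =>
  (SmoothRing.contDiffOn_fn ((hΩ.isLocal c).calculus.f j k)).congr fun _ hy =>
    kfun_eq hΩ c hc hy j k

lemma ring_kfun (c : FibredChart (m := m) (n := n) p) (hc : c.base = φ) (j k : Fin m) :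
    (smoothOver_kfun hΩ j k).ring c hc = (hΩ.isLocal c).calculus.f j k :=
  SmoothRing.fn_injective fun _ hy => by
    rw [SmoothOver.fn_ring _ c hc hy, kfun_eq hΩ c hc hy]

variable (hsub : Manifold.IsSubmersion 𝓘(ℂ, (Fin m → ℂ) × (Fin n → ℂ)) 𝓘(ℂ, Fin m → ℂ) ω p)
  (hφ : φ ∈ IsManifold.maximalAtlas 𝓘(ℂ, Fin m → ℂ) ω B)

include hsub hφ

/-- At each point the functions `⟨κ_j, κ_k⟩` and their derivatives along horizontal lifts are traces
of products of matrices that are symmetric with respect to the fibre metric. -/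
lemma exists_matrices {x : X} (hx : p x ∈ φ.source) :
    ∃ (g : Matrix (Fin n) (Fin n) ℂ) (A : Fin m → Matrix (Fin n) (Fin n) ℂ)
      (A₂ : Fin m → Fin m → Matrix (Fin n) (Fin n) ℂ), g.PosDef ∧
      (∀ j, (A j).transpose * g = g.transpose * A j) ∧
      (∀ j l, (A₂ j l).transpose * g = g.transpose * A₂ j l) ∧
      (∀ j l, A₂ j l = A₂ l j) ∧
      (∀ j k, kfun p Ω φ j k x = (A j * cc (A k)).trace) ∧
      (∀ j k l, hder p Ω φ l (kfun p Ω φ j k) x = (A₂ j l * cc (A k)).trace) ∧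
      ∀ q l j k, hder p Ω φ l (hderBar p Ω φ q (kfun p Ω φ j k)) x
        = (A₂ j l * cc (A₂ k q)).trace + (A j * cc (A q) * A l * cc (A k)).trace
          + (A l * cc (A q) * A j * cc (A k)).trace := by
  obtain ⟨c, hc, hxc⟩ := exists_fibredChart hsub x hφ hx
  have hy : c.total x ∈ c.dom := c.total.map_source hxc
  set h := hΩ.isLocal c
  refine ⟨_, h.ksMatrix ⟨_, hy⟩, h.ksMatrix₂ ⟨_, hy⟩, h.posDef hy, h.ksMatrix_symm ⟨_, hy⟩,
    h.ksMatrix₂_symm ⟨_, hy⟩, ?_, ?_, ?_, ?_⟩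
  · intro j l
    rw [IsLocalPoissonKahler.ksMatrix₂, HorizontalCalculus.A₂_symm]; rfl
  · intro j k
    rw [← h.eval_f, SmoothRing.eval_eq_fn, ← kfun_eq hΩ c hc hy, c.total.left_inv hxc]
  · intro j k l
    rw [← h.eval_V_f, SmoothRing.eval_eq_fn, ← ring_kfun hΩ c hc, ← hder_eq hΩ c hc _ hy,
      c.total.left_inv hxc]
  · intro q l j k
    rw [← h.eval_V_Vbar_f, SmoothRing.eval_eq_fn, ← ring_kfun hΩ c hc, ← ring_hderBar hΩ c hc,
      ← hder_eq hΩ c hc _ hy, c.total.left_inv hxc]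

lemma kappaInner_eq_sesq {t : B} (ht : t ∈ φ.source) (ξ η : TangentSpace 𝓘(ℂ, Fin m → ℂ) t) {x : X}
    (hx : p x = t) :
    kappaInner p Ω t ξ η x = sesq (fun j k => kfun p Ω φ j k x)
      (mfderiv 𝓘(ℂ, Fin m → ℂ) 𝓘(ℂ, Fin m → ℂ) φ t ξ)
      (mfderiv 𝓘(ℂ, Fin m → ℂ) 𝓘(ℂ, Fin m → ℂ) φ t η) := by
  obtain ⟨c, rfl, hxc⟩ := exists_fibredChart hsub x hφ (by rwa [hx])
  have hy : c.total x ∈ c.dom := c.total.map_source hxc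
  have h1 := kappaInner_eq hΩ c hy (t := t) (by rwa [c.total.left_inv hxc]) ξ η
  rw [c.total.left_inv hxc] at h1
  rw [h1, ksAt, ksAt, trace_mul_cc_sum]
  refine Finset.sum_congr rfl fun j _ => Finset.sum_congr rfl fun k _ => ?_
  have h2 := kfun_eq hΩ c rfl hy j k
  rw [← SmoothRing.eval_eq_fn _ hy, IsLocalPoissonKahler.eval_f, c.total.left_inv hxc] at h2
  exact congrArg (fun z : ℂ => c.dbase t ξ j * star (c.dbase t η k) * z) h2.symm

/-- If `⟨κ_ξ, κ_ξ⟩` vanishes at a point of the fibre, then so does `κ_ξ`. -/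
lemma kappa_eq_kappa_zero {t : B} (ht : t ∈ φ.source) (ξ : TangentSpace 𝓘(ℂ, Fin m → ℂ) t) {x : X}
    (hx : p x = t) (h0 : kappaInner p Ω t ξ ξ x = 0)
    {w : TangentSpace 𝓘(ℂ, (Fin m → ℂ) × (Fin n → ℂ)) x}
    (hw : w ∈ vert (E := (Fin m → ℂ) × (Fin n → ℂ)) (F := Fin m → ℂ) p x) :
    kappa p Ω t ξ x w = kappa p Ω t (0 : TangentSpace 𝓘(ℂ, Fin m → ℂ) t) x w := by
  obtain ⟨c, rfl, hxc⟩ := exists_fibredChart hsub x hφ (by rwa [hx])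
  obtain ⟨y, hy, rfl⟩ : ∃ y ∈ c.dom, c.total.symm y = x :=
    ⟨c.total x, c.total.map_source hxc, c.total.left_inv hxc⟩
  rw [kappaInner_eq hΩ c hy hx] at h0
  have h1 : ksAt hΩ c ⟨y, hy⟩ (c.dbase t ξ) = 0 :=
    eq_zero_of_trace_mul_cc ((hΩ.isLocal c).posDef hy)
      (symm_sum _ _ ((hΩ.isLocal c).ksMatrix_symm ⟨y, hy⟩)) h0
  obtain ⟨a, rfl⟩ := c.exists_dsymm_of_mem_vert hy hw
  have h2 : ksAt hΩ c ⟨y, hy⟩ (c.dbase t 0) = 0 := by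
    have : c.dbase t (0 : TangentSpace 𝓘(ℂ, Fin m → ℂ) t) = 0 :=
      map_zero _
    rw [this, ksAt]
    simp
  rw [kappa_eq hΩ c hy hx, kappa_eq hΩ c hy hx, h1, h2]

end Pairing

/-! ### Integral inequalities over the fibres -/

section Integrals

open scoped ComplexOrder

lemma sq_integral_le {α : Type*} [MeasurableSpace α] {μ : Measure α} [IsFiniteMeasure μ] {k : α → ℝ}
    (hk : Integrable k μ) (hk2 : Integrable (fun x => k x ^ 2) μ) :
    (∫ x, k x ∂μ) ^ 2 ≤ μ.real Set.univ * ∫ x, k x ^ 2 ∂μ := by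
  have key : ∀ c : ℝ, 0 ≤ μ.real Set.univ * (c * c) + (-2 * ∫ x, k x ∂μ) * c + ∫ x, k x ^ 2 ∂μ := by
    intro c
    have h1 : 0 ≤ ∫ x, (k x - c) ^ 2 ∂μ := integral_nonneg fun x => sq_nonneg _
    have h2 : ∀ x, (k x - c) ^ 2 = k x ^ 2 - (2 * c) * k x + c ^ 2 := fun x => by ring
    have h3 : Integrable (fun x => k x ^ 2 - (2 * c) * k x) μ := hk2.sub (hk.const_mul _)
    simp only [h2] at h1
    rw [integral_add h3 (integrable_const _), integral_sub hk2 (hk.const_mul _),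
      integral_const_mul, integral_const, smul_eq_mul] at h1
    linarith
  have h := discrim_le_zero key
  rw [discrim] at h
  linarith

set_option linter.unusedSectionVars false

variable {m n : ℕ}
variable {X : Type*} [TopologicalSpace X] [ChartedSpace ((Fin m → ℂ) × (Fin n → ℂ)) X]
variable {B : Type*} [TopologicalSpace B] [ChartedSpace (Fin m → ℂ) B]
variable {p : X → B} {Ω : TwoForm ((Fin m → ℂ) × (Fin n → ℂ)) X}
  {φ : OpenPartialHomeomorph B (Fin m → ℂ)}

namespace SmoothOver

lemma const (z : ℂ) : SmoothOver (n := n) p φ (fun _ => z) := fun _ _ => contDiffOn_const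

lemma const_mul {f : X → ℂ} (hf : SmoothOver (n := n) p φ f) (z : ℂ) :
    SmoothOver (n := n) p φ (fun x => z * f x) := fun c hc => contDiffOn_const.mul (hf c hc)

lemma sum {ι : Type*} [Fintype ι] {f : ι → X → ℂ} (hf : ∀ i, SmoothOver (n := n) p φ (f i)) :
    SmoothOver (n := n) p φ (fun x => ∑ i, f i x) := fun c hc =>
  ContDiffOn.sum fun i _ => hf i c hc

lemma ofReal_re {f : X → ℂ} (hf : SmoothOver (n := n) p φ f) :
    SmoothOver (n := n) p φ (fun x => ((f x).re : ℂ)) := fun c hc =>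
  (Complex.ofRealCLM.comp Complex.reCLM).contDiff.comp_contDiffOn (hf c hc)

end SmoothOver

variable [MeasurableSpace X]
variable [BorelSpace X] [T2Space X] [IsManifold 𝓘(ℂ, (Fin m → ℂ) × (Fin n → ℂ)) ω X]
  [IsManifold 𝓘(ℂ, Fin m → ℂ) ω B] [T2Space B]
variable (hsub : Manifold.IsSubmersion 𝓘(ℂ, (Fin m → ℂ) × (Fin n → ℂ)) 𝓘(ℂ, Fin m → ℂ) ω p)
  (hφ : φ ∈ IsManifold.maximalAtlas 𝓘(ℂ, Fin m → ℂ) ω B)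
  (hΩ : IsPoissonKahlerForm p Ω) (hp : IsProperMap p)
include hsub hφ hΩ hp

lemma fibreIntegral_sum {ι : Type*} [Fintype ι] (z : ι → ℂ) {f : ι → X → ℂ}
    (hf : ∀ i, SmoothOver (n := n) p φ (f i)) {y : Fin m → ℂ} (hy : y ∈ φ.target) :
    fibreIntegral p Ω φ (fun x => ∑ i, z i * f i x) y = ∑ i, z i * fibreIntegral p Ω φ (f i) y := by
  rw [fibreIntegral, integral_finsetSum]
  · simp only [integral_const_mul]; rfl
  · exact fun i _ => ((hf i).integrable hsub hφ hΩ hp (φ.map_target hy)).const_mul _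

lemma fibreIntegral_sesq {f : Fin m → Fin m → X → ℂ}
    (hf : ∀ i j, SmoothOver (n := n) p φ (f i j)) (a b : Fin m → ℂ) {y : Fin m → ℂ}
    (hy : y ∈ φ.target) :
    fibreIntegral p Ω φ (fun x => sesq (fun j k => f j k x) a b) y
      = sesq (fun j k => fibreIntegral p Ω φ (f j k) y) a b := by
  have h := fibreIntegral_sum hsub hφ hΩ hp (ι := Fin m × Fin m) (fun i => a i.1 * star (b i.2))
    (f := fun i => f i.1 i.2) (fun i => hf _ _) hy
  simp only [Fintype.sum_prod_type] at h
  exact h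

lemma re_fibreIntegral {f : X → ℂ} (hf : SmoothOver (n := n) p φ f) {y : Fin m → ℂ}
    (hy : y ∈ φ.target) :
    (fibreIntegral p Ω φ f y).re = ∫ x, (f x).re ∂(fibreMeasure p Ω (φ.symm y)) :=
  (Complex.reCLM.integral_comp_comm (hf.integrable hsub hφ hΩ hp (φ.map_target hy))).symm

/-- A smooth function with non-negative real part along a fibre whose integral over the fibre
vanishes has vanishing real part along the fibre: the fibre measure has full support. -/
lemma re_eq_zero_of_integral {f : X → ℂ} (hf : SmoothOver (n := n) p φ f) {y : Fin m → ℂ}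
    (hy : y ∈ φ.target) (h0 : ∀ x, p x = φ.symm y → 0 ≤ (f x).re)
    (hint : (fibreIntegral p Ω φ f y).re = 0) {x : X} (hx : p x = φ.symm y) : (f x).re = 0 := by
  by_contra hne
  set t := φ.symm y
  have ht : t ∈ φ.source := φ.map_target hy
  rw [re_fibreIntegral hsub hφ hΩ hp hf hy, integral_eq_zero_iff_of_nonneg_ae
    (by filter_upwards [ae_fibreMeasure_proj hp.continuous t] with x hx using h0 x hx)
    (show Integrable (fun x => (f x).re) _ from (hf.integrable hsub hφ hΩ hp ht).re)] at hint
  obtain ⟨c, rfl, hxc⟩ := exists_fibredChart hsub x hφ (by rwa [hx])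
  have hcont : ContinuousOn (fun z => (f z).re) c.total.source := fun z hz =>
    (Complex.continuous_re.continuousAt.comp
      (hf.continuousAt hsub hφ (c.map_source z hz))).continuousWithinAt
  set U : Set X := c.total.source ∩ (fun z => (f z).re) ⁻¹' {0}ᶜ
  have hU : IsOpen U := hcont.isOpen_inter_preimage c.total.open_source isOpen_compl_singleton
  have hxU : x ∈ U := ⟨hxc, hne⟩
  have h1 : chartMeasure Ω c t U = 0 := by
    refine le_antisymm ((chartMeasure_le c t U).trans ?_) zero_le
    refine le_of_eq (measure_mono_null (fun z hz => ?_) hint)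
    exact hz.2
  rw [chartMeasure_apply c t hU.measurableSet] at h1
  set S := c.param t ⁻¹' U ∩ c.domain t
  have hS : IsOpen S := by
    rw [show S = c.domain t ∩ c.param t ⁻¹' U from Set.inter_comm _ _]
    exact (c.continuousOn_param t).isOpen_inter_preimage (c.isOpen_domain t) hU
  have hne' : S.Nonempty := by
    refine ⟨(c.total x).2, ?_, ?_⟩
    · change c.param t (c.total x).2 ∈ U
      rw [← hx, c.param_snd hxc]; exact hxU
    · rw [← hx]; exact c.snd_mem_domain hxc
  have hmeas : AEMeasurable (fun ζ => ENNReal.ofReal (c.density Ω t ζ)) (volume.restrict S) :=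
    (((continuousOn_density hΩ c t).mono Set.inter_subset_right).aemeasurable
      hS.measurableSet).ennreal_ofReal
  rw [lintegral_eq_zero_iff' hmeas] at h1
  have h2 : ∀ᵐ ζ ∂(volume.restrict S), False := by
    filter_upwards [h1, ae_restrict_mem hS.measurableSet] with ζ hζ hζS
    exact (ENNReal.ofReal_pos.2 (density_pos hΩ c hζS.2)).ne' hζ
  have h3 : volume S = 0 := by
    rw [← Measure.restrict_eq_zero, ← ae_eq_bot]
    exact Filter.eventually_false_iff_eq_bot.1 h2
  exact (hS.measure_pos volume hne').ne' h3

/-- The volume of the fibres is locally constant, since the horizontal derivative of the constant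
function `1` vanishes. -/
lemma fderiv_fibreIntegral_one {y : Fin m → ℂ} (hy : y ∈ φ.target) :
    fderiv ℝ (fibreIntegral p Ω φ fun _ => 1) y = 0 := by
  have h0 : ∀ l x, hder p Ω φ l (fun _ => 1) x = 0 := by
    intro l x
    have h1 : ∀ u y : (Fin m → ℂ) × (Fin n → ℂ), wirt u (fun _ => (1 : ℂ)) y = 0 := by simp [wirt]
    exact h1 _ _
  have h1 := SmoothOver.const (m := m) (n := n) (p := p) (φ := φ) 1
  ext u
  rw [fderiv_eq_wirt, wirt_fibreIntegral hsub hφ hΩ hp h1 hy,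
    wirtBar_fibreIntegral hsub hφ hΩ hp h1 hy]
  simp [h0, fibreIntegral]

end Integrals

section Volume

variable {m n : ℕ}
variable {X : Type*} [TopologicalSpace X] [ChartedSpace ((Fin m → ℂ) × (Fin n → ℂ)) X]
variable {B : Type*} [TopologicalSpace B] [ChartedSpace (Fin m → ℂ) B]
variable {p : X → B} {Ω : TwoForm ((Fin m → ℂ) × (Fin n → ℂ)) X}
variable [MeasurableSpace X]
variable [BorelSpace X] [T2Space X] [IsManifold 𝓘(ℂ, (Fin m → ℂ) × (Fin n → ℂ)) ω X]
  [IsManifold 𝓘(ℂ, Fin m → ℂ) ω B] [T2Space B]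

lemma isLocallyConstant_fibreVolume
    (hsub : Manifold.IsSubmersion 𝓘(ℂ, (Fin m → ℂ) × (Fin n → ℂ)) 𝓘(ℂ, Fin m → ℂ) ω p)
    (hΩ : IsPoissonKahlerForm p Ω) (hp : IsProperMap p) : IsLocallyConstant (fibreVolume p Ω) := by
  rw [IsLocallyConstant.iff_eventually_eq]
  intro t
  set φ := chartAt (Fin m → ℂ) t
  have hφ : φ ∈ IsManifold.maximalAtlas 𝓘(ℂ, Fin m → ℂ) ω B := IsManifold.chart_mem_maximalAtlas _
  have ht : t ∈ φ.source := mem_chart_source _ _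
  obtain ⟨r, hr, hball⟩ := Metric.isOpen_iff.1 φ.open_target (φ t) (φ.map_source ht)
  have h1 : ∀ y ∈ φ.target, DifferentiableAt ℝ (fibreIntegral p Ω φ fun _ => 1) y := fun y hy =>
    (transportAt hsub hφ hΩ hp (SmoothOver.const 1) hy).1
  have hv : ∀ s ∈ φ.source, fibreIntegral p Ω φ (fun _ => 1) (φ s) = fibreVolume p Ω s := by
    intro s hs
    simp [fibreIntegral, φ.left_inv hs, fibreVolume]
  filter_upwards [φ.open_source.mem_nhds ht,
    (φ.continuousAt ht).preimage_mem_nhds (Metric.ball_mem_nhds _ hr)] with s hs hsb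
  have h2 := (convex_ball (φ t) r).is_const_of_fderivWithin_eq_zero (𝕜 := ℝ)
    (fun y hy => (h1 y (hball hy)).differentiableWithinAt)
    (fun y hy => by
      rw [fderivWithin_of_isOpen Metric.isOpen_ball hy,
        fderiv_fibreIntegral_one hsub hφ hΩ hp (hball hy)])
    (show φ s ∈ Metric.ball (φ t) r from hsb) (Metric.mem_ball_self hr)
  rw [hv s hs, hv t ht] at h2
  exact_mod_cast h2

end Volume

/-! ### The matrix of the Weil–Petersson metric -/

section Metric

open scoped ComplexOrder

set_option linter.unusedSectionVars false

lemma star_trace_mul_cc {κ : Type*} [Fintype κ] (A B : Matrix κ κ ℂ) :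
    star (A * cc B).trace = (B * cc A).trace := by
  have h1 : star (A * cc B).trace = (cc (A * cc B)).trace := by
    simp only [Matrix.trace, star_sum]; rfl
  rw [h1, cc_mul, cc_cc, Matrix.trace_mul_comm]

variable {m n : ℕ}
variable {X : Type*} [TopologicalSpace X] [ChartedSpace ((Fin m → ℂ) × (Fin n → ℂ)) X]
variable {B : Type*} [TopologicalSpace B] [ChartedSpace (Fin m → ℂ) B]
variable {p : X → B} {Ω : TwoForm ((Fin m → ℂ) × (Fin n → ℂ)) X}
  {φ : OpenPartialHomeomorph B (Fin m → ℂ)}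
variable [MeasurableSpace X]
variable [BorelSpace X] [T2Space X] [IsManifold 𝓘(ℂ, (Fin m → ℂ) × (Fin n → ℂ)) ω X]
  [IsManifold 𝓘(ℂ, Fin m → ℂ) ω B] [T2Space B]

/-- The matrix `G_{j k̄} = ∫ ⟨κ_j, κ_k⟩` of the Weil–Petersson metric in the chart `φ`. -/
def wpMatrix (p : X → B) (Ω : TwoForm ((Fin m → ℂ) × (Fin n → ℂ)) X)
    (φ : OpenPartialHomeomorph B (Fin m → ℂ)) (y : Fin m → ℂ) : Matrix (Fin m) (Fin m) ℂ :=
  Matrix.of fun j k => fibreIntegral p Ω φ (kfun p Ω φ j k) y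

variable (hsub : Manifold.IsSubmersion 𝓘(ℂ, (Fin m → ℂ) × (Fin n → ℂ)) 𝓘(ℂ, Fin m → ℂ) ω p)
  (hφ : φ ∈ IsManifold.maximalAtlas 𝓘(ℂ, Fin m → ℂ) ω B)
  (hΩ : IsPoissonKahlerForm p Ω) (hp : IsProperMap p)
include hsub hφ hΩ hp

lemma integrable_kappaInner {t : B} (ht : t ∈ φ.source) (ξ η : TangentSpace 𝓘(ℂ, Fin m → ℂ) t) :
    Integrable (kappaInner p Ω t ξ η) (fibreMeasure p Ω t) := by
  set a : Fin m → ℂ := mfderiv 𝓘(ℂ, Fin m → ℂ) 𝓘(ℂ, Fin m → ℂ) φ t ξ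
  set b : Fin m → ℂ := mfderiv 𝓘(ℂ, Fin m → ℂ) 𝓘(ℂ, Fin m → ℂ) φ t η
  have h : SmoothOver (n := n) p φ fun x => sesq (fun j k => kfun p Ω φ j k x) a b :=
    SmoothOver.sum fun j => SmoothOver.sum fun k => (smoothOver_kfun hΩ j k).const_mul _
  refine (h.integrable hsub hφ hΩ hp ht).congr ?_
  filter_upwards [ae_fibreMeasure_proj hp.continuous t] with x hx
  exact (kappaInner_eq_sesq hΩ hsub hφ ht ξ η hx).symm

lemma donaldsonFujiki_eq {t : B} (ht : t ∈ φ.source) (ξ η : TangentSpace 𝓘(ℂ, Fin m → ℂ) t) :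
    donaldsonFujiki p Ω t ξ η = sesq (wpMatrix p Ω φ (φ t))
      (mfderiv 𝓘(ℂ, Fin m → ℂ) 𝓘(ℂ, Fin m → ℂ) φ t ξ)
      (mfderiv 𝓘(ℂ, Fin m → ℂ) 𝓘(ℂ, Fin m → ℂ) φ t η) := by
  have h := fibreIntegral_sesq hsub hφ hΩ hp (fun j k => smoothOver_kfun (φ := φ) hΩ j k)
    (mfderiv 𝓘(ℂ, Fin m → ℂ) 𝓘(ℂ, Fin m → ℂ) φ t ξ : Fin m → ℂ)
    (mfderiv 𝓘(ℂ, Fin m → ℂ) 𝓘(ℂ, Fin m → ℂ) φ t η : Fin m → ℂ) (φ.map_source ht)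
  refine Eq.trans ?_ h
  rw [fibreIntegral, φ.left_inv ht]
  refine integral_congr_ae ?_
  filter_upwards [ae_fibreMeasure_proj hp.continuous t] with x hx
  exact kappaInner_eq_sesq hΩ hsub hφ ht ξ η hx

lemma star_wpMatrix {y : Fin m → ℂ} (hy : y ∈ φ.target) (j k : Fin m) :
    star (wpMatrix p Ω φ y j k) = wpMatrix p Ω φ y k j := by
  refine (star_fibreIntegral _ _).trans (fibreIntegral_congr hp fun x hx => ?_)
  obtain ⟨g, A, A₂, -, -, -, -, h, -⟩ :=
    exists_matrices hΩ hsub hφ (x := x) (by rw [hx]; exact φ.map_target hy)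
  rw [h, h, star_trace_mul_cc]

lemma sesq_kfun_nonneg {x : X} (hx : p x ∈ φ.source) (a : Fin m → ℂ) :
    0 ≤ sesq (fun j k => kfun p Ω φ j k x) a a := by
  obtain ⟨g, A, A₂, hg, hA, -, -, h, -⟩ := exists_matrices hΩ hsub hφ hx
  have h1 : sesq (fun j k => kfun p Ω φ j k x) a a
      = ((∑ j, a j • A j) * cc (∑ j, a j • A j)).trace := by
    rw [trace_mul_cc_sum]; simp only [sesq, h]
  rw [h1]
  exact trace_mul_cc_nonneg hg (symm_sum _ _ hA)

lemma re_sesq_wpMatrix_nonneg {y : Fin m → ℂ} (hy : y ∈ φ.target) (a : Fin m → ℂ) :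
    0 ≤ (sesq (wpMatrix p Ω φ y) a a).re := by
  have h := fibreIntegral_sesq hsub hφ hΩ hp (fun j k => smoothOver_kfun (φ := φ) hΩ j k) a a hy
  have h1 : SmoothOver (n := n) p φ fun x => sesq (fun j k => kfun p Ω φ j k x) a a :=
    SmoothOver.sum fun j => SmoothOver.sum fun k => (smoothOver_kfun hΩ j k).const_mul _
  change 0 ≤ (sesq (fun j k => fibreIntegral p Ω φ (kfun p Ω φ j k) y) a a).re
  rw [← h, re_fibreIntegral hsub hφ hΩ hp h1 hy]
  refine integral_nonneg_of_ae ?_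
  filter_upwards [ae_fibreMeasure_proj hp.continuous (φ.symm y)] with x hx
  exact (Complex.le_def.1 (sesq_kfun_nonneg hsub hφ hΩ hp (by rw [hx]; exact φ.map_target hy) a)).1

/-- The Weil–Petersson metric is positive definite when the Kodaira–Spencer map is injective: if the
norm of `ξ` vanishes then so does the Kodaira–Spencer tensor of `ξ`. -/
lemma donaldsonFujiki_pos {t : B} (ht : t ∈ φ.source)
    (hKS : Function.Injective (kodairaSpencer (F := Fin m → ℂ) p Ω t))
    {ξ : TangentSpace 𝓘(ℂ, Fin m → ℂ) t} (hξ : ξ ≠ 0) : 0 < (donaldsonFujiki p Ω t ξ ξ).re := by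
  set a : Fin m → ℂ := mfderiv 𝓘(ℂ, Fin m → ℂ) 𝓘(ℂ, Fin m → ℂ) φ t ξ with ha
  have hy := φ.map_source ht
  rw [donaldsonFujiki_eq hsub hφ hΩ hp ht]
  refine lt_of_le_of_ne (re_sesq_wpMatrix_nonneg hsub hφ hΩ hp hy a) fun h0 => hξ ?_
  have h := fibreIntegral_sesq hsub hφ hΩ hp (fun j k => smoothOver_kfun (φ := φ) hΩ j k) a a hy
  have h1 : SmoothOver (n := n) p φ fun x => sesq (fun j k => kfun p Ω φ j k x) a a :=
    SmoothOver.sum fun j => SmoothOver.sum fun k => (smoothOver_kfun hΩ j k).const_mul _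
  have h2 : ∀ x, p x = t → kappaInner p Ω t ξ ξ x = 0 := by
    intro x hx
    have hx' : p x = φ.symm (φ t) := by rw [φ.left_inv ht, hx]
    have hn : ∀ z, p z = φ.symm (φ t) → 0 ≤ sesq (fun j k => kfun p Ω φ j k z) a a := fun z hz =>
      sesq_kfun_nonneg hsub hφ hΩ hp (by rw [hz, φ.left_inv ht]; exact ht) a
    have h3 := re_eq_zero_of_integral hsub hφ hΩ hp h1 hy
      (fun z hz => (Complex.le_def.1 (hn z hz)).1) ((congrArg Complex.re h).trans h0.symm) hx'
    rw [kappaInner_eq_sesq hΩ hsub hφ ht ξ ξ hx]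
    exact Complex.ext h3 (Complex.le_def.1 (hn x hx')).2.symm
  refine hKS ?_
  rw [kodairaSpencer, kodairaSpencer]
  congr 1
  funext x w
  exact kappa_eq_kappa_zero hΩ hsub hφ ht ξ x.2 (h2 x.1 x.2) w.2

lemma contDiffOn_wpMatrix (j k : Fin m) :
    ContDiffOn ℝ ∞ (fun y => wpMatrix p Ω φ y j k) φ.target :=
  contDiffOn_fibreIntegral hsub hφ hΩ hp (smoothOver_kfun hΩ j k)

/-- The Kähler condition `∂_l G_{j k̄} = ∂_j G_{l k̄}`. -/
lemma wirt_wpMatrix_symm {y : Fin m → ℂ} (hy : y ∈ φ.target) (j k l : Fin m) :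
    wirt (Pi.single l 1) (fun z => wpMatrix p Ω φ z j k) y
      = wirt (Pi.single j 1) (fun z => wpMatrix p Ω φ z l k) y := by
  have h := fun j k => (transportAt hsub hφ hΩ hp (smoothOver_kfun hΩ j k) hy).2
  refine (h j k l).trans (Eq.trans (fibreIntegral_congr hp fun x hx => ?_) (h l k j).symm)
  obtain ⟨g, A, A₂, -, -, -, hs, -, h, -⟩ :=
    exists_matrices hΩ hsub hφ (x := x) (by rw [hx]; exact φ.map_target hy)
  rw [h, h, hs]

lemma wirtBar_wpMatrix {y : Fin m → ℂ} (hy : y ∈ φ.target) (j k q : Fin m) :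
    wirtBar (Pi.single q 1) (fun z => wpMatrix p Ω φ z j k) y
      = fibreIntegral p Ω φ (hderBar p Ω φ q (kfun p Ω φ j k)) y := by
  refine (wirtBar_fibreIntegral hsub hφ hΩ hp (smoothOver_kfun hΩ j k) hy _).trans ?_
  rw [Finset.sum_eq_single q]
  · simp only [Pi.single_eq_same, star_one, one_mul]; rfl
  · intro l _ hl; simp [hl]
  · simp

lemma wirtBar_wpMatrix_eq_star {y : Fin m → ℂ} (hy : y ∈ φ.target) (j k q : Fin m) :
    wirtBar (Pi.single q 1) (fun z => wpMatrix p Ω φ z j k) y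
      = star (wirt (Pi.single q 1) (fun z => wpMatrix p Ω φ z k j) y) := by
  rw [star_wirt]
  refine wirtBar_congr ?_
  filter_upwards [φ.open_target.mem_nhds hy] with z hz
  exact (star_wpMatrix hsub hφ hΩ hp hz k j).symm

lemma wirt_wirtBar_wpMatrix {y : Fin m → ℂ} (hy : y ∈ φ.target) (j k l q : Fin m) :
    wirt (Pi.single l 1) (wirtBar (Pi.single q 1) fun z => wpMatrix p Ω φ z j k) y
      = fibreIntegral p Ω φ (hder p Ω φ l (hderBar p Ω φ q (kfun p Ω φ j k))) y := by
  rw [← (transportAt hsub hφ hΩ hp ((smoothOver_kfun hΩ j k).hderBar hΩ q) hy).2]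
  refine wirt_congr ?_
  filter_upwards [φ.open_target.mem_nhds hy] with z hz
  exact wirtBar_wpMatrix hsub hφ hΩ hp hz j k q

end Metric

/-! ### The integrated curvature inequality -/

section CurvatureAlgebra

variable {ι : Type*} [Fintype ι]

lemma sesq_eq_vecMul (G : Matrix ι ι ℂ) (a b : ι → ℂ) :
    sesq G a b = ∑ k, Matrix.vecMul a G k * star (b k) := by
  unfold sesq
  rw [Finset.sum_comm]
  refine Finset.sum_congr rfl fun k _ => ?_
  rw [Matrix.vecMul, dotProduct, Finset.sum_mul]
  exact Finset.sum_congr rfl fun j _ => by ring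

lemma isUnit_det_of_sesq [DecidableEq ι] {G : Matrix ι ι ℂ} (h : ∀ a, a ≠ 0 → 0 < (sesq G a a).re) :
    IsUnit G.det := by
  rw [isUnit_iff_ne_zero]
  intro h0
  obtain ⟨v, hv, hv0⟩ := Matrix.exists_vecMul_eq_zero_iff.2 h0
  have := h v hv
  rw [sesq_eq_vecMul, hv0] at this
  simp at this

/-- The full contraction of the curvature tensor with two vectors `a` and `b`, in terms of the
covector `c_s = ∑ a_j b_l ∂_l G_{j s̄}`. -/
lemma sum_curvatureCoeff (Gi : Matrix ι ι ℂ) (T U : ι → ι → ι → ℂ) (D : ι → ι → ι → ι → ℂ)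
    (hU : ∀ q r k, U q r k = star (T q k r)) (a b c : ι → ℂ)
    (hc : ∀ s, c s = ∑ j, ∑ l, a j * b l * T l j s) :
    ∑ j, ∑ k, ∑ l, ∑ q, ((∑ r, ∑ s, Gi s r * T l j s * U q r k) - D j k l q)
        * a j * star (a k) * b l * star (b q)
      = ∑ r, ∑ s, Gi s r * c s * star (c r)
        - ∑ j, ∑ k, ∑ l, ∑ q, a j * star (a k) * b l * star (b q) * D j k l q := by
  have h1 : ∑ r, ∑ s, Gi s r * c s * star (c r) = ∑ j, ∑ k, ∑ l, ∑ q, ∑ r, ∑ s,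
      a j * star (a k) * b l * star (b q) * (Gi s r * T l j s * U q r k) := by
    rw [Finset.sum_congr rfl fun j _ => Finset.sum_congr rfl fun k _ => sum_swap_pairs _,
      sum_swap_pairs]
    refine Finset.sum_congr rfl fun r _ => Finset.sum_congr rfl fun s _ => ?_
    rw [hc, hc, star_sum, mul_assoc, Finset.sum_mul_sum, Finset.mul_sum]
    refine Finset.sum_congr rfl fun j _ => ?_
    rw [Finset.mul_sum]
    refine Finset.sum_congr rfl fun k _ => ?_
    rw [star_sum, Finset.sum_mul_sum, Finset.mul_sum]
    refine Finset.sum_congr rfl fun l _ => ?_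
    rw [Finset.mul_sum]
    refine Finset.sum_congr rfl fun q _ => ?_
    rw [hU, star_mul', star_mul']; ring
  rw [h1]
  simp only [← Finset.sum_sub_distrib]
  refine Finset.sum_congr rfl fun j _ => Finset.sum_congr rfl fun k _ =>
    Finset.sum_congr rfl fun l _ => Finset.sum_congr rfl fun q _ => ?_
  simp only [← Finset.mul_sum]
  ring

/-- Among the numbers `2 Re ⟨c, x⟩ - G(x, x)` the choice `x = c G⁻¹` gives the dual norm of `c`. -/
lemma exists_dual_vector [DecidableEq ι] {G : Matrix ι ι ℂ} (hG : IsUnit G.det) (c : ι → ℂ) :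
    ∃ x : ι → ℂ, (∑ r, ∑ s, G⁻¹ s r * c s * star (c r)).re
      = 2 * (∑ r, c r * star (x r)).re - (sesq G x x).re := by
  refine ⟨Matrix.vecMul c G⁻¹, ?_⟩
  have h1 : Matrix.vecMul (Matrix.vecMul c G⁻¹) G = c := by
    rw [Matrix.vecMul_vecMul, Matrix.nonsing_inv_mul _ hG, Matrix.vecMul_one]
  rw [sesq_eq_vecMul, h1]
  have h2 : ∑ r, ∑ s, G⁻¹ s r * c s * star (c r) = star (∑ r, c r * star (Matrix.vecMul c G⁻¹ r)) := by
    rw [star_sum]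
    refine Finset.sum_congr rfl fun r _ => ?_
    rw [star_mul', star_star, Matrix.vecMul, dotProduct, Finset.mul_sum]
    exact Finset.sum_congr rfl fun s _ => by ring
  rw [h2, Complex.star_def, Complex.conj_re]
  ring

end CurvatureAlgebra

section Inequality

open scoped ComplexOrder

set_option linter.unusedSectionVars false

variable {m n : ℕ}
variable {X : Type*} [TopologicalSpace X] [ChartedSpace ((Fin m → ℂ) × (Fin n → ℂ)) X]
variable {B : Type*} [TopologicalSpace B] [ChartedSpace (Fin m → ℂ) B]
variable {p : X → B} {Ω : TwoForm ((Fin m → ℂ) × (Fin n → ℂ)) X}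
  {φ : OpenPartialHomeomorph B (Fin m → ℂ)}
variable [MeasurableSpace X]
variable [BorelSpace X] [T2Space X] [IsManifold 𝓘(ℂ, (Fin m → ℂ) × (Fin n → ℂ)) ω X]
  [IsManifold 𝓘(ℂ, Fin m → ℂ) ω B] [T2Space B]

/-- A function on the total space whose fibre integral has as real part the negative of the
curvature `R(a, ā, b, b̄)` of the Weil–Petersson metric, when `x` is dual to the covector
`∑ a_j b_l ∂_l G_{j s̄}` of first derivatives of the metric. -/
def curvatureDensity (p : X → B) (Ω : TwoForm ((Fin m → ℂ) × (Fin n → ℂ)) X)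
    (φ : OpenPartialHomeomorph B (Fin m → ℂ)) (a b x : Fin m → ℂ) : X → ℂ :=
  (fun z => ∑ i : Fin m × Fin m × Fin m × Fin m, (a i.1 * star (a i.2.1) * b i.2.2.1 * star (b i.2.2.2))
      * hder p Ω φ i.2.2.1 (hderBar p Ω φ i.2.2.2 (kfun p Ω φ i.1 i.2.1)) z)
    + ((fun z => ∑ i : Fin m × Fin m × Fin m, (-2 * (a i.1 * b i.2.1 * star (x i.2.2)))
        * hder p Ω φ i.2.1 (kfun p Ω φ i.1 i.2.2) z)
      + fun z => sesq (fun j k => kfun p Ω φ j k z) x x)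

lemma SmoothOver.sesq {f : Fin m → Fin m → X → ℂ}
    (hf : ∀ j k, SmoothOver (n := n) p φ (f j k)) (a b : Fin m → ℂ) :
    SmoothOver (n := n) p φ fun x => sesq (fun j k => f j k x) a b :=
  SmoothOver.sum fun j => SmoothOver.sum fun k => (hf j k).const_mul _

lemma SmoothOver.curvatureDensity (hΩ : IsPoissonKahlerForm p Ω) (a b x : Fin m → ℂ) :
    SmoothOver (n := n) p φ (curvatureDensity p Ω φ a b x) :=
  (SmoothOver.sum fun _ => (((smoothOver_kfun hΩ _ _).hderBar hΩ _).hder hΩ _).const_mul _).add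
    ((SmoothOver.sum fun _ => ((smoothOver_kfun hΩ _ _).hder hΩ _).const_mul _).add
      (SmoothOver.sesq (smoothOver_kfun hΩ) x x))

variable (hsub : Manifold.IsSubmersion 𝓘(ℂ, (Fin m → ℂ) × (Fin n → ℂ)) 𝓘(ℂ, Fin m → ℂ) ω p)
  (hφ : φ ∈ IsManifold.maximalAtlas 𝓘(ℂ, Fin m → ℂ) ω B)
  (hΩ : IsPoissonKahlerForm p Ω)
include hsub hφ hΩ

lemma exists_curvatureDensity_ge (a b x : Fin m → ℂ) {z : X} (hz : p z ∈ φ.source) :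
    ∃ (g : Matrix (Fin n) (Fin n) ℂ) (A : Fin m → Matrix (Fin n) (Fin n) ℂ), g.PosDef ∧
      (∀ j, (A j).transpose * g = g.transpose * A j) ∧
      (∀ j k, kfun p Ω φ j k z = (A j * cc (A k)).trace) ∧
      ((∑ j, a j • A j) * cc (∑ j, b j • A j) * (∑ j, b j • A j) * cc (∑ j, a j • A j)).trace.re
      + ((∑ j, b j • A j) * cc (∑ j, b j • A j) * (∑ j, a j • A j) * cc (∑ j, a j • A j)).trace.re
        ≤ (curvatureDensity p Ω φ a b x z).re := by
  obtain ⟨g, A, A₂, hg, hA, hA₂, -, h1, h2, h3⟩ := exists_matrices hΩ hsub hφ hz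
  refine ⟨g, A, hg, hA, h1, (pointwise_curvature hg hA hA₂ a b x).trans (le_of_eq ?_)⟩
  simp only [curvatureDensity, Pi.add_apply, Fintype.sum_prod_type, h1, h2, h3, Complex.add_re,
    mul_assoc, ← Finset.mul_sum]
  simp only [Complex.mul_re (-2), Complex.neg_re, Complex.neg_im, Complex.re_ofNat, Complex.im_ofNat]
  ring

lemma re_curvatureDensity_nonneg (a b x : Fin m → ℂ) {z : X} (hz : p z ∈ φ.source) :
    0 ≤ (curvatureDensity p Ω φ a b x z).re := by
  obtain ⟨g, A, hg, hA, -, h⟩ := exists_curvatureDensity_ge hsub hφ hΩ a b x hz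
  refine le_trans (add_nonneg ?_ ?_) h
  · exact (Complex.le_def.1 (trace_four_nonneg hg (symm_sum _ _ hA) (symm_sum _ _ hA))).1
  · exact (Complex.le_def.1 (trace_four_nonneg' hg (symm_sum _ _ hA) (symm_sum _ _ hA))).1

lemma re_curvatureDensity_ge_sq (a x : Fin m → ℂ) {z : X} (hz : p z ∈ φ.source) :
    (2 / n : ℝ) * (sesq (fun j k => kfun p Ω φ j k z) a a).re ^ 2
      ≤ (curvatureDensity p Ω φ a a x z).re := by
  obtain ⟨g, A, hg, hA, hk, h⟩ := exists_curvatureDensity_ge hsub hφ hΩ a a x hz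
  have h1 : sesq (fun j k => kfun p Ω φ j k z) a a
      = ((∑ j, a j • A j) * cc (∑ j, a j • A j)).trace := by
    rw [trace_mul_cc_sum]; simp only [sesq, hk]
  have h2 := sq_trace_le hg (symm_sum a A hA)
  rw [Fintype.card_fin] at h2
  rcases Nat.eq_zero_or_pos n with hn | hn
  · simpa [hn] using re_curvatureDensity_nonneg hsub hφ hΩ a a x hz
  · have hn' : (0 : ℝ) < n := by exact_mod_cast hn
    rw [h1, div_mul_eq_mul_div, div_le_iff₀ hn']
    nlinarith

variable (hp : IsProperMap p)
include hp

lemma fibreIntegral_curvatureDensity (a b x : Fin m → ℂ) {y : Fin m → ℂ} (hy : y ∈ φ.target) :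
    (fibreIntegral p Ω φ (curvatureDensity p Ω φ a b x) y).re
      = (∑ j, ∑ k, ∑ l, ∑ q, a j * star (a k) * b l * star (b q) *
          wirt (Pi.single l 1) (wirtBar (Pi.single q 1) fun z => wpMatrix p Ω φ z j k) y).re
        - 2 * (∑ r, (∑ j, ∑ l, a j * b l * wirt (Pi.single l 1) (fun z => wpMatrix p Ω φ z j r) y)
            * star (x r)).re
        + (sesq (wpMatrix p Ω φ y) x x).re := by
  have h1 := fibreIntegral_sum hsub hφ hΩ hp
    (fun i : Fin m × Fin m × Fin m × Fin m => a i.1 * star (a i.2.1) * b i.2.2.1 * star (b i.2.2.2))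
    (f := fun i => hder p Ω φ i.2.2.1 (hderBar p Ω φ i.2.2.2 (kfun p Ω φ i.1 i.2.1)))
    (fun _ => ((smoothOver_kfun hΩ _ _).hderBar hΩ _).hder hΩ _) hy
  have h2 := fibreIntegral_sum hsub hφ hΩ hp
    (fun i : Fin m × Fin m × Fin m => -2 * (a i.1 * b i.2.1 * star (x i.2.2)))
    (f := fun i => hder p Ω φ i.2.1 (kfun p Ω φ i.1 i.2.2))
    (fun _ => (smoothOver_kfun hΩ _ _).hder hΩ _) hy
  have h3 := fibreIntegral_sesq hsub hφ hΩ hp (smoothOver_kfun (φ := φ) hΩ) x x hy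
  rw [curvatureDensity, fibreIntegral_add hsub hφ hΩ hp (SmoothOver.sum fun _ =>
      (((smoothOver_kfun hΩ _ _).hderBar hΩ _).hder hΩ _).const_mul _)
    ((SmoothOver.sum fun _ => ((smoothOver_kfun hΩ _ _).hder hΩ _).const_mul _).add
      (SmoothOver.sesq (smoothOver_kfun hΩ) x x)) hy,
    fibreIntegral_add hsub hφ hΩ hp (SmoothOver.sum fun _ =>
      ((smoothOver_kfun hΩ _ _).hder hΩ _).const_mul _)
      (SmoothOver.sesq (smoothOver_kfun hΩ) x x) hy, h1, h2, h3]
  have h4 : ∑ r, (∑ j, ∑ l, a j * b l * wirt (Pi.single l 1) (fun z => wpMatrix p Ω φ z j r) y)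
      * star (x r) = ∑ j, ∑ l, ∑ r, a j * b l * star (x r) *
        wirt (Pi.single l 1) (fun z => wpMatrix p Ω φ z j r) y := by
    simp only [Finset.sum_mul]
    rw [Finset.sum_comm]
    refine Finset.sum_congr rfl fun j _ => ?_
    rw [Finset.sum_comm]
    exact Finset.sum_congr rfl fun l _ => Finset.sum_congr rfl fun r _ => by ring
  have h5 : ∀ j r l, wirt (Pi.single l 1) (fun z => wpMatrix p Ω φ z j r) y
      = fibreIntegral p Ω φ (hder p Ω φ l (kfun p Ω φ j r)) y := fun j r l =>
    (transportAt hsub hφ hΩ hp (smoothOver_kfun hΩ j r) hy).2 l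
  rw [h4]
  simp only [wirt_wirtBar_wpMatrix hsub hφ hΩ hp hy, h5, Fintype.sum_prod_type, Complex.add_re,
    mul_assoc, ← Finset.mul_sum]
  simp only [Complex.mul_re (-2), Complex.neg_re, Complex.neg_im, Complex.re_ofNat, Complex.im_ofNat]
  change _ = _ - _ + (sesq (fun j k => fibreIntegral p Ω φ (kfun p Ω φ j k) y) x x).re
  ring

lemma re_fibreIntegral_curvatureDensity_nonneg (a b x : Fin m → ℂ) {y : Fin m → ℂ}
    (hy : y ∈ φ.target) : 0 ≤ (fibreIntegral p Ω φ (curvatureDensity p Ω φ a b x) y).re := by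
  rw [re_fibreIntegral hsub hφ hΩ hp (SmoothOver.curvatureDensity hΩ a b x) hy]
  refine integral_nonneg_of_ae ?_
  filter_upwards [ae_fibreMeasure_proj hp.continuous (φ.symm y)] with z hz
  exact re_curvatureDensity_nonneg hsub hφ hΩ a b x (by rw [hz]; exact φ.map_target hy)

/-- The Cauchy–Schwarz inequality on the fibre gives the bound by the square of the metric. -/
lemma re_fibreIntegral_curvatureDensity_ge (a x : Fin m → ℂ) {y : Fin m → ℂ} (hy : y ∈ φ.target) :
    (2 / n : ℝ) * (fibreVolume p Ω (φ.symm y))⁻¹ * (sesq (wpMatrix p Ω φ y) a a).re ^ 2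
      ≤ (fibreIntegral p Ω φ (curvatureDensity p Ω φ a a x) y).re := by
  set μ := fibreMeasure p Ω (φ.symm y)
  have : IsFiniteMeasure μ := ⟨fibreMeasure_lt_top hΩ hp hsub _⟩
  set k : X → ℝ := fun z => (sesq (fun j k => kfun p Ω φ j k z) a a).re
  have hs := SmoothOver.sesq (smoothOver_kfun (φ := φ) hΩ) a a
  have hk : Integrable k μ := (hs.integrable hsub hφ hΩ hp (φ.map_target hy)).re
  have hk2 : Integrable (fun z => k z ^ 2) μ := by
    have := ((hs.ofReal_re.mul hs.ofReal_re).integrable hsub hφ hΩ hp (φ.map_target hy)).re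
    refine this.congr (Filter.Eventually.of_forall fun z => ?_)
    simp [k, sq]
  have hint : (sesq (wpMatrix p Ω φ y) a a).re = ∫ z, k z ∂μ := by
    rw [← re_fibreIntegral hsub hφ hΩ hp hs hy,
      fibreIntegral_sesq hsub hφ hΩ hp (smoothOver_kfun (φ := φ) hΩ) a a hy]
    rfl
  have h1 : (2 / n : ℝ) * ∫ z, k z ^ 2 ∂μ
      ≤ (fibreIntegral p Ω φ (curvatureDensity p Ω φ a a x) y).re := by
    have hd := SmoothOver.curvatureDensity (φ := φ) hΩ a a x
    rw [re_fibreIntegral hsub hφ hΩ hp hd hy, ← integral_const_mul]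
    refine integral_mono_ae (hk2.const_mul _) (hd.integrable hsub hφ hΩ hp (φ.map_target hy)).re ?_
    filter_upwards [ae_fibreMeasure_proj hp.continuous (φ.symm y)] with z hz
    exact re_curvatureDensity_ge_sq hsub hφ hΩ a x (by rw [hz]; exact φ.map_target hy)
  refine le_trans ?_ h1
  rw [mul_assoc, hint]
  refine mul_le_mul_of_nonneg_left ?_ (by positivity)
  have hv : 0 ≤ fibreVolume p Ω (φ.symm y) := measureReal_nonneg
  rcases hv.eq_or_lt with h0 | h0
  · rw [← h0, inv_zero, zero_mul]
    exact integral_nonneg fun z => sq_nonneg _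
  · rw [inv_mul_le_iff₀ h0]
    exact sq_integral_le hk hk2

end Inequality

/-! ### The fundamental form of the Weil–Petersson metric -/

section Sesq

variable {ι : Type*} [Fintype ι]

lemma sesq_add_left (G : ι → ι → ℂ) (a a' b : ι → ℂ) : sesq G (a + a') b = sesq G a b + sesq G a' b := by
  simp [sesq, add_mul, Finset.sum_add_distrib]

lemma sesq_add_right (G : ι → ι → ℂ) (a b b' : ι → ℂ) : sesq G a (b + b') = sesq G a b + sesq G a b' := by
  simp [sesq, mul_add, add_mul, Finset.sum_add_distrib]

lemma sesq_smul_left (G : ι → ι → ℂ) (z : ℂ) (a b : ι → ℂ) : sesq G (z • a) b = z * sesq G a b := by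
  simp [sesq, Finset.mul_sum, mul_assoc]

lemma sesq_smul_right (G : ι → ι → ℂ) (z : ℂ) (a b : ι → ℂ) :
    sesq G a (z • b) = star z * sesq G a b := by
  simp only [sesq, Finset.mul_sum, Pi.smul_apply, smul_eq_mul, star_mul']
  exact Finset.sum_congr rfl fun j _ => Finset.sum_congr rfl fun k _ => by ring

lemma sesq_real_smul_left (G : ι → ι → ℂ) (r : ℝ) (a b : ι → ℂ) :
    sesq G (r • a) b = r * sesq G a b := by
  rw [← sesq_smul_left]; congr 1

lemma sesq_real_smul_right (G : ι → ι → ℂ) (r : ℝ) (a b : ι → ℂ) :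
    sesq G a (r • b) = r * sesq G a b := by
  have h : r • b = (r : ℂ) • b := by ext; simp
  rw [h, sesq_smul_right, Complex.star_def, Complex.conj_ofReal]

lemma star_sesq (G : ι → ι → ℂ) (hG : ∀ j k, star (G j k) = G k j) (a b : ι → ℂ) :
    star (sesq G a b) = sesq G b a := by
  simp only [sesq, star_sum, star_mul', star_star, hG]
  rw [Finset.sum_comm]
  exact Finset.sum_congr rfl fun j _ => Finset.sum_congr rfl fun k _ => by ring

lemma sesq_single [DecidableEq ι] (G : ι → ι → ℂ) (j k : ι) :
    sesq G (Pi.single j 1) (Pi.single k 1) = G j k := by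
  rw [sesq, Finset.sum_eq_single j, Finset.sum_eq_single k]
  · simp
  · intro b _ hb; simp [hb]
  · simp
  · intro b _ hb; simp [hb]
  · simp

/-- The real two-form `(u, v) ↦ Im ⟨v, u⟩ - Im ⟨u, v⟩` of a sesquilinear form with matrix `G`; it is
`-2 Im ⟨u, v⟩` when `G` is Hermitian. -/
def sesqForm (G : ι → ι → ℂ) : (ι → ℂ) [⋀^Fin 2]→L[ℝ] ℝ where
  toFun v := (sesq G (v 1) (v 0)).im - (sesq G (v 0) (v 1)).im
  map_update_add' {_} v i x y := by
    fin_cases i <;> simp [sesq_add_left, sesq_add_right] <;> ring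
  map_update_smul' {_} v i r x := by
    fin_cases i <;> simp [sesq_real_smul_left, sesq_real_smul_right] <;> ring
  map_eq_zero_of_eq' v i j hij hne := by
    have h : v 0 = v 1 := by
      fin_cases i <;> fin_cases j <;> simp_all
    simp [h]
  cont := by
    unfold sesq
    fun_prop

end Sesq

section Form

variable {m n : ℕ}
variable {X : Type*} [TopologicalSpace X] [ChartedSpace ((Fin m → ℂ) × (Fin n → ℂ)) X]
variable {B : Type*} [TopologicalSpace B] [ChartedSpace (Fin m → ℂ) B]
variable {p : X → B} {Ω : TwoForm ((Fin m → ℂ) × (Fin n → ℂ)) X}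
variable [MeasurableSpace X]

/-- The fundamental form of the Weil–Petersson metric on the base. -/
def wpForm (p : X → B) (Ω : TwoForm ((Fin m → ℂ) × (Fin n → ℂ)) X) : TwoForm (Fin m → ℂ) B :=
  fun t => (sesqForm (wpMatrix p Ω (chartAt (Fin m → ℂ) t) (chartAt (Fin m → ℂ) t t))
    ).compContinuousLinearMap
      ((mfderiv 𝓘(ℂ, Fin m → ℂ) 𝓘(ℂ, Fin m → ℂ) (chartAt (Fin m → ℂ) t) t).restrictScalars ℝ)

variable [BorelSpace X] [T2Space X] [IsManifold 𝓘(ℂ, (Fin m → ℂ) × (Fin n → ℂ)) ω X]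
  [IsManifold 𝓘(ℂ, Fin m → ℂ) ω B] [T2Space B]

set_option linter.unusedSectionVars false

variable (hsub : Manifold.IsSubmersion 𝓘(ℂ, (Fin m → ℂ) × (Fin n → ℂ)) 𝓘(ℂ, Fin m → ℂ) ω p)
  (hΩ : IsPoissonKahlerForm p Ω) (hp : IsProperMap p)
include hsub hΩ hp

lemma star_donaldsonFujiki (t : B) (ξ η : TangentSpace 𝓘(ℂ, Fin m → ℂ) t) :
    star (donaldsonFujiki p Ω t ξ η) = donaldsonFujiki p Ω t η ξ := by
  have hφ := IsManifold.chart_mem_maximalAtlas (I := 𝓘(ℂ, Fin m → ℂ)) (n := ω) t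
  have ht := mem_chart_source (Fin m → ℂ) t
  rw [donaldsonFujiki_eq hsub hφ hΩ hp ht, donaldsonFujiki_eq hsub hφ hΩ hp ht]
  exact star_sesq _ (star_wpMatrix hsub hφ hΩ hp (OpenPartialHomeomorph.map_source _ ht)) _ _

lemma donaldsonFujiki_I_right (t : B) (ξ η : TangentSpace 𝓘(ℂ, Fin m → ℂ) t) :
    donaldsonFujiki p Ω t ξ (Complex.I • η) = -Complex.I * donaldsonFujiki p Ω t ξ η := by
  have hφ := IsManifold.chart_mem_maximalAtlas (I := 𝓘(ℂ, Fin m → ℂ)) (n := ω) t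
  have ht := mem_chart_source (Fin m → ℂ) t
  rw [donaldsonFujiki_eq hsub hφ hΩ hp ht, donaldsonFujiki_eq hsub hφ hΩ hp ht, map_smul]
  refine (sesq_smul_right _ _ _ _).trans ?_
  rw [Complex.star_def, Complex.conj_I]

lemma wpForm_apply (t : B) (ξ η : TangentSpace 𝓘(ℂ, Fin m → ℂ) t) :
    wpForm p Ω t ![ξ, η] = -2 * (donaldsonFujiki p Ω t ξ η).im := by
  have hφ := IsManifold.chart_mem_maximalAtlas (I := 𝓘(ℂ, Fin m → ℂ)) (n := ω) t
  have ht := mem_chart_source (Fin m → ℂ) t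
  have h1 : wpForm p Ω t ![ξ, η]
      = (donaldsonFujiki p Ω t η ξ).im - (donaldsonFujiki p Ω t ξ η).im := by
    rw [donaldsonFujiki_eq hsub hφ hΩ hp ht, donaldsonFujiki_eq hsub hφ hΩ hp ht]; rfl
  rw [h1, ← star_donaldsonFujiki hsub hΩ hp, Complex.star_def, Complex.conj_im]
  ring

lemma herm_wpForm (t : B) (ξ η : TangentSpace 𝓘(ℂ, Fin m → ℂ) t) :
    (wpForm p Ω).herm t ξ η = donaldsonFujiki p Ω t ξ η := by
  rw [TwoForm.herm, wpForm_apply hsub hΩ hp, wpForm_apply hsub hΩ hp,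
    donaldsonFujiki_I_right hsub hΩ hp]
  apply Complex.ext <;> simp

lemma donaldsonFujiki_mfderiv_symm {φ : OpenPartialHomeomorph B (Fin m → ℂ)}
    (hφ : φ ∈ IsManifold.maximalAtlas 𝓘(ℂ, Fin m → ℂ) ω B) {y : Fin m → ℂ} (hy : y ∈ φ.target)
    (a b : Fin m → ℂ) :
    donaldsonFujiki p Ω (φ.symm y) (mfderiv 𝓘(ℂ, Fin m → ℂ) 𝓘(ℂ, Fin m → ℂ) φ.symm y a)
      (mfderiv 𝓘(ℂ, Fin m → ℂ) 𝓘(ℂ, Fin m → ℂ) φ.symm y b) = sesq (wpMatrix p Ω φ y) a b := by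
  rw [donaldsonFujiki_eq hsub hφ hΩ hp (φ.map_target hy), φ.right_inv hy]
  exact congrArg₂ (sesq (wpMatrix p Ω φ y)) (mfderiv_mfderiv_symm hφ hy a)
    (mfderiv_mfderiv_symm hφ hy b)

lemma inChart_wpForm (t : B) {y : Fin m → ℂ} (hy : y ∈ (chartAt (Fin m → ℂ) t).target)
    (a b : Fin m → ℂ) :
    (wpForm p Ω).inChart t y ![a, b]
      = -2 * (sesq (wpMatrix p Ω (chartAt (Fin m → ℂ) t) y) a b).im := by
  have hφ := IsManifold.chart_mem_maximalAtlas (I := 𝓘(ℂ, Fin m → ℂ)) (n := ω) t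
  refine (TwoForm.formIn_apply _ _ _ _ _).trans ((wpForm_apply hsub hΩ hp _ _ _).trans ?_)
  rw [donaldsonFujiki_mfderiv_symm hsub hΩ hp hφ hy]

lemma metricMatrix_wpForm (t : B) {y : Fin m → ℂ} (hy : y ∈ (chartAt (Fin m → ℂ) t).target)
    (j k : Fin m) :
    metricMatrix (wpForm p Ω) t y j k = wpMatrix p Ω (chartAt (Fin m → ℂ) t) y j k := by
  have hφ := IsManifold.chart_mem_maximalAtlas (I := 𝓘(ℂ, Fin m → ℂ)) (n := ω) t
  refine (herm_wpForm hsub hΩ hp _ _ _).trans ?_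
  exact (donaldsonFujiki_mfderiv_symm hsub hΩ hp hφ hy _ _).trans (sesq_single _ _ _)

lemma contDiffOn_sesq_wpMatrix {φ : OpenPartialHomeomorph B (Fin m → ℂ)}
    (hφ : φ ∈ IsManifold.maximalAtlas 𝓘(ℂ, Fin m → ℂ) ω B) (a b : Fin m → ℂ) :
    ContDiffOn ℝ ∞ (fun y => sesq (wpMatrix p Ω φ y) a b) φ.target :=
  ContDiffOn.sum fun j _ => ContDiffOn.sum fun k _ =>
    contDiffOn_const.mul (contDiffOn_wpMatrix hsub hφ hΩ hp j k)

lemma wirt_sesq_wpMatrix {φ : OpenPartialHomeomorph B (Fin m → ℂ)}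
    (hφ : φ ∈ IsManifold.maximalAtlas 𝓘(ℂ, Fin m → ℂ) ω B) {y : Fin m → ℂ} (hy : y ∈ φ.target)
    (u a b : Fin m → ℂ) :
    wirt u (fun z => sesq (wpMatrix p Ω φ z) a b) y
      = ∑ l, ∑ j, ∑ k, u l * a j * star (b k) *
        wirt (Pi.single l 1) (fun z => wpMatrix p Ω φ z j k) y := by
  have hd : ∀ j k, DifferentiableAt ℝ (fun z => wpMatrix p Ω φ z j k) y := fun j k =>
    ((contDiffOn_wpMatrix hsub hφ hΩ hp j k).contDiffAt (φ.open_target.mem_nhds hy)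
      ).differentiableAt (by simp)
  have h1 : ∀ v, fderiv ℝ (fun z => sesq (wpMatrix p Ω φ z) a b) y v
      = ∑ j, ∑ k, a j * star (b k) * fderiv ℝ (fun z => wpMatrix p Ω φ z j k) y v := by
    intro v
    have h2 : HasFDerivAt (fun z => sesq (wpMatrix p Ω φ z) a b)
        (∑ j, ∑ k, (a j * star (b k)) • fderiv ℝ (fun z => wpMatrix p Ω φ z j k) y) y :=
      HasFDerivAt.fun_sum fun j _ => HasFDerivAt.fun_sum fun k _ =>
        (hd j k).hasFDerivAt.const_mul _
    rw [h2.fderiv]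
    simp
  rw [wirt_eq_sum]
  refine Finset.sum_congr rfl fun l _ => ?_
  simp only [wirt, h1, Finset.mul_sum, ← Finset.sum_sub_distrib]
  exact Finset.sum_congr rfl fun j _ => Finset.sum_congr rfl fun k _ => by ring

lemma wirt_sesq_wpMatrix_symm {φ : OpenPartialHomeomorph B (Fin m → ℂ)}
    (hφ : φ ∈ IsManifold.maximalAtlas 𝓘(ℂ, Fin m → ℂ) ω B) {y : Fin m → ℂ} (hy : y ∈ φ.target)
    (u a b : Fin m → ℂ) :
    wirt u (fun z => sesq (wpMatrix p Ω φ z) a b) y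
      = wirt a (fun z => sesq (wpMatrix p Ω φ z) u b) y := by
  rw [wirt_sesq_wpMatrix hsub hΩ hp hφ hy, wirt_sesq_wpMatrix hsub hΩ hp hφ hy, Finset.sum_comm]
  refine Finset.sum_congr rfl fun j _ => Finset.sum_congr rfl fun l _ =>
    Finset.sum_congr rfl fun k _ => ?_
  rw [wirt_wpMatrix_symm hsub hφ hΩ hp hy j k l]
  ring

lemma isClosedOneOne_wpForm : IsClosedOneOne (wpForm p Ω) where
  smooth t y hy := by
    have hφ := IsManifold.chart_mem_maximalAtlas (I := 𝓘(ℂ, Fin m → ℂ)) (n := ω) t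
    have hn := (chartAt (Fin m → ℂ) t).open_target.mem_nhds hy
    refine (contDiffAt_form_of_apply fun a b => ?_).contDiffWithinAt
    have h1 := ((contDiffOn_sesq_wpMatrix hsub hΩ hp hφ a b).contDiffAt hn)
    refine ((contDiffAt_const (c := (-2 : ℝ))).mul
      (Complex.imCLM.contDiff.contDiffAt.comp y h1)).congr_of_eventuallyEq ?_
    filter_upwards [hn] with z hz
    exact inChart_wpForm hsub hΩ hp t hz a b
  closed t y hy := by
    have hφ := IsManifold.chart_mem_maximalAtlas (I := 𝓘(ℂ, Fin m → ℂ)) (n := ω) t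
    have hn := (chartAt (Fin m → ℂ) t).open_target.mem_nhds hy
    set φ := chartAt (Fin m → ℂ) t
    have hs : ∀ a b, ContDiffAt ℝ ∞ (fun y => sesq (wpMatrix p Ω φ y) a b) y := fun a b =>
      (contDiffOn_sesq_wpMatrix hsub hΩ hp hφ a b).contDiffAt hn
    have hform : ∀ a b, (fun z => (wpForm p Ω).inChart t z ![a, b]) =ᶠ[nhds y]
        fun z => -2 * (sesq (wpMatrix p Ω φ z) a b).im := fun a b => by
      filter_upwards [hn] with z hz using inChart_wpForm hsub hΩ hp t hz a b
    have hd : DifferentiableAt ℝ ((wpForm p Ω).inChart t) y := by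
      refine ContDiffAt.differentiableAt (n := ∞) (contDiffAt_form_of_apply fun a b => ?_) (by simp)
      exact ((contDiffAt_const (c := (-2 : ℝ))).mul
        (Complex.imCLM.contDiff.contDiffAt.comp y (hs a b))).congr_of_eventuallyEq (hform a b)
    have key : ∀ u a b, fderiv ℝ (fun z => (wpForm p Ω).inChart t z ![a, b]) y u
        = -2 * ((wirt u (fun z => sesq (wpMatrix p Ω φ z) a b) y).im
          - (wirt u (fun z => sesq (wpMatrix p Ω φ z) b a) y).im) := by
      intro u a b
      have h1 := (Complex.imCLM.hasFDerivAt.comp y ((hs a b).differentiableAt (by simp)).hasFDerivAt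
        ).const_mul (-2 : ℝ)
      have h2 : wirtBar u (fun z => sesq (wpMatrix p Ω φ z) a b) y
          = star (wirt u (fun z => sesq (wpMatrix p Ω φ z) b a) y) := by
        rw [star_wirt]
        refine wirtBar_congr ?_
        filter_upwards [hn] with z hz
        exact (star_sesq _ (star_wpMatrix hsub hφ hΩ hp hz) b a).symm
      rw [(hform a b).fderiv_eq]
      refine (DFunLike.congr_fun h1.fderiv u).trans ?_
      have h3 := fderiv_eq_wirt u (fun z => sesq (wpMatrix p Ω φ z) a b) y
      rw [h2] at h3
      change -2 * (fderiv ℝ (fun z => sesq (wpMatrix p Ω φ z) a b) y u).im = _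
      rw [h3, Complex.add_im, Complex.star_def, Complex.conj_im]
      ring
    ext v
    have hv : v = ![v 0, v 1, v 2] := by ext i; fin_cases i <;> rfl
    rw [hv]
    refine (closed_two_form hd _ _ _).trans ?_
    have hT := fun u a b => wirt_sesq_wpMatrix_symm hsub hΩ hp hφ hy u a b
    rw [key, key, key, hT (v 0) (v 1) (v 2), hT (v 2) (v 0) (v 1), hT (v 2) (v 1) (v 0)]
    change _ = (0 : ℝ)
    ring
  oneOne t u v := by
    rw [wpForm_apply hsub hΩ hp, wpForm_apply hsub hΩ hp, donaldsonFujiki_I_right hsub hΩ hp,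
      ← star_donaldsonFujiki hsub hΩ hp, donaldsonFujiki_I_right hsub hΩ hp,
      ← star_donaldsonFujiki hsub hΩ hp t u v]
    simp

lemma isKahlerForm_wpForm
    (hKS : ∀ t : B, Function.Injective (kodairaSpencer (F := Fin m → ℂ) p Ω t)) :
    IsKahlerForm (wpForm p Ω) where
  toIsClosedOneOne := isClosedOneOne_wpForm hsub hΩ hp
  pos t u hu := by
    have hφ := IsManifold.chart_mem_maximalAtlas (I := 𝓘(ℂ, Fin m → ℂ)) (n := ω) t
    have h := donaldsonFujiki_pos hsub hφ hΩ hp (mem_chart_source _ t) (hKS t) hu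
    rw [wpForm_apply hsub hΩ hp, donaldsonFujiki_I_right hsub hΩ hp]
    simpa using h

end Form

section Curvature

variable {m n : ℕ}
variable {X : Type*} [TopologicalSpace X] [ChartedSpace ((Fin m → ℂ) × (Fin n → ℂ)) X]
variable {B : Type*} [TopologicalSpace B] [ChartedSpace (Fin m → ℂ) B]
variable {p : X → B} {Ω : TwoForm ((Fin m → ℂ) × (Fin n → ℂ)) X}
variable [MeasurableSpace X] [BorelSpace X] [T2Space X]
  [IsManifold 𝓘(ℂ, (Fin m → ℂ) × (Fin n → ℂ)) ω X] [IsManifold 𝓘(ℂ, Fin m → ℂ) ω B] [T2Space B]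

lemma wirtinger_eq_wirt (l : Fin m) (f : (Fin m → ℂ) → ℂ) : wirtinger l f = wirt (Pi.single l 1) f := by
  funext y
  rw [wirtinger, wirt, ← Pi.single_smul, smul_eq_mul, mul_one]

lemma wirtingerBar_eq_wirtBar (l : Fin m) (f : (Fin m → ℂ) → ℂ) :
    wirtingerBar l f = wirtBar (Pi.single l 1) f := by
  funext y
  rw [wirtingerBar, wirtBar, ← Pi.single_smul, smul_eq_mul, mul_one]

/-- The curvature of the Weil–Petersson metric is the negative of a fibre integral. -/
lemma exists_curvature_eq
    (hsub : Manifold.IsSubmersion 𝓘(ℂ, (Fin m → ℂ) × (Fin n → ℂ)) 𝓘(ℂ, Fin m → ℂ) ω p)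
    (hΩ : IsPoissonKahlerForm p Ω) (hp : IsProperMap p) (t : B)
    (hKS : Function.Injective (kodairaSpencer (F := Fin m → ℂ) p Ω t))
    (ξ η : TangentSpace 𝓘(ℂ, Fin m → ℂ) t) :
    ∃ x, (curvature (wpForm p Ω) t ξ η).re = -(fibreIntegral p Ω (chartAt (Fin m → ℂ) t)
      (curvatureDensity p Ω (chartAt (Fin m → ℂ) t)
        (mfderiv 𝓘(ℂ, Fin m → ℂ) 𝓘(ℂ, Fin m → ℂ) (chartAt (Fin m → ℂ) t) t ξ)
        (mfderiv 𝓘(ℂ, Fin m → ℂ) 𝓘(ℂ, Fin m → ℂ) (chartAt (Fin m → ℂ) t) t η) x)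
      (chartAt (Fin m → ℂ) t t)).re := by
  have hφ := IsManifold.chart_mem_maximalAtlas (I := 𝓘(ℂ, Fin m → ℂ)) (n := ω) t
  have ht := mem_chart_source (Fin m → ℂ) t
  set φ := chartAt (Fin m → ℂ) t with hφt
  set y := φ t with hyt
  have hy : y ∈ φ.target := φ.map_source ht
  have hn := φ.open_target.mem_nhds hy
  set a : Fin m → ℂ := mfderiv 𝓘(ℂ, Fin m → ℂ) 𝓘(ℂ, Fin m → ℂ) φ t ξ with ha
  set b : Fin m → ℂ := mfderiv 𝓘(ℂ, Fin m → ℂ) 𝓘(ℂ, Fin m → ℂ) φ t η with hb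
  set G := wpMatrix p Ω φ y with hG
  have hu : IsUnit G.det := by
    refine isUnit_det_of_sesq fun v hv => ?_
    have h1 := mfderiv_mfderiv_symm hφ hy v
    have h2 := mfderiv_mfderiv_symm hφ hy
    rw [← donaldsonFujiki_mfderiv_symm hsub hΩ hp hφ hy]
    have hts : φ.symm y = t := φ.left_inv ht
    refine donaldsonFujiki_pos hsub hφ hΩ hp (φ.map_target hy) (by rw [hts]; exact hKS) ?_
    intro h0
    refine hv (h1.symm.trans ?_)
    exact (congrArg (mfderiv 𝓘(ℂ, Fin m → ℂ) 𝓘(ℂ, Fin m → ℂ) φ (φ.symm y)) h0).trans (map_zero _)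
  set T : Fin m → Fin m → Fin m → ℂ := fun l j s =>
    wirt (Pi.single l 1) (fun z => wpMatrix p Ω φ z j s) y with hT
  obtain ⟨x, hx⟩ := exists_dual_vector hu fun s => ∑ j, ∑ l, a j * b l * T l j s
  refine ⟨x, ?_⟩
  have hm : ∀ j k, (fun z => metricMatrix (wpForm p Ω) t z j k) =ᶠ[nhds y]
      fun z => wpMatrix p Ω φ z j k := fun j k => by
    filter_upwards [hn] with z hz using metricMatrix_wpForm hsub hΩ hp t hz j k
  have hm' : metricMatrix (wpForm p Ω) t y = G := by
    ext j k; exact metricMatrix_wpForm hsub hΩ hp t hy j k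
  have hcoeff : ∀ j k l q, curvatureCoeff (wpForm p Ω) t j k l q
      = (∑ r, ∑ s, G⁻¹ s r * T l j s
          * wirtBar (Pi.single q 1) (fun z => wpMatrix p Ω φ z r k) y)
        - wirt (Pi.single l 1) (wirtBar (Pi.single q 1) fun z => wpMatrix p Ω φ z j k) y := by
    intro j k l q
    have h1 : wirtBar (Pi.single q 1) (fun z => metricMatrix (wpForm p Ω) t z j k) =ᶠ[nhds y]
        wirtBar (Pi.single q 1) fun z => wpMatrix p Ω φ z j k := by
      filter_upwards [(hm j k).eventuallyEq_nhds] with z hz using wirtBar_congr hz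
    simp only [curvatureCoeff, wirtinger_eq_wirt, wirtingerBar_eq_wirtBar]
    rw [← hφt, ← hyt, hm', wirt_congr h1]
    congr 1
    exact Finset.sum_congr rfl fun r _ => Finset.sum_congr rfl fun s _ => by
      rw [wirt_congr (hm j s), wirtBar_congr (hm r k)]
  have h1 : curvature (wpForm p Ω) t ξ η = _ :=
    (Finset.sum_congr rfl fun j _ => Finset.sum_congr rfl fun k _ => Finset.sum_congr rfl fun l _ =>
      Finset.sum_congr rfl fun q _ => by rw [hcoeff]; rfl).trans
    (sum_curvatureCoeff G⁻¹ T (fun q r k => wirtBar (Pi.single q 1) (fun z => wpMatrix p Ω φ z r k) y)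
      (fun j k l q => wirt (Pi.single l 1)
        (wirtBar (Pi.single q 1) fun z => wpMatrix p Ω φ z j k) y)
      (fun q r k => wirtBar_wpMatrix_eq_star hsub hφ hΩ hp hy r k q) a b
      (fun s => ∑ j, ∑ l, a j * b l * T l j s) fun s => rfl)
  rw [h1, Complex.sub_re, hx, fibreIntegral_curvatureDensity hsub hφ hΩ hp a b x hy]
  ring

end Curvature

end PoissonKahler

end

/-- Let `p : (X, Ω) → B` be a Poisson–Kähler fibration with `n`-dimensional fibres over an
`m`-dimensional complex manifold, with injective Kodaira–Spencer map.  The fibre volume is finite and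
locally constant, the integrals that define the non-harmonic Weil–Petersson metric converge, and this
metric is Kähler with non-positive holomorphic bisectional curvature and with holomorphic sectional
curvature at most `-(2/n) |X_t|⁻¹`. -/
theorem theoremA {m n : ℕ}
    {X : Type*} [TopologicalSpace X] [T2Space X] [SecondCountableTopology X]
    [ChartedSpace ((Fin m → ℂ) × (Fin n → ℂ)) X]
    [IsManifold 𝓘(ℂ, (Fin m → ℂ) × (Fin n → ℂ)) ω X]
    [MeasurableSpace X] [BorelSpace X]
    {B : Type*} [TopologicalSpace B] [T2Space B] [SecondCountableTopology B]
    [ChartedSpace (Fin m → ℂ) B] [IsManifold 𝓘(ℂ, Fin m → ℂ) ω B]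
    (p : X → B) (hproper : IsProperMap p)
    (hsub : Manifold.IsSubmersion 𝓘(ℂ, (Fin m → ℂ) × (Fin n → ℂ)) 𝓘(ℂ, Fin m → ℂ) ω p)
    (Ω : PoissonKahler.TwoForm ((Fin m → ℂ) × (Fin n → ℂ)) X)
    (hΩ : PoissonKahler.IsRelativeKahlerForm (F := Fin m → ℂ) p Ω)
    (hMA : ∀ (x : X)
      (v : Fin (n + 1) × Fin 2 → TangentSpace 𝓘(ℂ, (Fin m → ℂ) × (Fin n → ℂ)) x),
      PoissonKahler.wedgePow (Ω x) (n + 1) v = 0)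
    (hKS : ∀ t : B, Function.Injective
      (PoissonKahler.kodairaSpencer (F := Fin m → ℂ) p Ω t)) :
    (∀ t : B, PoissonKahler.fibreMeasure p Ω t Set.univ < ⊤) ∧
    IsLocallyConstant (PoissonKahler.fibreVolume p Ω) ∧
    (∀ (t : B) (ξ η : TangentSpace 𝓘(ℂ, Fin m → ℂ) t),
      MeasureTheory.Integrable (PoissonKahler.kappaInner p Ω t ξ η)
        (PoissonKahler.fibreMeasure p Ω t)) ∧
    ∃ ΩDF : PoissonKahler.TwoForm (Fin m → ℂ) B,
      (∀ (t : B) (ξ η : TangentSpace 𝓘(ℂ, Fin m → ℂ) t),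
        ΩDF.herm t ξ η = PoissonKahler.donaldsonFujiki p Ω t ξ η) ∧
      PoissonKahler.IsKahlerForm ΩDF ∧
      (∀ (t : B) (ξ : TangentSpace 𝓘(ℂ, Fin m → ℂ) t), ξ ≠ 0 →
        PoissonKahler.sectionalCurvature ΩDF t ξ
          ≤ -(2 / (n : ℝ)) * (PoissonKahler.fibreVolume p Ω t)⁻¹) ∧
      (∀ (t : B) (ξ η : TangentSpace 𝓘(ℂ, Fin m → ℂ) t), ξ ≠ 0 → η ≠ 0 →
        PoissonKahler.bisectionalCurvature ΩDF t ξ η ≤ 0) := by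
  have hΩ' : PoissonKahler.IsPoissonKahlerForm p Ω := { hΩ with degenerate := hMA }
  have hmem : ∀ t : B, chartAt (Fin m → ℂ) t ∈ IsManifold.maximalAtlas 𝓘(ℂ, Fin m → ℂ) ω B :=
    fun t => IsManifold.chart_mem_maximalAtlas t
  have hsrc : ∀ t : B, t ∈ (chartAt (Fin m → ℂ) t).source := fun t => mem_chart_source _ t
  have hneg : ∀ (t : B) (ξ η : TangentSpace 𝓘(ℂ, Fin m → ℂ) t),
      (PoissonKahler.curvature (PoissonKahler.wpForm p Ω) t ξ η).re ≤ 0 := by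
    intro t ξ η
    obtain ⟨x, hx⟩ := PoissonKahler.exists_curvature_eq hsub hΩ' hproper t (hKS t) ξ η
    rw [hx, neg_nonpos]
    exact PoissonKahler.re_fibreIntegral_curvatureDensity_nonneg hsub (hmem t) hΩ' hproper _ _ _
      (OpenPartialHomeomorph.map_source _ (hsrc t))
  have hpos : ∀ (t : B) (ξ : TangentSpace 𝓘(ℂ, Fin m → ℂ) t), ξ ≠ 0 →
      0 < ((PoissonKahler.wpForm p Ω).herm t ξ ξ).re := by
    intro t ξ hξ
    rw [PoissonKahler.herm_wpForm hsub hΩ' hproper]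
    exact PoissonKahler.donaldsonFujiki_pos hsub (hmem t) hΩ' hproper (hsrc t) (hKS t) hξ
  refine ⟨PoissonKahler.fibreMeasure_lt_top hΩ' hproper hsub,
    PoissonKahler.isLocallyConstant_fibreVolume hsub hΩ' hproper,
    fun t => PoissonKahler.integrable_kappaInner hsub (hmem t) hΩ' hproper (hsrc t),
    PoissonKahler.wpForm p Ω, PoissonKahler.herm_wpForm hsub hΩ' hproper,
    PoissonKahler.isKahlerForm_wpForm hsub hΩ' hproper hKS, fun t ξ hξ => ?_, fun t ξ η hξ hη =>
      div_nonpos_of_nonpos_of_nonneg (hneg t ξ η) (mul_pos (hpos t ξ hξ) (hpos t η hη)).le⟩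
  obtain ⟨x, hx⟩ := PoissonKahler.exists_curvature_eq hsub hΩ' hproper t (hKS t) ξ ξ
  have h1 := PoissonKahler.re_fibreIntegral_curvatureDensity_ge hsub (hmem t) hΩ' hproper
    (mfderiv 𝓘(ℂ, Fin m → ℂ) 𝓘(ℂ, Fin m → ℂ) (chartAt (Fin m → ℂ) t) t ξ : Fin m → ℂ) x
    (OpenPartialHomeomorph.map_source _ (hsrc t))
  have h2 : (PoissonKahler.sesq (PoissonKahler.wpMatrix p Ω (chartAt (Fin m → ℂ) t)
      (chartAt (Fin m → ℂ) t t))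
      (mfderiv 𝓘(ℂ, Fin m → ℂ) 𝓘(ℂ, Fin m → ℂ) (chartAt (Fin m → ℂ) t) t ξ : Fin m → ℂ)
      (mfderiv 𝓘(ℂ, Fin m → ℂ) 𝓘(ℂ, Fin m → ℂ) (chartAt (Fin m → ℂ) t) t ξ : Fin m → ℂ)).re
      = ((PoissonKahler.wpForm p Ω).herm t ξ ξ).re := by
    rw [PoissonKahler.herm_wpForm hsub hΩ' hproper,
      PoissonKahler.donaldsonFujiki_eq hsub (hmem t) hΩ' hproper (hsrc t)]
  rw [OpenPartialHomeomorph.left_inv _ (hsrc t), h2] at h1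
  rw [PoissonKahler.sectionalCurvature, PoissonKahler.bisectionalCurvature, hx,
    div_le_iff₀ (mul_pos (hpos t ξ hξ) (hpos t ξ hξ))]
  linarith
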